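/- Let $V=\mathbb{C}^7$ with basis $x_1,\dots,x_7$, let $$\omega_0=x_1\wedge x_2\wedge x_3\wedge x_7+x_4\wedge x_5\wedge x_6\wedge x_7+x_2\wedge x_3\wedge x_5\wedge x_6+x_1\wedge x_3\wedge x_4\wedge x_6\in\textstyle\bigwedge^4V,$$ and let $\hat G_2\subset\mathbb{P}(\bigwedge^2V)=\mathbb{P}^{20}$ be the variety $$\hat G_2=\{[v\wedge w]\in G(2,V)\;:\; v\wedge w\wedge\omega_0=0\ \text{in}\ \textstyle\bigwedge^6V\}.$$ (1) The Hilbert scheme of projective 3-spaces (linear in $\mathbb{P}^{20}$) contained in $\hat G_2$ is a smooth conic. Precisely: let $H$ be the functor that sends a $\mathbb{C}$-algebra $R$ to the set of closed subschemes $Z\subset\hat G_2\times\operatorname{Spec}R$, flat over $R$, whose fibres are projective 3-spaces; that is, to the set of homogeneous ideals $I\subset R[p_{ij}: 1\le i<j\le 7]$ that contain the ideal of $\hat G_2$ and for which $(R[p_{ij}]/I)_d$ is locally free of rank $\binom{d+3}{3}$ for every $d\ge 0$. Then there are a plane in $\mathbb{P}(V)$ and a smooth conic $Q$ in it such that $H$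 is isomorphic to the functor of points of $Q$, in such a way that the point of $Q$ corresponding to a 3-space $\Pi\subset\hat G_2$ is a point $[v]\in\mathbb{P}(V)$ through which all the lines of $\mathbb{P}(V)$ parametrized by $\Pi$ pass. (2) The union $D$ of all projective 3-spaces contained in $\hat G_2$ is a divisor in $\hat G_2$ (a Zariski closed subset of $\hat G_2$, each of whose irreducible components has codimension one in $\hat G_2$), and $D$, with its reduced structure, has dimension $4$ and degree $8$ in $\mathbb{P}^{20}$. -/

import Mathlib

open scoped LinearAlgebra.Projectivization

noncomputable section

namespace G2hat

/-! ### The variety `Ĝ₂` in the Plücker space -/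

/-- The seven-dimensional vector space `V = ℂ⁷`. -/
abbrev V : Type := Fin 7 → ℂ

/-- The basis vector `x_{i+1}` of `V`, as an element of the exterior algebra of `V`. -/
def x (i : Fin 7) : ExteriorAlgebra ℂ V := ExteriorAlgebra.ι ℂ (Pi.single i (1 : ℂ) : V)

/-- The generic degenerate four-form
`ω₀ = x₁∧x₂∧x₃∧x₇ + x₄∧x₅∧x₆∧x₇ + x₂∧x₃∧x₅∧x₆ + x₁∧x₃∧x₄∧x₆`
(the basis vector `x_{i+1}` has index `i` here). -/
def omega0 : ExteriorAlgebra ℂ V :=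
  x 0 * x 1 * x 2 * x 6 + x 3 * x 4 * x 5 * x 6 + x 1 * x 2 * x 4 * x 5 + x 0 * x 2 * x 3 * x 5

/-- The index set of the Plücker coordinates: pairs `i < j` in `{0, …, 6}`. -/
abbrev PIdx : Type := {p : Fin 7 × Fin 7 // p.1 < p.2}

/-- The space `⋀² V`, in coordinates with respect to the basis `x_i ∧ x_j` (`i < j`). -/
abbrev W : Type := PIdx → ℂ

/-- The bivector `v ∧ w`, in coordinates with respect to the basis `x_i ∧ x_j` (`i < j`). -/
def wedge (v w : V) : W := fun p => v p.1.1 * w p.1.2 - v p.1.2 * w p.1.1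

/-- The variety `Ĝ₂ = {[v ∧ w] ∈ G(2, V) | v ∧ w ∧ ω₀ = 0 in ⋀⁶ V}`, as a subset of `ℙ(⋀² V)`. -/
def variety : Set (ℙ ℂ W) :=
  {p | ∃ (v w : V) (h : wedge v w ≠ 0), p = Projectivization.mk ℂ (wedge v w) h ∧
    ExteriorAlgebra.ι ℂ v * ExteriorAlgebra.ι ℂ w * omega0 = 0}

/-! ### Closed subsets of projective space: ideals, degree, divisors -/

/-- The ideal of a subset `Z` of projective space: all polynomials that vanish at every
representative of every point of `Z`. -/
def idealOf (Z : Set (ℙ ℂ W)) : Ideal (MvPolynomial PIdx ℂ) :=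
  MvPolynomial.vanishingIdeal ℂ {z : W | ∃ h : z ≠ 0, Projectivization.mk ℂ z h ∈ Z}

/-- `Z` is Zariski closed: it is the zero locus of a set of homogeneous polynomials. -/
def IsZariskiClosed (Z : Set (ℙ ℂ W)) : Prop :=
  ∃ T : Set (MvPolynomial PIdx ℂ), (∀ f ∈ T, ∃ d : ℕ, f.IsHomogeneous d) ∧
    Z = {p | ∀ f ∈ T, MvPolynomial.eval p.rep f = 0}

/-- The degree `d` part of `R[p_ij] / I`, for a homogeneous ideal `I`. -/
abbrev GradedPiece {R : Type} [CommRing R] (I : Ideal (MvPolynomial PIdx R)) (d : ℕ) : Type :=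
  MvPolynomial.homogeneousSubmodule PIdx R d ⧸
    (I.restrictScalars R).comap (MvPolynomial.homogeneousSubmodule PIdx R d).subtype

/-- The closed set `Z` has dimension `r` and degree `δ > 0`: the Hilbert function of its
homogeneous coordinate ring grows like `δ d ^ r / r!`, that is, its Hilbert polynomial has degree
`r` and leading coefficient `δ / r!`. -/
def HasDimDegree (Z : Set (ℙ ℂ W)) (r δ : ℕ) : Prop :=
  0 < δ ∧ Filter.Tendsto
    (fun d : ℕ => (r.factorial : ℝ) * (Module.finrank ℂ (GradedPiece (idealOf Z) d) : ℝ) /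
      (d : ℝ) ^ r) Filter.atTop (nhds (δ : ℝ))

/-- `D` is a (reduced effective Weil) divisor in `X`: a closed subset of `X` all of whose
irreducible components (which correspond to the minimal primes of the ideal of `D`) have
codimension one in `X`. -/
def IsDivisorIn (D X : Set (ℙ ℂ W)) : Prop :=
  IsZariskiClosed D ∧ D ⊆ X ∧ ∀ P ∈ (idealOf D).minimalPrimes,
    (P.map (Ideal.Quotient.mk (idealOf X))).height = 1

/-- The linear subspace of `ℙ(⋀² V)` attached to a vector subspace of `⋀² V`. -/
def linearSpace (L : Submodule ℂ W) : Set (ℙ ℂ W) := {p | p.submodule ≤ L}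

/-- The union of all the projective 3-spaces contained in `X`. -/
def unionOfP3 (X : Set (ℙ ℂ W)) : Set (ℙ ℂ W) :=
  {p | ∃ L : Submodule ℂ W, Module.finrank ℂ L = 4 ∧ linearSpace L ⊆ X ∧ p ∈ linearSpace L}

/-! ### The Hilbert functor of projective 3-spaces -/

/-- The `R`-valued points of the Hilbert scheme of projective 3-spaces contained in `X`: the
closed subschemes `Z` of `X ×_ℂ Spec R ⊆ ℙ(⋀² V) ×_ℂ Spec R` that are flat over `R` and whose
fibres have the Hilbert function `d ↦ (d + 3).choose 3` of a projective 3-space. `Z` is given by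
its homogeneous ideal; flatness means that the graded pieces of the homogeneous coordinate ring
are locally free, of the prescribed rank. -/
structure HilbP3 (X : Set (ℙ ℂ W)) (R : Type) [CommRing R] [Algebra ℂ R] where
  /-- The homogeneous ideal of the family. -/
  ideal : Ideal (MvPolynomial PIdx R)
  homogeneous : ∀ f ∈ ideal, ∀ d : ℕ, MvPolynomial.homogeneousComponent d f ∈ ideal
  projective : ∀ d : ℕ, Module.Projective R (GradedPiece ideal d)
  rank : ∀ (d : ℕ) (p : PrimeSpectrum R),
    Module.rankAtStalk (R := R) (GradedPiece ideal d) p = (d + 3).choose 3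
  contained : (idealOf X).map (MvPolynomial.map (algebraMap ℂ R)) ≤ ideal

/-- The `R`-valued points of the plane conic `{[v] ∈ ℙ² | vᵀ M v = 0}`: submodules `ℓ` of `R³`
such that `R³ / ℓ` is locally free of rank 2 (so `ℓ` is a line subbundle), on which the quadratic
form `vᵀ M v` vanishes. -/
structure ConicPoint (M : Matrix (Fin 3) (Fin 3) ℂ) (R : Type) [CommRing R] [Algebra ℂ R] where
  /-- The line subbundle. -/
  line : Module.Grassmannian R (Fin 3 → R) 2
  vanish : ∀ v ∈ line.toSubmodule, v ⬝ᵥ ((M.map (algebraMap ℂ R)).mulVec v) = 0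

end G2hat

end

/-!
The proof makes the symmetry of `ω₀` explicit. Let `A` and `B` be two-dimensional, and write
`V = S²B ⊕ A ⊗ B`, where `S²B` is spanned by the basis vectors with indices `2, 5, 6`. The
condition `v ∧ w ∧ ω₀ = 0` amounts to seven linear equations in the Plücker coordinates (`IsLin`,
`wedge_omega0_eq_zero_iff`), which leave the fourteen coordinates `q` on `S²A`, `y` on
`⋀²S²B = S²B`, and `(u, v)` on `A ⊗ S³B`. In these coordinates the Plücker quadrics say that `q`
and `(u, v)` have rank one, that `q y` is the Hessian of the cubics, and that `y` is apolar to them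
(`Rel`, `rel_of_pluPolar`).

*The 3-spaces.* For `b = (s, t)` in `B` the subspace `b·B ⊕ A ⊗ b³` of `S²B ⊕ A ⊗ S³B` consists of
bivectors divisible by `b² = (s², st, t²)` in `S²B` (`psi`, `psi_eq_wedge`), so it gives a 3-space
in the variety, all of whose lines pass through a point of a conic in `ℙ(S²B)`. Conversely, on a
linear subspace the polarized relations hold. Over a field they force `q = 0` on a 3-space
(`LinFamily.q_eq_zero`), and then one of two sets of four coordinates is a coordinate system on it
(`LinFamily.chart`). Over a local ring, a split family inherits such a coordinate system from its
special fibre, and then the relations leave a single free parameter (`LinFamily.normalForm`). So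
each such family is `psi s t` with `s = 1` or `t = 1` (`range_eq_range_psi`); no reducedness of the
base is used, which is what makes the Hilbert scheme smooth.

*The functor.* A family of 3-spaces over `R` has the same Hilbert function as the ideal generated
by its linear forms, hence is generated by them (`HilbP3.ideal_eq`); so it amounts to a submodule
of `R²¹` with locally free quotient of rank `4`. A point `ℓ ⊆ R³` of the conic is sent to the
linear forms `conicForms ℓ`, whose coefficients are linear in `ℓ`, and `ℓ` is recovered from them
by a linear map (`conicProj`). Whether these constructions are inverse to each other, and whether
they land where they should, can be tested at the local rings of `R`, where both sides are
parametrized by `(s, t)` (`hilbOfConic_surjective`, `hilbEquivConic`).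

*The divisor.* The union `D` of the 3-spaces is the locus `q = 0`, and the ideal of `D` is the
kernel of the substitution of the generic point `genPsi` of the 3-spaces, hence prime. Its height
modulo the ideal of the variety is at most one by Krull's theorem, because `D` is a component of
the locus `q₀ = 0` (`idealOf_unionOfP3_mem_minimalPrimes`). It is at least one because it strictly
contains the prime kernel of the substitution of a generic point `genChi` with `q ≠ 0`; the
containment holds because the points of `D` are limits of points of that kind
(`eval_psi_eq_zero_of_aeval_genChi`).

*The degree.* The substitution of `genPsi` turns the forms of degree `d` on `D` into polynomials in
`s, t, m, n, c, d` of a fixed bidegree. The monomials of that bidegree have some degree `k ≤ d` in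
`m, n`, degree `d - k` in `c, d` and degree `3d - 2k` in `s, t`, and all those with `k < d` occur
(`psiForms_le`, `le_psiForms`). So the Hilbert function of `D` is
`∑ k, (k + 1) (d - k + 1) (3d - 2k + 1)` up to terms of lower order, that is, it grows like
`d⁴ / 3 = 8 d⁴ / 4!`.
-/

set_option linter.flexible false
set_option linter.unnecessarySeqFocus false
set_option linter.unusedSectionVars false
set_option linter.unusedSimpArgs false

noncomputable section

namespace G2hat

open MvPolynomial

/-! ### Ideals generated by linear forms -/

section LinearIdeals

variable {σ τ R : Type} [Fintype σ] [Fintype τ] [DecidableEq σ] [DecidableEq τ] [CommRing R]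

/-- The linear form `∑ k, a k * X k` with coefficient vector `a`. -/
def linForm : (σ → R) →ₗ[R] MvPolynomial σ R := Fintype.linearCombination R X

lemma linForm_apply (a : σ → R) : linForm a = ∑ k, a k • (X k : MvPolynomial σ R) := rfl

@[simp] lemma linForm_single (k : σ) : linForm (Pi.single k (1 : R)) = X k := by
  simp [linForm_apply, Pi.single_apply]

lemma linForm_isHomogeneous (a : σ → R) : (linForm a).IsHomogeneous 1 := by
  rw [linForm_apply]
  refine IsHomogeneous.sum _ _ _ fun k _ => ?_
  rw [smul_eq_C_mul]
  exact isHomogeneous_C_mul_X _ _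

lemma coeff_linForm (a : σ → R) (k : σ) : coeff (Finsupp.single k 1) (linForm a) = a k := by
  simp [linForm_apply, coeff_sum, coeff_smul, coeff_X, Finsupp.single_left_inj]

lemma linForm_injective : Function.Injective (linForm : (σ → R) → MvPolynomial σ R) :=
  fun a b h => funext fun k => by rw [← coeff_linForm a, h, coeff_linForm]

lemma exists_linForm_eq {f : MvPolynomial σ R} (hf : f.IsHomogeneous 1) :
    ∃ a : σ → R, linForm a = f := by
  replace hf : f ∈ homogeneousSubmodule σ R 1 := hf
  rw [homogeneousSubmodule_one_eq_span_X] at hf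
  induction hf using Submodule.span_induction with
  | mem x h => obtain ⟨k, rfl⟩ := h; exact ⟨_, linForm_single k⟩
  | zero => exact ⟨0, map_zero _⟩
  | add x y _ _ hx hy =>
    obtain ⟨a, rfl⟩ := hx
    obtain ⟨b, rfl⟩ := hy
    exact ⟨a + b, map_add _ _ _⟩
  | smul r x _ hx => obtain ⟨a, rfl⟩ := hx; exact ⟨r • a, map_smul _ _ _⟩

lemma eval_linForm (z a : σ → R) : eval z (linForm a) = ∑ k, a k * z k := by
  simp [linForm_apply, smul_eq_C_mul]

/-- The ideal generated by the linear forms with coefficient vectors in `N`. -/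
def linIdeal (N : Submodule R (σ → R)) : Ideal (MvPolynomial σ R) :=
  Ideal.span (linForm '' (N : Set (σ → R)))

lemma linForm_mem_linIdeal {N : Submodule R (σ → R)} {a : σ → R} (ha : a ∈ N) :
    linForm a ∈ linIdeal N := Ideal.subset_span ⟨a, ha, rfl⟩

lemma linIdeal_span (T : Set (σ → R)) :
    linIdeal (Submodule.span R T) = Ideal.span (linForm '' T) := by
  apply le_antisymm
  · refine Ideal.span_le.2 ?_
    rintro _ ⟨a, ha, rfl⟩
    have h : Submodule.span R T ≤
        ((Ideal.span (linForm '' T)).restrictScalars R).comap (linForm (σ := σ) (R := R)) :=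
      Submodule.span_le.2 fun b hb => Ideal.subset_span ⟨b, hb, rfl⟩
    exact h ha
  · exact Ideal.span_mono (Set.image_mono Submodule.subset_span)

/-- The substitution `X k ↦ φ (e k)` attached to a linear map between spaces of linear forms. -/
def linSubst (φ : (σ → R) →ₗ[R] (τ → R)) : MvPolynomial σ R →ₐ[R] MvPolynomial τ R :=
  aeval fun k => linForm (φ (Pi.single k 1))

lemma linSubst_linForm (φ : (σ → R) →ₗ[R] (τ → R)) (a : σ → R) :
    linSubst φ (linForm a) = linForm (φ a) := by
  have : (linSubst φ).toLinearMap ∘ₗ linForm = linForm ∘ₗ φ := by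
    refine LinearMap.pi_ext' fun k => LinearMap.ext_ring ?_
    simp [linSubst]
  exact LinearMap.congr_fun this a

lemma linSubst_comp {υ : Type} [Fintype υ] [DecidableEq υ] (φ : (σ → R) →ₗ[R] (τ → R))
    (ψ : (τ → R) →ₗ[R] (υ → R)) (f : MvPolynomial σ R) :
    linSubst ψ (linSubst φ f) = linSubst (ψ ∘ₗ φ) f := by
  have : (linSubst ψ).comp (linSubst φ) = linSubst (ψ ∘ₗ φ) :=
    MvPolynomial.algHom_ext fun k => by
      rw [AlgHom.comp_apply, ← linForm_single, linSubst_linForm, linSubst_linForm,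
        linSubst_linForm, LinearMap.comp_apply]
  exact DFunLike.congr_fun this f

lemma linSubst_id (f : MvPolynomial σ R) : linSubst LinearMap.id f = f := by
  have : linSubst (LinearMap.id (R := R) (M := σ → R)) = AlgHom.id R _ :=
    MvPolynomial.algHom_ext fun k => by simp [linSubst]
  rw [this, AlgHom.id_apply]

lemma linSubst_isHomogeneous (φ : (σ → R) →ₗ[R] (τ → R)) {f : MvPolynomial σ R} {d : ℕ}
    (hf : f.IsHomogeneous d) : (linSubst φ f).IsHomogeneous d := by
  have := hf.aeval (fun k => linForm (φ (Pi.single k 1))) (n := 1)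
    fun k => linForm_isHomogeneous _
  rwa [one_mul] at this

/-- The substitution attached to `ρ` is the identity modulo `N` if `ρ` is. -/
lemma sub_linSubst_mem {N : Submodule R (σ → R)} {ρ : (σ → R) →ₗ[R] (σ → R)}
    (h : ∀ a, a - ρ a ∈ N) (f : MvPolynomial σ R) : f - linSubst ρ f ∈ linIdeal N := by
  have : Ideal.Quotient.mkₐ R (linIdeal N) =
      (Ideal.Quotient.mkₐ R (linIdeal N)).comp (linSubst ρ) :=
    MvPolynomial.algHom_ext fun k => by
      rw [AlgHom.comp_apply, ← linForm_single, linSubst_linForm]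
      refine Ideal.Quotient.eq.2 ?_
      rw [← map_sub]
      exact linForm_mem_linIdeal (h _)
  exact Ideal.Quotient.eq.1 (DFunLike.congr_fun this f)

/-- If `φ` kills `N` and is split modulo `N`, then the ideal generated by `N` is the kernel of the
substitution attached to `φ`. -/
lemma mem_linIdeal_iff {N : Submodule R (σ → R)} {φ : (σ → R) →ₗ[R] (τ → R)}
    {s : (τ → R) →ₗ[R] (σ → R)} (hN : ∀ a ∈ N, φ a = 0) (hs : ∀ a, a - s (φ a) ∈ N)
    (f : MvPolynomial σ R) : f ∈ linIdeal N ↔ linSubst φ f = 0 := by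
  constructor
  · intro hf
    have : linIdeal N ≤ RingHom.ker (linSubst φ) := Ideal.span_le.2 <| by
      rintro _ ⟨a, ha, rfl⟩
      simp [RingHom.mem_ker, linSubst_linForm, hN a ha]
    exact this hf
  · intro hf
    have := sub_linSubst_mem (N := N) (ρ := s ∘ₗ φ) hs f
    rwa [← linSubst_comp, hf, map_zero, sub_zero] at this

lemma homogeneousComponent_mem_linIdeal {N : Submodule R (σ → R)} {f : MvPolynomial σ R}
    (hf : f ∈ linIdeal N) (d : ℕ) : homogeneousComponent d f ∈ linIdeal N := by
  classical
  let _ := MvPolynomial.gradedAlgebra (σ := σ) (R := R)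
  have hh : (linIdeal N).IsHomogeneous (homogeneousSubmodule σ R) := by
    refine Ideal.homogeneous_span _ _ ?_
    rintro _ ⟨a, _, rfl⟩
    exact ⟨1, linForm_isHomogeneous a⟩
  exact homogeneousComponent_mem_of_mem hh hf d

/-- A projective quotient of the space of linear forms has a splitting. -/
lemma exists_projector (N : Submodule R (σ → R)) [Module.Projective R ((σ → R) ⧸ N)] :
    ∃ ρ : (σ → R) →ₗ[R] (σ → R), (∀ a ∈ N, ρ a = 0) ∧ ∀ a, a - ρ a ∈ N := by
  obtain ⟨s, hs⟩ := Module.projective_lifting_property N.mkQ LinearMap.id N.mkQ_surjective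
  refine ⟨s ∘ₗ N.mkQ, fun a ha => ?_, fun a => ?_⟩
  · simp [(Submodule.Quotient.mk_eq_zero N).2 ha]
  · rw [← Submodule.Quotient.mk_eq_zero, Submodule.Quotient.mk_sub, sub_eq_zero]
    exact (LinearMap.congr_fun hs (N.mkQ a)).symm

/-- A free quotient of rank `n` of the space of linear forms is given by a split surjection. -/
lemma exists_surjection (N : Submodule R (σ → R)) [Nontrivial R] [Module.Free R ((σ → R) ⧸ N)]
    {n : ℕ} (hn : Module.finrank R ((σ → R) ⧸ N) = n) :
    ∃ (φ : (σ → R) →ₗ[R] (Fin n → R)) (s : (Fin n → R) →ₗ[R] (σ → R)),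
      LinearMap.ker φ = N ∧ φ ∘ₗ s = LinearMap.id := by
  let b := Module.finBasisOfFinrankEq R _ hn
  let φ := b.equivFun.toLinearMap ∘ₗ N.mkQ
  obtain ⟨s, hs⟩ := Module.projective_lifting_property φ LinearMap.id
    (b.equivFun.surjective.comp N.mkQ_surjective)
  refine ⟨φ, s, ?_, hs⟩
  rw [LinearMap.ker_comp_of_ker_eq_bot _ b.equivFun.ker, Submodule.ker_mkQ]

lemma mem_linIdeal_ker_iff {φ : (σ → R) →ₗ[R] (τ → R)}
    {s : (τ → R) →ₗ[R] (σ → R)} (hs : φ ∘ₗ s = LinearMap.id) (f : MvPolynomial σ R) :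
    f ∈ linIdeal (LinearMap.ker φ) ↔ linSubst φ f = 0 := by
  refine mem_linIdeal_iff (s := s) (fun a ha => ha) (fun a => ?_) f
  rw [LinearMap.mem_ker, map_sub, sub_eq_zero]
  exact (LinearMap.congr_fun hs (φ a)).symm

/-- A linear form lies in the ideal generated by a split space of linear forms only if it lies in
that space. -/
lemma linForm_mem_linIdeal_iff {N : Submodule R (σ → R)} [Module.Projective R ((σ → R) ⧸ N)]
    {a : σ → R} : linForm a ∈ linIdeal N ↔ a ∈ N := by
  refine ⟨fun h => ?_, linForm_mem_linIdeal⟩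
  obtain ⟨ρ, h1, h2⟩ := exists_projector N
  rw [mem_linIdeal_iff h1 (s := LinearMap.id) h2, linSubst_linForm] at h
  have h0 : ρ a = 0 := linForm_injective (h.trans (map_zero _).symm)
  simpa [h0] using h2 a

lemma finrank_span_monomials {σ : Type} (R : Type) [CommRing R] [Nontrivial R]
    (S : Finset (σ →₀ ℕ)) :
    Module.finrank R (Submodule.span R ((fun m => (monomial m (1 : R))) '' (S : Set (σ →₀ ℕ)))) =
      S.card := by
  have hli : LinearIndependent R fun m : S => (monomial (m : σ →₀ ℕ) (1 : R)) := by
    have := (basisMonomials σ R).linearIndependent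
    rw [coe_basisMonomials] at this
    exact this.comp _ Subtype.val_injective
  have := finrank_span_eq_card hli
  rw [Fintype.card_coe] at this
  rw [← this, Set.image_eq_range]
  rfl

/-- The Hilbert function of `ℙⁿ`. -/
lemma finrank_homogeneousSubmodule_fin (R : Type) [CommRing R] [Nontrivial R] (n d : ℕ) :
    Module.finrank R (homogeneousSubmodule (Fin (n + 1)) R d) = (d + n).choose n := by
  classical
  have h := finrank_span_monomials R (Finset.univ.finsuppAntidiag d : Finset (Fin (n + 1) →₀ ℕ))
  rw [Finset.card_finsuppAntidiag_nat_eq_choose, Finset.card_univ, Fintype.card_fin] at h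
  rw [homogeneousSubmodule_eq_finsupp_supported, AddMonoidAlgebra.supported_eq_span_single]
  have e : ((Finset.univ.finsuppAntidiag d : Finset (Fin (n + 1) →₀ ℕ)) : Set _) =
      {e : Fin (n + 1) →₀ ℕ | e.degree = d} := by
    ext e; simp [Finset.mem_finsuppAntidiag, Finsupp.degree_eq_sum]
  rw [e] at h
  rw [show d + n = n + 1 + d - 1 by omega, ← Nat.choose_symm (n := n + 1 + d - 1) (k := n)
    (by omega), show n + 1 + d - 1 - n = d by omega]
  exact h

end LinearIdeals

/-! ### Graded pieces of the coordinate ring of a linear subspace -/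

section GradedPieces

variable {R τ : Type} [CommRing R] [Fintype τ] [DecidableEq τ]

lemma gradedPiece_mk_eq_zero {I : Ideal (MvPolynomial PIdx R)} {d : ℕ}
    (f : homogeneousSubmodule PIdx R d) :
    (Submodule.Quotient.mk f : GradedPiece I d) = 0 ↔ (f : MvPolynomial PIdx R) ∈ I := by
  rw [Submodule.Quotient.mk_eq_zero]; rfl

instance (I : Ideal (MvPolynomial PIdx R)) (d : ℕ) : Module.Finite R (GradedPiece I d) := by
  have : Module.Finite R (homogeneousSubmodule PIdx R d) :=
    Module.Finite.iff_fg.2 (homogeneousSubmodule_fg PIdx R d)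
  infer_instance

/-- The graded pieces of the ring of polynomial functions on a split linear subspace embed, as
direct summands, into a polynomial ring. -/
lemma gradedPiece_linIdeal_projective (N : Submodule R (PIdx → R))
    [Module.Projective R ((PIdx → R) ⧸ N)] (d : ℕ) :
    Module.Projective R (GradedPiece (linIdeal N) d) := by
  obtain ⟨ρ, h1, h2⟩ := exists_projector N
  let α : GradedPiece (linIdeal N) d →ₗ[R] MvPolynomial PIdx R :=
    Submodule.liftQ _ ((linSubst ρ).toLinearMap ∘ₗ (homogeneousSubmodule PIdx R d).subtype)
      fun f hf => (mem_linIdeal_iff h1 (s := LinearMap.id) h2 _).1 hf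
  let β : MvPolynomial PIdx R →ₗ[R] GradedPiece (linIdeal N) d :=
    Submodule.mkQ _ ∘ₗ (homogeneousComponent d).codRestrict (homogeneousSubmodule PIdx R d)
      (homogeneousComponent_mem d)
  refine Module.Projective.of_split α β (LinearMap.ext fun x => ?_)
  obtain ⟨f, rfl⟩ := Submodule.Quotient.mk_surjective _ x
  change (Submodule.Quotient.mk _ : GradedPiece (linIdeal N) d) = Submodule.Quotient.mk f
  rw [eq_comm, ← sub_eq_zero, ← Submodule.Quotient.mk_sub, gradedPiece_mk_eq_zero]
  have : homogeneousComponent d (linSubst ρ (f : MvPolynomial PIdx R)) = linSubst ρ f :=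
    homogeneousComponent_eq_self (linSubst_isHomogeneous ρ f.2)
  change (f : MvPolynomial PIdx R) - homogeneousComponent d (linSubst ρ f) ∈ _
  rw [this]
  exact sub_linSubst_mem h2 _

/-- The graded pieces of the coordinate ring of a linear subspace with coordinates indexed
by `τ`. -/
def gradedPieceKerEquiv {φ : (PIdx → R) →ₗ[R] (τ → R)}
    {s : (τ → R) →ₗ[R] (PIdx → R)} (hs : φ ∘ₗ s = LinearMap.id) (d : ℕ) :
    GradedPiece (linIdeal (LinearMap.ker φ)) d ≃ₗ[R] homogeneousSubmodule τ R d := by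
  let α : homogeneousSubmodule PIdx R d →ₗ[R] homogeneousSubmodule τ R d :=
    (linSubst φ).toLinearMap.restrict fun f hf => linSubst_isHomogeneous φ hf
  refine (Submodule.quotEquivOfEq _ (LinearMap.ker α) ?_).trans
    (α.quotKerEquivOfSurjective fun g => ?_)
  · ext f
    refine (mem_linIdeal_ker_iff hs (f : MvPolynomial PIdx R)).trans ?_
    rw [LinearMap.mem_ker, ← Subtype.coe_inj]
    rfl
  · refine ⟨⟨linSubst s g, linSubst_isHomogeneous s g.2⟩, Subtype.ext ?_⟩
    change linSubst φ (linSubst s (g : MvPolynomial τ R)) = g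
    rw [linSubst_comp, hs, linSubst_id]

end GradedPieces

/-! ### Localization of ideals and of graded pieces -/

section Localization

variable {R : Type} [CommRing R] (S : Submonoid R) (A : Type) [CommRing A] [Algebra R A]
  [IsLocalization S A]

/-- Localization of coefficient vectors. -/
def vecMap {ι : Type} : (ι → R) →ₗ[R] (ι → A) := .pi fun k => Algebra.linearMap R A ∘ₗ .proj k

instance {ι : Type} [Finite ι] : IsLocalizedModule S (vecMap (R := R) A (ι := ι)) :=
  inferInstanceAs (IsLocalizedModule S (.pi fun k : ι => Algebra.linearMap R A ∘ₗ .proj k))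

/-- Base change of a submodule of a coordinate space along a ring homomorphism. -/
def vecSpan {R A ι : Type} [CommRing R] [CommRing A] (f : R →+* A)
    (N : Submodule R (ι → R)) : Submodule A (ι → A) :=
  Submodule.span A ((fun a k => f (a k)) '' (N : Set (ι → R)))

lemma vecSpan_span {R A ι : Type} [CommRing R] [CommRing A] (f : R →+* A) (T : Set (ι → R)) :
    vecSpan f (Submodule.span R T) = Submodule.span A ((fun a k => f (a k)) '' T) := by
  let W := Submodule.span A ((fun (a : ι → R) k => f (a k)) '' T)
  have hW : ∀ a ∈ Submodule.span R T, (fun k => f (a k)) ∈ W := fun a ha => by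
    refine Submodule.span_induction (p := fun a _ => (fun k => f (a k)) ∈ W)
      (fun x h => Submodule.subset_span ⟨x, h, rfl⟩) ?_ (fun x y _ _ hx hy => ?_)
      (fun r x _ hx => ?_) ha
    · have : (fun k : ι => f ((0 : ι → R) k)) = 0 := funext fun k => map_zero f
      rw [this]
      exact W.zero_mem
    · have : (fun k => f ((x + y) k)) = (fun k => f (x k)) + fun k => f (y k) :=
        funext fun k => map_add f _ _
      rw [this]
      exact W.add_mem hx hy
    · have : (fun k => f ((r • x) k)) = f r • fun k => f (x k) := funext fun k => map_mul f _ _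
      rw [this]
      exact W.smul_mem _ hx
  apply le_antisymm
  · refine Submodule.span_le.2 ?_
    rintro _ ⟨a, ha, rfl⟩
    exact hW a ha
  · exact Submodule.span_mono (Set.image_mono Submodule.subset_span)

lemma vecSpan_comp {R A B ι : Type} [CommRing R] [CommRing A] [CommRing B] (f : R →+* A)
    (g : A →+* B) (N : Submodule R (ι → R)) :
    vecSpan g (vecSpan f N) = vecSpan (g.comp f) N := by
  change vecSpan g (Submodule.span A _) = _
  rw [vecSpan_span, Set.image_image]
  rfl

lemma map_linForm {R A σ : Type} [CommRing R] [CommRing A] [Fintype σ] [DecidableEq σ]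
    (f : R →+* A) (a : σ → R) :
    MvPolynomial.map f (linForm a) = linForm (fun k => f (a k)) := by
  simp only [linForm_apply, smul_eq_C_mul, map_sum, map_mul, map_C, map_X]

lemma map_linIdeal {R A σ : Type} [CommRing R] [CommRing A] [Fintype σ] [DecidableEq σ]
    (f : R →+* A) (N : Submodule R (σ → R)) :
    (linIdeal N).map (MvPolynomial.map f) = linIdeal (vecSpan f N) := by
  rw [vecSpan, linIdeal_span, linIdeal, Ideal.map_span, Set.image_image, Set.image_image]
  simp_rw [map_linForm]

lemma exists_smul_eq_map (f : MvPolynomial PIdx A) :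
    ∃ (g : MvPolynomial PIdx R) (s : S), (s : R) • f = MvPolynomial.map (algebraMap R A) g := by
  have _ := MvPolynomial.isLocalization (σ := PIdx) S A
  let _ := MvPolynomial.algebraMvPolynomial (σ := PIdx) (R := R) (S := A)
  obtain ⟨⟨g, ⟨_, s, hs, rfl⟩⟩, h⟩ := IsLocalization.surj (S.map (C (σ := PIdx) (R := R))) f
  refine ⟨g, ⟨s, hs⟩, ?_⟩
  rw [algebraMap_def] at h
  rw [← h, Algebra.smul_def, mul_comm]
  simp [MvPolynomial.algebraMap_eq, IsScalarTower.algebraMap_apply R A (MvPolynomial PIdx A)]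

/-- A polynomial lies in a localized ideal if and only if one of its multiples by the denominators
lies in the ideal. -/
lemma map_mem_map_iff {I : Ideal (MvPolynomial PIdx R)} (f : MvPolynomial PIdx R) :
    MvPolynomial.map (algebraMap R A) f ∈ I.map (MvPolynomial.map (algebraMap R A)) ↔
      ∃ s : S, (s : R) • f ∈ I := by
  let _ := MvPolynomial.algebraMvPolynomial (σ := PIdx) (R := R) (S := A)
  have _ := MvPolynomial.isLocalization (σ := PIdx) S A
  have := IsLocalization.algebraMap_mem_map_algebraMap_iff (S.map (C (σ := PIdx) (R := R)))
    (MvPolynomial PIdx A) I f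
  rw [algebraMap_def] at this
  rw [this]
  constructor
  · rintro ⟨_, ⟨s, hs, rfl⟩, h⟩
    exact ⟨⟨s, hs⟩, by rwa [smul_eq_C_mul]⟩
  · rintro ⟨s, h⟩
    exact ⟨C (s : R), ⟨s, s.2, rfl⟩, by rwa [← smul_eq_C_mul]⟩

/-- The localization map on graded pieces. -/
def gradedPieceMap (I : Ideal (MvPolynomial PIdx R)) (d : ℕ) :
    GradedPiece I d →ₗ[R] GradedPiece (I.map (MvPolynomial.map (algebraMap R A))) d :=
  Submodule.liftQ _
    (((Submodule.mkQ _).restrictScalars R) ∘ₗ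
      (((MvPolynomial.mapAlgHom (Algebra.ofId R A)).toLinearMap ∘ₗ
        (homogeneousSubmodule PIdx R d).subtype).codRestrict
          ((homogeneousSubmodule PIdx A d).restrictScalars R)
          fun f => IsHomogeneous.map f.2 (algebraMap R A)))
    fun f hf => (gradedPiece_mk_eq_zero (I := I.map (MvPolynomial.map (algebraMap R A)))
      ⟨MvPolynomial.map (algebraMap R A) f, _⟩).2 (Ideal.mem_map_of_mem _ hf)

lemma gradedPieceMap_mk (I : Ideal (MvPolynomial PIdx R)) (d : ℕ)
    (f : homogeneousSubmodule PIdx R d) :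
    gradedPieceMap A I d (Submodule.Quotient.mk f) = Submodule.Quotient.mk
      ⟨MvPolynomial.map (algebraMap R A) f, IsHomogeneous.map f.2 (algebraMap R A)⟩ := rfl

instance (I : Ideal (MvPolynomial PIdx R)) (d : ℕ) :
    IsLocalizedModule S (gradedPieceMap A I d) where
  map_units s := by
    have hu := IsLocalization.map_units A s
    rw [Module.End.isUnit_iff]
    have : (⇑((algebraMap R (Module.End R (GradedPiece
        (I.map (MvPolynomial.map (algebraMap R A))) d))) s)) =
        fun x => (algebraMap R A s) • x := by
      ext x; rw [Module.algebraMap_end_apply, algebraMap_smul]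
    rw [this]
    exact (hu.smul_bijective)
  surj y := by
    obtain ⟨⟨f, hf⟩, rfl⟩ := Submodule.Quotient.mk_surjective _ y
    obtain ⟨g, s, h⟩ := exists_smul_eq_map S A f
    refine ⟨⟨Submodule.Quotient.mk ⟨homogeneousComponent d g, homogeneousComponent_mem d g⟩, s⟩, ?_⟩
    rw [gradedPieceMap_mk]
    change Submodule.Quotient.mk ((s : R) • (⟨f, hf⟩ : homogeneousSubmodule PIdx A d)) = _
    congr 1
    refine Subtype.ext ?_
    change (s : R) • f = MvPolynomial.map (algebraMap R A) (homogeneousComponent d g)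
    rw [← homogeneousComponent_eq_self hf, ← (homogeneousComponent d).map_smul_of_tower, h]
    ext m
    simp only [coeff_map, coeff_homogeneousComponent]
    split_ifs <;> simp
  exists_of_eq {x y} h := by
    obtain ⟨f, rfl⟩ := Submodule.Quotient.mk_surjective _ x
    obtain ⟨g, rfl⟩ := Submodule.Quotient.mk_surjective _ y
    rw [← sub_eq_zero, ← map_sub, ← Submodule.Quotient.mk_sub, gradedPieceMap_mk,
      gradedPiece_mk_eq_zero] at h
    obtain ⟨s, hs⟩ := (map_mem_map_iff S A _).1 h
    refine ⟨s, ?_⟩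
    rw [← sub_eq_zero, ← smul_sub, ← Submodule.Quotient.mk_sub]
    exact (gradedPiece_mk_eq_zero ((s : R) • (f - g))).2 hs

end Localization

/-! ### Ranks at primes and local-to-global arguments -/

section Rank

variable {R : Type} [CommRing R]

lemma rankAtStalk_eq_finrank_of_isLocalizedModule {M M' : Type} [AddCommGroup M] [Module R M]
    (p : PrimeSpectrum R) [AddCommGroup M'] [Module R M']
    [Module (Localization.AtPrime p.asIdeal) M']
    [IsScalarTower R (Localization.AtPrime p.asIdeal) M'] (f : M →ₗ[R] M')
    [IsLocalizedModule p.asIdeal.primeCompl f] :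
    Module.rankAtStalk (R := R) M p = Module.finrank (Localization.AtPrime p.asIdeal) M' :=
  ((IsLocalizedModule.linearEquiv p.asIdeal.primeCompl
    (LocalizedModule.mkLinearMap p.asIdeal.primeCompl M) f).extendScalarsOfIsLocalization
      p.asIdeal.primeCompl (Localization.AtPrime p.asIdeal)).finrank_eq

/-- The localization map on the quotient of a coordinate space by `N`. -/
def quotMap {ι : Type} (A : Type) [CommRing A] [Algebra R A] (N : Submodule R (ι → R)) :
    ((ι → R) ⧸ N) →ₗ[R] ((ι → A) ⧸ vecSpan (algebraMap R A) N) :=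
  Submodule.mapQ N ((vecSpan (algebraMap R A) N).restrictScalars R) (vecMap A)
    fun a ha => Submodule.subset_span ⟨a, ha, rfl⟩

lemma localized'_eq_vecSpan {ι : Type} [Finite ι] (S : Submonoid R) (A : Type) [CommRing A]
    [Algebra R A] [IsLocalization S A] (N : Submodule R (ι → R)) :
    N.localized' A S (vecMap A) = vecSpan (algebraMap R A) N := Submodule.localized'_eq_span ..

instance {ι : Type} [Finite ι] (S : Submonoid R) (A : Type) [CommRing A] [Algebra R A]
    [IsLocalization S A] (N : Submodule R (ι → R)) : IsLocalizedModule S (quotMap A N) := by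
  have key : ∀ (P : Submodule A (ι → A)) (_ : N.localized' A S (vecMap A) = P)
      (hle : N ≤ (P.restrictScalars R).comap (vecMap A)),
      IsLocalizedModule S (Submodule.mapQ N (P.restrictScalars R) (vecMap A) hle) := by
    rintro _ rfl _
    exact IsLocalizedModule.toLocalizedQuotient' A S (vecMap (R := R) A) N
  exact key _ (localized'_eq_vecSpan S A N) _

/-- The structure map to the local ring at a prime. -/
abbrev toLocal (p : PrimeSpectrum R) : R →+* Localization.AtPrime p.asIdeal :=
  algebraMap R (Localization.AtPrime p.asIdeal)

/-- Submodules of coordinate spaces that agree at all primes are equal. -/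
lemma eq_of_vecSpan_eq {ι : Type} [Finite ι] {N N' : Submodule R (ι → R)}
    (h : ∀ p : PrimeSpectrum R, vecSpan (toLocal p) N = vecSpan (toLocal p) N') : N = N' := by
  refine Submodule.eq_of_localization₀_maximal (fun P _ => ι → Localization.AtPrime P)
    (fun P _ => vecMap (Localization.AtPrime P)) fun P hP => ?_
  have := h ⟨P, hP.isPrime⟩
  rw [← localized'_eq_vecSpan P.primeCompl, ← localized'_eq_vecSpan P.primeCompl] at this
  exact congrArg (Submodule.restrictScalars R) this

/-- A finitely generated submodule of a coordinate space has projective quotient of rank `n` if at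
every prime it is the kernel of a split surjection to a free module of rank `n`. -/
lemma projective_quotient_of_forall_prime {ι : Type} [Finite ι] {N : Submodule R (ι → R)}
    (hN : N.FG) {n : ℕ}
    (h : ∀ p : PrimeSpectrum R, ∃ φ : (ι → Localization.AtPrime p.asIdeal)
        →ₗ[Localization.AtPrime p.asIdeal] (Fin n → Localization.AtPrime p.asIdeal),
      Function.Surjective φ ∧ LinearMap.ker φ = vecSpan (toLocal p) N) :
    Module.Projective R ((ι → R) ⧸ N) ∧
      ∀ p : PrimeSpectrum R, Module.rankAtStalk (R := R) ((ι → R) ⧸ N) p = n := by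
  have e : ∀ p : PrimeSpectrum R, Nonempty (((ι → Localization.AtPrime p.asIdeal) ⧸
      vecSpan (toLocal p) N) ≃ₗ[Localization.AtPrime p.asIdeal]
      (Fin n → Localization.AtPrime p.asIdeal)) := fun p => by
    obtain ⟨φ, h1, h2⟩ := h p
    exact ⟨(Submodule.quotEquivOfEq _ _ h2.symm).trans (φ.quotKerEquivOfSurjective h1)⟩
  constructor
  · have : Module.FinitePresentation R ((ι → R) ⧸ N) :=
      Module.finitePresentation_of_surjective N.mkQ N.mkQ_surjective (by rwa [Submodule.ker_mkQ])
    refine Module.projective_of_localization_maximal' (fun P _ => Localization.AtPrime P)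
      (fun P hP => (ι → Localization.AtPrime P) ⧸
        vecSpan (toLocal (⟨P, Ideal.IsMaximal.isPrime ‹_›⟩ : PrimeSpectrum R)) N)
      (fun P _ => quotMap (Localization.AtPrime P) N) fun P hP => ?_
    exact Module.Projective.of_equiv (e ⟨P, hP.isPrime⟩).some.symm
  · intro p
    rw [rankAtStalk_eq_finrank_of_isLocalizedModule p
      (quotMap (Localization.AtPrime p.asIdeal) N), (e p).some.finrank_eq]
    simp

/-- At a prime, a locally free quotient of rank `n` of a coordinate space is cut out by a split
surjection onto a free module. -/
lemma exists_surjection_atPrime {ι : Type} [Fintype ι] [DecidableEq ι] (N : Submodule R (ι → R))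
    (p : PrimeSpectrum R) [Module.Projective R ((ι → R) ⧸ N)] {n : ℕ}
    (hn : Module.rankAtStalk (R := R) ((ι → R) ⧸ N) p = n) :
    ∃ (φ : (ι → Localization.AtPrime p.asIdeal) →ₗ[Localization.AtPrime p.asIdeal]
        (Fin n → Localization.AtPrime p.asIdeal))
      (s : (Fin n → Localization.AtPrime p.asIdeal) →ₗ[Localization.AtPrime p.asIdeal]
        (ι → Localization.AtPrime p.asIdeal)),
      LinearMap.ker φ = vecSpan (toLocal p) N ∧ φ ∘ₗ s = LinearMap.id := by
  let A := Localization.AtPrime p.asIdeal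
  have : Module.Projective A ((ι → A) ⧸ vecSpan (toLocal p) N) :=
    Module.projective_of_isLocalizedModule p.asIdeal.primeCompl (quotMap A N)
  have : Module.Free A ((ι → A) ⧸ vecSpan (toLocal p) N) := Module.free_of_flat_of_isLocalRing
  refine exists_surjection _ ?_
  rw [← hn]
  exact (rankAtStalk_eq_finrank_of_isLocalizedModule p (quotMap A N)).symm

/-- A linear ideal with locally free quotient of rank `n + 1` in degree one has the Hilbert function
of `ℙⁿ` at every prime. -/
lemma rankAtStalk_gradedPiece_linIdeal (N : Submodule R (PIdx → R)) (p : PrimeSpectrum R)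
    [Module.Projective R ((PIdx → R) ⧸ N)] {n : ℕ}
    (hn : Module.rankAtStalk (R := R) ((PIdx → R) ⧸ N) p = n + 1) (d : ℕ) :
    Module.rankAtStalk (R := R) (GradedPiece (linIdeal N) d) p = (d + n).choose n := by
  obtain ⟨φ, s, h1, h2⟩ := exists_surjection_atPrime N p hn
  rw [rankAtStalk_eq_finrank_of_isLocalizedModule p
    (gradedPieceMap (Localization.AtPrime p.asIdeal) (linIdeal N) d), map_linIdeal, ← h1,
    (gradedPieceKerEquiv h2 d).finrank_eq, finrank_homogeneousSubmodule_fin]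

/-- Membership in an ideal of polynomials can be tested at the primes of the ring of
coefficients. -/
lemma mem_of_forall_map_mem {I : Ideal (MvPolynomial PIdx R)} {f : MvPolynomial PIdx R}
    (h : ∀ p : PrimeSpectrum R, MvPolynomial.map (toLocal p) f ∈
      I.map (MvPolynomial.map (toLocal p))) : f ∈ I := by
  -- the ideal of denominators `{r | r • f ∈ I}` is contained in no maximal ideal
  let J : Ideal R := (Submodule.restrictScalars R I).comap (LinearMap.toSpanSingleton R _ f)
  suffices J = ⊤ by simpa [J] using J.eq_top_iff_one.mp this
  refine Not.imp_symm J.exists_le_maximal fun ⟨P, hP, le⟩ => ?_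
  obtain ⟨s, hs⟩ := (map_mem_map_iff P.primeCompl (Localization.AtPrime P) f).1
    (h ⟨P, hP.isPrime⟩)
  exact s.2 (le hs)

end Rank

/-! ### Coordinates adapted to the decomposition of the bivectors -/

section Coordinates

variable {A : Type} [CommRing A]

/-- The index of the Plücker coordinate `p_ij`. -/
abbrev ix (i j : Fin 7) (h : i < j := by decide) : PIdx := ⟨(i, j), h⟩

/-- A statement about all Plücker coordinates can be checked on the `21` coordinates. -/
lemma PIdx.forall_of {P : PIdx → Prop}
    (h : P (ix 0 1) ∧ P (ix 0 2) ∧ P (ix 0 3) ∧ P (ix 0 4) ∧ P (ix 0 5) ∧ P (ix 0 6) ∧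
      P (ix 1 2) ∧ P (ix 1 3) ∧ P (ix 1 4) ∧ P (ix 1 5) ∧ P (ix 1 6) ∧ P (ix 2 3) ∧ P (ix 2 4) ∧
      P (ix 2 5) ∧ P (ix 2 6) ∧ P (ix 3 4) ∧ P (ix 3 5) ∧ P (ix 3 6) ∧ P (ix 4 5) ∧ P (ix 4 6) ∧
      P (ix 5 6)) (k : PIdx) : P k := by
  obtain ⟨h1, h2, h3, h4, h5, h6, h7, h8, h9, h10, h11, h12, h13, h14, h15, h16, h17, h18, h19,
    h20, h21⟩ := h
  obtain ⟨⟨i, j⟩, hij⟩ := k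
  fin_cases i <;> fin_cases j <;> first | exact absurd hij (by decide) | assumption

/-- The seven linear equations of the variety. -/
structure IsLin (z : PIdx → A) : Prop where
  h01 : z (ix 0 1) = 0
  h34 : z (ix 3 4) = 0
  h14 : z (ix 1 4) = -z (ix 0 3)
  h36 : z (ix 3 6) = -z (ix 1 2)
  h46 : z (ix 4 6) = z (ix 0 2)
  h45 : z (ix 4 5) = -z (ix 0 6)
  h35 : z (ix 3 5) = z (ix 1 6)

/-- The polarization of the Plücker quadric `p_ij p_kl - p_ik p_jl + p_il p_jk`. -/
def pluPolar (z w : PIdx → A) (i j k l : Fin 7) (hij : i < j := by decide)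
    (hjk : j < k := by decide) (hkl : k < l := by decide) : A :=
  z (ix i j hij) * w (ix k l hkl) + w (ix i j hij) * z (ix k l hkl)
    - z (ix i k (hij.trans hjk)) * w (ix j l (hjk.trans hkl))
    - w (ix i k (hij.trans hjk)) * z (ix j l (hjk.trans hkl))
    + z (ix i l (hij.trans (hjk.trans hkl))) * w (ix j k hjk)
    + w (ix i l (hij.trans (hjk.trans hkl))) * z (ix j k hjk)

/-- The coordinates `q` on the summand `S²A` of `⋀²V`, where `V = S²B ⊕ A ⊗ B`. -/
def qc : (PIdx → A) →ₗ[A] (Fin 3 → A) where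
  toFun z := ![z (ix 0 4), z (ix 0 3), -z (ix 1 3)]
  map_add' z w := by ext k; fin_cases k <;> simp; ring
  map_smul' r z := by ext k; fin_cases k <;> simp

/-- The coordinates `y` on the summand `⋀²S²B = S²B` of `⋀²V`. -/
def yc : (PIdx → A) →ₗ[A] (Fin 3 → A) where
  toFun z := ![-z (ix 2 6), z (ix 2 5), -z (ix 5 6)]
  map_add' z w := by ext k; fin_cases k <;> simp <;> ring
  map_smul' r z := by ext k; fin_cases k <;> simp

/-- The first binary cubic of the coordinates on the summand `A ⊗ S³B` of `⋀²V`. -/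
def uc : (PIdx → A) →ₗ[A] (Fin 4 → A) where
  toFun z := ![z (ix 2 4), -z (ix 0 2), -z (ix 0 6), z (ix 0 5)]
  map_add' z w := by ext k; fin_cases k <;> simp <;> ring
  map_smul' r z := by ext k; fin_cases k <;> simp

/-- The second binary cubic of the coordinates on the summand `A ⊗ S³B` of `⋀²V`. -/
def vc : (PIdx → A) →ₗ[A] (Fin 4 → A) where
  toFun z := ![z (ix 2 3), z (ix 1 2), z (ix 1 6), -z (ix 1 5)]
  map_add' z w := by ext k; fin_cases k <;> simp <;> ring
  map_smul' r z := by ext k; fin_cases k <;> simp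

/-- The polarized quadratic relations between the coordinates of points of the variety. For a
binary cubic `u`, the quadric `u₀u₂ - u₁², u₀u₃ - u₁u₂, u₁u₃ - u₂²` is its Hessian. So `disc` and
`minor` say that `q` and `(u, v)` have rank one, `qu0` and `qu1` that they have the same factor in
`A`, the relations `qy` that `q ⊗ y` is the Hessian of `(u, v)`, and `uy`, `vy` that `y` is apolar
to both cubics. -/
structure Rel (q y : Fin 3 → A) (u v : Fin 4 → A) (q' y' : Fin 3 → A) (u' v' : Fin 4 → A) :
    Prop where
  disc : q 0 * q' 2 + q' 0 * q 2 = 2 * (q 1 * q' 1)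
  qu0 : ∀ j, q 0 * v' j + q' 0 * v j = q 1 * u' j + q' 1 * u j
  qu1 : ∀ j, q 1 * v' j + q' 1 * v j = q 2 * u' j + q' 2 * u j
  qy00 : q 0 * y' 0 + q' 0 * y 0 = u 0 * u' 2 + u' 0 * u 2 - 2 * (u 1 * u' 1)
  qy01 : q 0 * y' 1 + q' 0 * y 1 = u 0 * u' 3 + u' 0 * u 3 - (u 1 * u' 2 + u' 1 * u 2)
  qy02 : q 0 * y' 2 + q' 0 * y 2 = u 1 * u' 3 + u' 1 * u 3 - 2 * (u 2 * u' 2)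
  qy10 : q 1 * y' 0 + q' 1 * y 0 = u 0 * v' 2 + u' 0 * v 2 - (u 1 * v' 1 + u' 1 * v 1)
  qy11 : q 1 * y' 1 + q' 1 * y 1 = u 0 * v' 3 + u' 0 * v 3 - (u 1 * v' 2 + u' 1 * v 2)
  qy12 : q 1 * y' 2 + q' 1 * y 2 = u 1 * v' 3 + u' 1 * v 3 - (u 2 * v' 2 + u' 2 * v 2)
  qy20 : q 2 * y' 0 + q' 2 * y 0 = v 0 * v' 2 + v' 0 * v 2 - 2 * (v 1 * v' 1)
  qy21 : q 2 * y' 1 + q' 2 * y 1 = v 0 * v' 3 + v' 0 * v 3 - (v 1 * v' 2 + v' 1 * v 2)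
  qy22 : q 2 * y' 2 + q' 2 * y 2 = v 1 * v' 3 + v' 1 * v 3 - 2 * (v 2 * v' 2)
  minor : ∀ j k, u j * v' k + u' j * v k = u k * v' j + u' k * v j
  uy0 : u 0 * y' 2 + u' 0 * y 2 - (u 1 * y' 1 + u' 1 * y 1) + (u 2 * y' 0 + u' 2 * y 0) = 0
  uy1 : u 1 * y' 2 + u' 1 * y 2 - (u 2 * y' 1 + u' 2 * y 1) + (u 3 * y' 0 + u' 3 * y 0) = 0
  vy0 : v 0 * y' 2 + v' 0 * y 2 - (v 1 * y' 1 + v' 1 * y 1) + (v 2 * y' 0 + v' 2 * y 0) = 0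
  vy1 : v 1 * y' 2 + v' 1 * y 2 - (v 2 * y' 1 + v' 2 * y 1) + (v 3 * y' 0 + v' 3 * y 0) = 0

/-- The relations are the Plücker quadrics after elimination of seven coordinates by the linear
equations. For `qy11` and for the outer `minor` several quadrics have to be combined. -/
lemma rel_of_pluPolar {z w : PIdx → A} (hz : IsLin z) (hw : IsLin w)
    (h : ∀ (i j k l : Fin 7) (hij : i < j) (hjk : j < k) (hkl : k < l),
      pluPolar z w i j k l hij hjk hkl = 0) :
    Rel (qc z) (yc z) (uc z) (vc z) (qc w) (yc w) (uc w) (vc w) := by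
  have H : ∀ (i j k l : Fin 7) (hij : i < j := by decide) (hjk : j < k := by decide)
    (hkl : k < l := by decide), pluPolar z w i j k l hij hjk hkl = 0 := h
  simp only [pluPolar] at H
  obtain ⟨z1, z2, z3, z4, z5, z6, z7⟩ := hz
  obtain ⟨w1, w2, w3, w4, w5, w6, w7⟩ := hw
  constructor
  case disc =>
    have := H 0 1 3 4
    simp [qc, z1, z2, z3, w1, w2, w3] at this ⊢
    linear_combination -this
  case qu0 =>
    have h0 := H 0 2 3 4
    have h1 := H 0 1 2 4
    have h2 := H 0 1 4 6
    have h3 := H 0 1 4 5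
    simp only [z1, z2, z3, z4, z5, z6, z7, w1, w2, w3, w4, w5, w6, w7] at h0 h1 h2 h3
    intro j
    fin_cases j <;> simp [qc, uc, vc]
    · linear_combination h0
    · linear_combination h1
    · linear_combination -h2
    · linear_combination h3
  case qu1 =>
    have h0 := H 1 2 3 4
    have h1 := H 0 1 2 3
    have h2 := H 0 1 3 6
    have h3 := H 0 1 3 5
    simp only [z1, z2, z3, z4, z5, z6, z7, w1, w2, w3, w4, w5, w6, w7] at h0 h1 h2 h3
    intro j
    fin_cases j <;> simp [qc, uc, vc]
    · linear_combination -h0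
    · linear_combination h1
    · linear_combination -h2
    · linear_combination h3
  case minor =>
    have h01 := H 2 3 4 6
    have h02 := H 2 3 4 5
    have h03a := H 0 2 3 5
    have h03b := H 1 2 4 5
    have h12a := H 0 1 2 6
    have h13 := H 0 1 2 5
    have h23 := H 0 1 5 6
    simp only [z1, z2, z3, z4, z5, z6, z7, w1, w2, w3, w4, w5, w6, w7]
      at h01 h02 h03a h03b h12a h13 h23
    intro j k
    fin_cases j <;> fin_cases k <;> simp [uc, vc]
    · linear_combination h01
    · linear_combination -h02
    · linear_combination -h03a - h03b - h12a
    · linear_combination -h01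
    · linear_combination h12a
    · linear_combination -h13
    · linear_combination h02
    · linear_combination -h12a
    · linear_combination h23
    · linear_combination h03a + h03b + h12a
    · linear_combination h13
    · linear_combination -h23
  case qy11 =>
    have h1 := H 1 2 4 5
    have h2 := H 0 1 2 6
    simp only [z1, z2, z3, z4, z5, z6, z7, w1, w2, w3, w4, w5, w6, w7] at h1 h2
    simp [qc, yc, uc, vc]
    linear_combination h1 + h2
  case qy00 =>
    have h1 := H 0 2 4 6
    simp only [z1, z2, z3, z4, z5, z6, z7, w1, w2, w3, w4, w5, w6, w7] at h1
    simp [qc, yc, uc]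
    linear_combination h1
  case qy01 =>
    have h1 := H 0 2 4 5
    simp only [z1, z2, z3, z4, z5, z6, z7, w1, w2, w3, w4, w5, w6, w7] at h1
    simp [qc, yc, uc]
    linear_combination -h1
  case qy02 =>
    have h1 := H 0 4 5 6
    simp only [z1, z2, z3, z4, z5, z6, z7, w1, w2, w3, w4, w5, w6, w7] at h1
    simp [qc, yc, uc]
    linear_combination -h1
  case qy10 =>
    have h1 := H 1 2 4 6
    simp only [z1, z2, z3, z4, z5, z6, z7, w1, w2, w3, w4, w5, w6, w7] at h1
    simp [qc, yc, uc, vc]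
    linear_combination -h1
  case qy12 =>
    have h1 := H 1 4 5 6
    simp only [z1, z2, z3, z4, z5, z6, z7, w1, w2, w3, w4, w5, w6, w7] at h1
    simp [qc, yc, uc, vc]
    linear_combination h1
  case qy20 =>
    have h1 := H 1 2 3 6
    simp only [z1, z2, z3, z4, z5, z6, z7, w1, w2, w3, w4, w5, w6, w7] at h1
    simp [qc, yc, vc]
    linear_combination -h1
  case qy21 =>
    have h1 := H 1 2 3 5
    simp only [z1, z2, z3, z4, z5, z6, z7, w1, w2, w3, w4, w5, w6, w7] at h1
    simp [qc, yc, vc]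
    linear_combination h1
  case qy22 =>
    have h1 := H 1 3 5 6
    simp only [z1, z2, z3, z4, z5, z6, z7, w1, w2, w3, w4, w5, w6, w7] at h1
    simp [qc, yc, vc]
    linear_combination h1
  case uy0 =>
    have h1 := H 2 4 5 6
    simp only [z1, z2, z3, z4, z5, z6, z7, w1, w2, w3, w4, w5, w6, w7] at h1
    simp [yc, uc]
    linear_combination -h1
  case uy1 =>
    have h1 := H 0 2 5 6
    simp [yc, uc]
    linear_combination h1
  case vy0 =>
    have h1 := H 2 3 5 6
    simp only [z1, z2, z3, z4, z5, z6, z7, w1, w2, w3, w4, w5, w6, w7] at h1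
    simp [yc, vc]
    linear_combination -h1
  case vy1 =>
    have h1 := H 1 2 5 6
    simp [yc, vc]
    linear_combination -h1

/-- Points satisfying the linear equations are determined by their `14` coordinates. -/
lemma IsLin.ext {z w : PIdx → A} (hz : IsLin z) (hw : IsLin w) (hq : qc z = qc w)
    (hy : yc z = yc w) (hu : uc z = uc w) (hv : vc z = vc w) : z = w := by
  obtain ⟨z1, z2, z3, z4, z5, z6, z7⟩ := hz
  obtain ⟨w1, w2, w3, w4, w5, w6, w7⟩ := hw
  simp [qc, yc, uc, vc] at hq hy hu hv
  funext k
  revert k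
  refine PIdx.forall_of ?_
  simp [*]

end Coordinates

/-! ### Linear subspaces of the variety, over a field -/

section Field

variable {κ E : Type} [Field κ] [CharZero κ] [AddCommGroup E] [Module κ E]

/-- A family of linear coordinate functions on `E` on which all polarized relations hold, and which
separates points: a linear subspace `ℙ(E)` of the variety. -/
structure LinFamily {A E : Type} [CommRing A] [AddCommGroup E] [Module A E]
    (q y : E →ₗ[A] (Fin 3 → A)) (u v : E →ₗ[A] (Fin 4 → A)) : Prop where
  rel : ∀ e f, Rel (q e) (y e) (u e) (v e) (q f) (y f) (u f) (v f)
  sep : ∀ e, q e = 0 → y e = 0 → u e = 0 → v e = 0 → e = 0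

/-- The coordinates with the basis of `A` interchanged. -/
lemma LinFamily.swap {A E : Type} [CommRing A] [AddCommGroup E] [Module A E]
    {q y : E →ₗ[A] (Fin 3 → A)} {u v : E →ₗ[A] (Fin 4 → A)} (h : LinFamily q y u v) :
    LinFamily (LinearMap.funLeft A A Fin.rev ∘ₗ q) y v u where
  rel e f := by
    have m := (h.rel e f).minor
    have := h.rel e f
    constructor <;> try simp [LinearMap.funLeft_apply, Fin.rev]
    · linear_combination this.disc
    · intro j; linear_combination -this.qu1 j
    · intro j; linear_combination -this.qu0 j
    · linear_combination this.qy20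
    · linear_combination this.qy21
    · linear_combination this.qy22
    · linear_combination this.qy10 + m 0 2
    · linear_combination this.qy11 + m 0 3 - m 1 2
    · linear_combination this.qy12 + m 1 3
    · linear_combination this.qy00
    · linear_combination this.qy01
    · linear_combination this.qy02
    · intro j k; linear_combination m k j
    · linear_combination this.vy0
    · linear_combination this.vy1
    · linear_combination this.uy0
    · linear_combination this.uy1
  sep e hq hy hu hv := h.sep e (by
    funext k
    have := congrFun hq (Fin.rev k)
    simpa [LinearMap.funLeft_apply] using this) hy hv hu

/-- The coordinates with the basis of `B` interchanged. -/
lemma LinFamily.rev {A E : Type} [CommRing A] [AddCommGroup E] [Module A E]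
    {q y : E →ₗ[A] (Fin 3 → A)} {u v : E →ₗ[A] (Fin 4 → A)} (h : LinFamily q y u v) :
    LinFamily q (LinearMap.funLeft A A Fin.rev ∘ₗ y) (LinearMap.funLeft A A Fin.rev ∘ₗ u)
      (LinearMap.funLeft A A Fin.rev ∘ₗ v) where
  rel e f := by
    have m := (h.rel e f).minor
    have := h.rel e f
    constructor <;> try simp [LinearMap.funLeft_apply, Fin.rev]
    · linear_combination this.disc
    · intro j; exact this.qu0 _
    · intro j; exact this.qu1 _
    · linear_combination this.qy02
    · linear_combination this.qy01
    · linear_combination this.qy00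
    · linear_combination this.qy12 + m 1 3
    · linear_combination this.qy11 + m 0 3 - m 1 2
    · linear_combination this.qy10 + m 0 2
    · linear_combination this.qy22
    · linear_combination this.qy21
    · linear_combination this.qy20
    · intro j k; exact m _ _
    · linear_combination this.uy1
    · linear_combination this.uy0
    · linear_combination this.vy1
    · linear_combination this.vy0
  sep e hq hy hu hv := h.sep e hq
    (by funext k; simpa [LinearMap.funLeft_apply] using congrFun hy (Fin.rev k))
    (by funext k; simpa [LinearMap.funLeft_apply] using congrFun hu (Fin.rev k))
    (by funext k; simpa [LinearMap.funLeft_apply] using congrFun hv (Fin.rev k))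

variable {q y : E →ₗ[κ] (Fin 3 → κ)} {u v : E →ₗ[κ] (Fin 4 → κ)}

lemma exists_ne_zero_of_lt_finrank {n : ℕ} (hn : n < Module.finrank κ E)
    (f : E →ₗ[κ] (Fin n → κ)) : ∃ e, e ≠ 0 ∧ f e = 0 := by
  have : Module.Finite κ E := Module.finite_of_finrank_pos (by omega)
  have h := LinearMap.ker_ne_bot_of_finrank_lt (f := f) (by simpa using hn)
  obtain ⟨e, he, h0⟩ := (Submodule.ne_bot_iff _).1 h
  exact ⟨e, h0, he⟩

/-- On a 3-space in the variety the first coordinate `q₀` vanishes. Otherwise some nonzero point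
has `q₀ = u₀ = u₃ = 0`, and the relations, polarized with a point where `q₀ ≠ 0`, force all its
coordinates to vanish. -/
lemma LinFamily.q0_eq_zero (h : LinFamily q y u v) (hE : 3 < Module.finrank κ E) (e : E) :
    q e 0 = 0 := by
  by_contra h0
  obtain ⟨f, hf, hf0⟩ := exists_ne_zero_of_lt_finrank (n := 3) hE
    (LinearMap.pi ![LinearMap.proj 0 ∘ₗ q, LinearMap.proj 0 ∘ₗ u, LinearMap.proj 3 ∘ₗ u])
  have q0 : q f 0 = 0 := congrFun hf0 0
  have u0 : u f 0 = 0 := congrFun hf0 1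
  have u3 : u f 3 = 0 := congrFun hf0 2
  have r := h.rel f f
  have s := h.rel e f
  have q1 : q f 1 = 0 := by
    have := r.disc
    rw [q0] at this
    simpa using this
  have q2 : q f 2 = 0 := by
    have := s.disc
    rw [q0, q1] at this
    simpa [h0] using this
  have u1 : u f 1 = 0 := by
    have := r.qy00
    rw [q0, u0] at this
    simpa using this
  have u2 : u f 2 = 0 := by
    have := r.qy02
    rw [q0, u3] at this
    simpa using this
  have hu : u f = 0 := by
    funext k; fin_cases k <;> assumption
  refine hf (h.sep f ?_ ?_ hu ?_)
  · funext k; fin_cases k <;> assumption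
  · have y0 := s.qy00
    have y1 := s.qy01
    have y2 := s.qy02
    simp [hu, q0, h0] at y0 y1 y2
    funext k; fin_cases k <;> assumption
  · funext j
    have := s.qu0 j
    simpa [hu, q0, q1, h0] using this

/-- On a 3-space in the variety the coordinates `q` vanish: `q₂` by the symmetry that interchanges
the basis of `A`, and `q₁` because `q₁² = q₀ q₂`. -/
lemma LinFamily.q_eq_zero (h : LinFamily q y u v) (hE : 3 < Module.finrank κ E) (e : E) :
    q e = 0 := by
  have q0 := h.q0_eq_zero hE e
  have q2 : q e 2 = 0 := h.swap.q0_eq_zero hE e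
  have q1 : q e 1 = 0 := by
    have := (h.rel e e).disc
    rw [q0] at this
    simpa using this
  funext k; fin_cases k <;> assumption

/-- On a 3-space in the variety, one of the two families of four coordinates separates points. They
are the charts around the subspaces `psi 1 0` and `psi 0 1`. -/
lemma LinFamily.chart (h : LinFamily q y u v) (hE : 3 < Module.finrank κ E) :
    (∀ e, y e 0 = 0 → y e 1 = 0 → u e 0 = 0 → v e 0 = 0 → e = 0) ∨
    (∀ e, y e 2 = 0 → y e 1 = 0 → u e 3 = 0 → v e 3 = 0 → e = 0) := by
  have hq := h.q_eq_zero hE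
  by_cases H : ∃ z, u z 0 = 0 ∧ v z 0 = 0 ∧ (u z 3 ≠ 0 ∨ v z 3 ≠ 0)
  · right
    obtain ⟨z, u0, v0, hz⟩ := H
    have r := h.rel z z
    have u1 : u z 1 = 0 := by simpa [hq, u0] using r.qy00
    have v1 : v z 1 = 0 := by simpa [hq, v0] using r.qy20
    have u2 : u z 2 = 0 := by simpa [hq, u1] using r.qy02
    have v2 : v z 2 = 0 := by simpa [hq, v1] using r.qy22
    -- The cubics at `z` are multiples of the cube of the second basis vector of `B`, and the
    -- polarized relations transport this to the whole space.
    have y0 : y z 0 = 0 := by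
      have a := r.uy1
      have b := r.vy1
      simp [u1, u2, v1, v2] at a b
      rcases hz with hz | hz <;> simp_all
    intro e ye2 ye1 ue3 ve3
    have s := h.rel e z
    have t := h.swap.rel e z
    have c1 := s.qy01
    have c2 := s.qy02
    have c3 := s.minor 0 3
    have c4 := s.minor 1 3
    have c5 := s.qy21
    have c6 := s.qy22
    have c7 := s.uy1
    have c8 := s.vy1
    simp [hq, u0, v0, u1, v1, u2, v2, y0, ue3, ve3] at c1 c2 c3 c4 c5 c6 c7 c8
    have d := h.rel e e
    have d1 := d.qy02
    have d2 := d.qy22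
    simp [hq, ue3, ve3] at d1 d2
    rcases hz with hz | hz
    all_goals
      simp [hz] at c1 c2 c3 c4 c5 c6 c7 c8
      refine h.sep e (hq e) ?_ ?_ ?_
      all_goals funext k; fin_cases k <;> simp_all
  · left
    push Not at H
    intro e y0 y1 u0 v0
    obtain ⟨u3, v3⟩ := H e u0 v0
    have r := h.rel e e
    have u1 : u e 1 = 0 := by simpa [hq, u0] using r.qy00
    have v1 : v e 1 = 0 := by simpa [hq, v0] using r.qy20
    have u2 : u e 2 = 0 := by simpa [hq, u1, u3] using r.qy02
    have v2 : v e 2 = 0 := by simpa [hq, v1, v3] using r.qy22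
    have hu : u e = 0 := by funext k; fin_cases k <;> assumption
    have hv : v e = 0 := by funext k; fin_cases k <;> assumption
    by_contra he
    have y2 : y e 2 ≠ 0 := fun y2 => he (h.sep e (hq e)
      (by funext k; fin_cases k <;> assumption) hu hv)
    -- Otherwise `u` and `v` vanish identically, and three coordinates `y` cannot separate points.
    obtain ⟨f, hf, hf0⟩ := exists_ne_zero_of_lt_finrank (n := 3) hE y
    have s := h.rel e f
    have a0 := s.uy0
    have b0 := s.vy0
    simp [hu, hv, hf0, y0, y1, y2] at a0 b0
    obtain ⟨f3, g3⟩ := H f a0 b0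
    have r := h.rel f f
    have u1 : u f 1 = 0 := by simpa [hq, a0] using r.qy00
    have v1 : v f 1 = 0 := by simpa [hq, b0] using r.qy20
    have u2 : u f 2 = 0 := by simpa [hq, u1, f3] using r.qy02
    have v2 : v f 2 = 0 := by simpa [hq, v1, g3] using r.qy22
    exact hf (h.sep f (hq f) hf0 (by funext k; fin_cases k <;> assumption)
      (by funext k; fin_cases k <;> assumption))

end Field

/-! ### Normal form of a linear family -/

section Chart

variable {A : Type} [CommRing A]

/-- The explicit shape of a linear family normalized by the coordinates `y₀, y₁, u₀, v₀`. The
parameter is `t = u₁(b₂)` for the standard basis `b`, and the relations between pairs of basis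
vectors determine all the other coordinates. -/
lemma LinFamily.normalForm (h2 : IsUnit (2 : A)) {q y : (Fin 4 → A) →ₗ[A] (Fin 3 → A)}
    {u v : (Fin 4 → A) →ₗ[A] (Fin 4 → A)} (h : LinFamily q y u v)
    (y0 : ∀ e, y e 0 = e 0) (y1 : ∀ e, y e 1 = e 1) (u0 : ∀ e, u e 0 = e 2)
    (v0 : ∀ e, v e 0 = e 3) :
    ∃ t : A, ∀ e, q e = 0 ∧ y e = ![e 0, e 1, t * e 1 - t ^ 2 * e 0] ∧
      u e = ![e 2, t * e 2, t ^ 2 * e 2, t ^ 3 * e 2] ∧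
      v e = ![e 3, t * e 3, t ^ 2 * e 3, t ^ 3 * e 3] := by
  have two : ∀ a : A, 2 * a = 0 → a = 0 := fun a ha => h2.mul_right_eq_zero.1 ha
  let b : Fin 4 → Fin 4 → A := fun i => Pi.single i 1
  have v2 : ∀ j, v (b 2) j = 0 := fun j => two _ <| by
    have := (h.rel (b 2) (b 2)).minor 0 j
    simp [u0, v0, b] at this
    linear_combination this
  have u3 : ∀ j, u (b 3) j = 0 := fun j => two _ <| by
    have := (h.rel (b 3) (b 3)).minor 0 j
    simp [u0, v0, b] at this
    linear_combination -this
  -- the cubics `u` and `v` are multiples of the same cubic `u (b 2)`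
  have ve : ∀ e j, v e j = u (b 2) j * e 3 := fun e j => by
    have := (h.rel e (b 2)).minor 0 j
    simp [u0, v0, v2, show b 2 2 = 1 from rfl, show b 2 3 = 0 from rfl] at this
    linear_combination this
  have ue : ∀ e j, u e j = u (b 2) j * e 2 := fun e j => by
    have := (h.rel e (b 3)).minor 0 j
    simp [u0, v0, u3, ve (b 3), show b 3 2 = 0 from rfl, show b 3 3 = 1 from rfl] at this
    linear_combination -this
  have ub : u (b 0) = 0 := funext fun j => by rw [ue]; simp [b]
  have vb : v (b 0) = 0 := funext fun j => by rw [ve]; simp [b]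
  have yb : y (b 0) 0 = 1 := by rw [y0]; simp [b]
  have qb0 : q (b 0) 0 = 0 := two _ <| by
    have := (h.rel (b 0) (b 0)).qy00
    simp [ub, yb] at this
    linear_combination this
  have qb1 : q (b 0) 1 = 0 := two _ <| by
    have := (h.rel (b 0) (b 0)).qy10
    simp [ub, vb, yb] at this
    linear_combination this
  have qb2 : q (b 0) 2 = 0 := two _ <| by
    have := (h.rel (b 0) (b 0)).qy20
    simp [vb, yb] at this
    linear_combination this
  -- the Hessian of `u (b 2)` vanishes, so `u (b 2)` is the cube of `(1, t)`
  have t0 : u (b 2) 0 = 1 := by rw [u0]; simp [b]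
  have t2 : u (b 2) 2 = u (b 2) 1 ^ 2 := by
    have := (h.rel (b 2) (b 2)).qy00
    have hq := (h.rel (b 2) (b 0)).qy00
    simp [ub, yb, qb0] at hq
    rw [hq, t0] at this
    refine sub_eq_zero.1 (two _ ?_)
    linear_combination -this
  have t3 : u (b 2) 3 = u (b 2) 1 ^ 3 := by
    have := (h.rel (b 2) (b 2)).qy01
    have hq := (h.rel (b 2) (b 0)).qy00
    simp [ub, yb, qb0] at hq
    rw [hq, t0, t2] at this
    refine sub_eq_zero.1 (two _ ?_)
    linear_combination -this
  have yb2 : y (b 2) 2 = 0 := two _ <| by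
    have := (h.rel (b 2) (b 2)).uy0
    simp [y0, y1, t0, show b 2 0 = 0 from rfl, show b 2 1 = 0 from rfl] at this
    linear_combination this
  refine ⟨u (b 2) 1, fun e => ⟨?_, ?_, ?_, ?_⟩⟩
  · have hq0 := (h.rel e (b 0)).qy00
    have hq1 := (h.rel e (b 0)).qy10
    have hq2 := (h.rel e (b 0)).qy20
    simp [ub, vb, yb, qb0, qb1, qb2] at hq0 hq1 hq2
    funext k; fin_cases k <;> assumption
  · have := (h.rel e (b 2)).uy0
    simp [y0, y1, t0, t2, yb2, show b 2 0 = 0 from rfl, show b 2 1 = 0 from rfl] at this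
    funext k; fin_cases k <;> simp [y0, y1]
    linear_combination this
  · funext j; fin_cases j <;> simp [ue e, t0, t2, t3]
  · funext j; fin_cases j <;> simp [ve e, t0, t2, t3]

end Chart

/-! ### The standard 3-spaces -/

section Psi

variable {A : Type} [CommRing A]

/-- The point of `⋀²V` with given coordinates that satisfies the linear equations of the
variety. -/
def ofCoords (q y : Fin 3 → A) (u v : Fin 4 → A) : PIdx → A := fun k =>
  !![0, 0, -u 1, q 1, q 0, u 3, -u 2;
     0, 0, v 1, -q 2, -q 1, -v 3, v 2;
     0, 0, 0, v 0, u 0, y 1, -y 0;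
     0, 0, 0, 0, 0, v 2, -v 1;
     0, 0, 0, 0, 0, u 2, -u 1;
     0, 0, 0, 0, 0, 0, -y 2;
     0, 0, 0, 0, 0, 0, 0] k.1.1 k.1.2

section
variable (q y : Fin 3 → A) (u v : Fin 4 → A)

lemma isLin_ofCoords : IsLin (ofCoords q y u v) := by
  constructor <;> simp [ofCoords]

@[simp] lemma qc_ofCoords : qc (ofCoords q y u v) = q := by
  funext k; fin_cases k <;> simp [ofCoords, qc]

@[simp] lemma yc_ofCoords : yc (ofCoords q y u v) = y := by
  funext k; fin_cases k <;> simp [ofCoords, yc]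

@[simp] lemma uc_ofCoords : uc (ofCoords q y u v) = u := by
  funext k; fin_cases k <;> simp [ofCoords, uc]

@[simp] lemma vc_ofCoords : vc (ofCoords q y u v) = v := by
  funext k; fin_cases k <;> simp [ofCoords, vc]

end

lemma isLin_iff_eq_ofCoords {z : PIdx → A} :
    IsLin z ↔ z = ofCoords (qc z) (yc z) (uc z) (vc z) :=
  ⟨fun h => h.ext (isLin_ofCoords ..) (by simp) (by simp) (by simp) (by simp),
    fun h => h ▸ isLin_ofCoords ..⟩

/-- The parametrization of the 3-space `b·B ⊕ A ⊗ b³` for `b = (s, t)`: the point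
`(b·(m, n), (c, d) ⊗ b³)`, as a function of `(m, n, c, d)`. -/
def psi (s t : A) : (Fin 4 → A) →ₗ[A] (PIdx → A) where
  toFun e := ofCoords 0 ![s * e 0, s * e 1 + t * e 0, t * e 1]
    ![s ^ 3 * e 2, s ^ 2 * t * e 2, s * t ^ 2 * e 2, t ^ 3 * e 2]
    ![s ^ 3 * e 3, s ^ 2 * t * e 3, s * t ^ 2 * e 3, t ^ 3 * e 3]
  map_add' e f := by
    funext k; revert k
    refine PIdx.forall_of ?_
    simp [ofCoords]
    refine ⟨?_, ?_, ?_, ?_, ?_, ?_, ?_, ?_, ?_, ?_, ?_, ?_, ?_, ?_, ?_⟩ <;> ring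
  map_smul' r f := by
    funext k; revert k
    refine PIdx.forall_of ?_
    simp [ofCoords]
    refine ⟨?_, ?_, ?_, ?_, ?_, ?_, ?_, ?_, ?_, ?_, ?_, ?_, ?_, ?_, ?_⟩ <;> ring

lemma psi_apply (s t : A) (e : Fin 4 → A) :
    psi s t e = ofCoords 0 ![s * e 0, s * e 1 + t * e 0, t * e 1]
    ![s ^ 3 * e 2, s ^ 2 * t * e 2, s * t ^ 2 * e 2, t ^ 3 * e 2]
    ![s ^ 3 * e 3, s ^ 2 * t * e 3, s * t ^ 2 * e 3, t ^ 3 * e 3] := rfl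

lemma Rel.map {B : Type} [CommRing B] (f : A →+* B) {q y : Fin 3 → A} {u v : Fin 4 → A}
    {q' y' : Fin 3 → A} {u' v' : Fin 4 → A} (h : Rel q y u v q' y' u' v') :
    Rel (f ∘ q) (f ∘ y) (f ∘ u) (f ∘ v) (f ∘ q') (f ∘ y') (f ∘ u') (f ∘ v') := by
  constructor
  case disc => simpa [map_ofNat f 2] using congrArg f h.disc
  case qu0 => exact fun j => by simpa using congrArg f (h.qu0 j)
  case qu1 => exact fun j => by simpa using congrArg f (h.qu1 j)
  case qy00 => simpa [map_ofNat f 2] using congrArg f h.qy00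
  case qy01 => simpa using congrArg f h.qy01
  case qy02 => simpa [map_ofNat f 2] using congrArg f h.qy02
  case qy10 => simpa using congrArg f h.qy10
  case qy11 => simpa using congrArg f h.qy11
  case qy12 => simpa using congrArg f h.qy12
  case qy20 => simpa [map_ofNat f 2] using congrArg f h.qy20
  case qy21 => simpa using congrArg f h.qy21
  case qy22 => simpa [map_ofNat f 2] using congrArg f h.qy22
  case minor => exact fun j k => by simpa using congrArg f (h.minor j k)
  case uy0 => simpa using congrArg f h.uy0
  case uy1 => simpa using congrArg f h.uy1
  case vy0 => simpa using congrArg f h.vy0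
  case vy1 => simpa using congrArg f h.vy1

lemma IsLin.map {B : Type} [CommRing B] (f : A →+* B) {z : PIdx → A} (h : IsLin z) :
    IsLin (f ∘ z) := by
  obtain ⟨z1, z2, z3, z4, z5, z6, z7⟩ := h
  constructor <;> simp [*]

lemma qc_map {B : Type} [CommRing B] (f : A →+* B) (z : PIdx → A) : qc (f ∘ z) = f ∘ qc z := by
  funext k; fin_cases k <;> simp [qc]
lemma yc_map {B : Type} [CommRing B] (f : A →+* B) (z : PIdx → A) : yc (f ∘ z) = f ∘ yc z := by
  funext k; fin_cases k <;> simp [yc]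
lemma uc_map {B : Type} [CommRing B] (f : A →+* B) (z : PIdx → A) : uc (f ∘ z) = f ∘ uc z := by
  funext k; fin_cases k <;> simp [uc]
lemma vc_map {B : Type} [CommRing B] (f : A →+* B) (z : PIdx → A) : vc (f ∘ z) = f ∘ vc z := by
  funext k; fin_cases k <;> simp [vc]

end Psi

/-! ### Classification of linear families over local rings -/

section Reduction

variable {A : Type} [CommRing A] {ι ι' : Type} [Fintype ι] [DecidableEq ι]

/-- Base change of a linear map between coordinate spaces. -/
def redMap {B : Type} [CommRing B] (f : A →+* B) (g : (ι → A) →ₗ[A] (ι' → A)) :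
    (ι → B) →ₗ[B] (ι' → B) :=
  Matrix.mulVecLin ((LinearMap.toMatrix' g).map f)

lemma redMap_apply {B : Type} [CommRing B] (f : A →+* B) (g : (ι → A) →ₗ[A] (ι' → A))
    (e : ι → A) : redMap f g (f ∘ e) = f ∘ g e := by
  funext i
  rw [redMap, Matrix.mulVecLin_apply, ← RingHom.map_mulVec, ← Matrix.toLin'_apply,
    Matrix.toLin'_toMatrix']
  rfl

variable [IsLocalRing A]

/-- An endomorphism of a free module over a local ring that is injective modulo the maximal ideal
is bijective. -/
lemma bijective_of_residue_injective (T : (ι → A) →ₗ[A] (ι → A))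
    (h : ∀ e : ι → A, (∀ i, IsLocalRing.residue A (T e i) = 0) →
      ∀ i, IsLocalRing.residue A (e i) = 0) : Function.Bijective T := by
  let M := LinearMap.toMatrix' T
  have hdet : IsUnit M.det := by
    rw [← IsLocalRing.residue_ne_zero_iff_isUnit, RingHom.map_det]
    intro h0
    obtain ⟨w, hw, hw0⟩ := Matrix.exists_mulVec_eq_zero_iff.2 h0
    obtain ⟨e, rfl⟩ : ∃ e : ι → A, IsLocalRing.residue A ∘ e = w :=
      (Function.Surjective.comp_left IsLocalRing.residue_surjective) w
    refine hw (funext fun i => h e (fun i => ?_) i)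
    have := redMap_apply (IsLocalRing.residue A) T e
    rw [redMap, Matrix.mulVecLin_apply] at this
    exact (congrFun this i).symm.trans (congrFun hw0 i)
  have : IsUnit T := by
    rw [LinearMap.isUnit_iff_isUnit_det, ← LinearMap.det_toMatrix']
    exact hdet
  exact (Module.End.isUnit_iff T).1 this

variable {q y : (Fin 4 → A) →ₗ[A] (Fin 3 → A)} {u v : (Fin 4 → A) →ₗ[A] (Fin 4 → A)}

lemma LinFamily.comp {E E' : Type} [AddCommGroup E] [Module A E] [AddCommGroup E'] [Module A E']
    {q y : E →ₗ[A] (Fin 3 → A)} {u v : E →ₗ[A] (Fin 4 → A)} (h : LinFamily q y u v)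
    (T : E' ≃ₗ[A] E) :
    LinFamily (q ∘ₗ T.toLinearMap) (y ∘ₗ T.toLinearMap) (u ∘ₗ T.toLinearMap)
      (v ∘ₗ T.toLinearMap) where
  rel e f := h.rel (T e) (T f)
  sep e h1 h2 h3 h4 := T.map_eq_zero_iff.1 (h.sep (T e) h1 h2 h3 h4)

/-- Over a local ring, a linear family whose special fibre is normalizable by the first four
coordinates has an explicit shape after a change of basis. -/
lemma LinFamily.exists_normalForm (h2 : IsUnit (2 : A)) (h : LinFamily q y u v)
    (hs : ∀ e : Fin 4 → A, IsLocalRing.residue A (y e 0) = 0 → IsLocalRing.residue A (y e 1) = 0 →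
      IsLocalRing.residue A (u e 0) = 0 → IsLocalRing.residue A (v e 0) = 0 →
      ∀ i, IsLocalRing.residue A (e i) = 0) :
    ∃ (T : (Fin 4 → A) ≃ₗ[A] (Fin 4 → A)) (t : A), ∀ e, q (T e) = 0 ∧
      y (T e) = ![e 0, e 1, t * e 1 - t ^ 2 * e 0] ∧
      u (T e) = ![e 2, t * e 2, t ^ 2 * e 2, t ^ 3 * e 2] ∧
      v (T e) = ![e 3, t * e 3, t ^ 2 * e 3, t ^ 3 * e 3] := by
  let S : (Fin 4 → A) →ₗ[A] (Fin 4 → A) := LinearMap.pi ![LinearMap.proj 0 ∘ₗ y,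
    LinearMap.proj 1 ∘ₗ y, LinearMap.proj 0 ∘ₗ u, LinearMap.proj 0 ∘ₗ v]
  have hS : Function.Bijective S := bijective_of_residue_injective S fun e he =>
    hs e (he 0) (he 1) (he 2) (he 3)
  let T := (LinearEquiv.ofBijective S hS).symm
  have hT : ∀ e, S (T e) = e := (LinearEquiv.ofBijective S hS).apply_symm_apply
  obtain ⟨t, ht⟩ := (h.comp T).normalForm h2 (fun e => congrFun (hT e) 0)
    (fun e => congrFun (hT e) 1) (fun e => congrFun (hT e) 2) (fun e => congrFun (hT e) 3)
  exact ⟨T, t, ht⟩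

/-- Over a local ring, every split linear family of dimension four on which the equations of the
variety hold is one of the families `psi s t`. The chart is found on the special fibre. -/
theorem range_eq_range_psi [Algebra ℂ A] (P : (Fin 4 → A) →ₗ[A] (PIdx → A))
    (σ : (PIdx → A) →ₗ[A] (Fin 4 → A)) (hσ : σ ∘ₗ P = LinearMap.id) (hlin : ∀ e, IsLin (P e))
    (hrel : ∀ e f, Rel (qc (P e)) (yc (P e)) (uc (P e)) (vc (P e))
      (qc (P f)) (yc (P f)) (uc (P f)) (vc (P f))) :
    ∃ s t : A, (s = 1 ∨ t = 1) ∧ LinearMap.range P = LinearMap.range (psi s t) := by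
  let κ := IsLocalRing.ResidueField A
  let π := IsLocalRing.residue A
  have hc : CharZero κ := charZero_of_injective_algebraMap (algebraMap ℂ κ).injective
  have h2 : IsUnit (2 : A) := by
    have : IsUnit (2 : ℂ) := by simp
    have := this.map (algebraMap ℂ A)
    rwa [map_ofNat] at this
  have hz : ∀ z : PIdx → A, IsLin z → qc z = 0 → yc z = 0 → uc z = 0 → vc z = 0 → z = 0 :=
    fun z h h3 h4 h5 h6 => h.ext (w := 0) (by constructor <;> simp) (by simpa using h3)
      (by simpa using h4) (by simpa using h5) (by simpa using h6)
  have hzκ : ∀ z : PIdx → κ, IsLin z → qc z = 0 → yc z = 0 → uc z = 0 → vc z = 0 → z = 0 :=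
    fun z h h3 h4 h5 h6 => h.ext (w := 0) (by constructor <;> simp) (by simpa using h3)
      (by simpa using h4) (by simpa using h5) (by simpa using h6)
  have hA : LinFamily (qc ∘ₗ P) (yc ∘ₗ P) (uc ∘ₗ P) (vc ∘ₗ P) := by
    refine ⟨hrel, fun e h3 h4 h5 h6 => ?_⟩
    have := LinearMap.congr_fun hσ e
    rw [LinearMap.comp_apply, hz _ (hlin e) h3 h4 h5 h6, map_zero] at this
    exact this.symm
  have hlift : ∀ w : Fin 4 → κ, ∃ e : Fin 4 → A, π ∘ e = w :=
    Function.Surjective.comp_left IsLocalRing.residue_surjective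
  have hκ : LinFamily (redMap π (qc ∘ₗ P)) (redMap π (yc ∘ₗ P)) (redMap π (uc ∘ₗ P))
      (redMap π (vc ∘ₗ P)) := by
    refine ⟨fun e f => ?_, fun e h3 h4 h5 h6 => ?_⟩
    · obtain ⟨e, rfl⟩ := hlift e
      obtain ⟨f, rfl⟩ := hlift f
      simp only [redMap_apply]
      exact (hrel e f).map π
    · obtain ⟨e, rfl⟩ := hlift e
      simp only [redMap_apply] at h3 h4 h5 h6
      have h0 : π ∘ P e = 0 := hzκ _ ((hlin e).map π) (by rw [qc_map]; exact h3)
        (by rw [yc_map]; exact h4) (by rw [uc_map]; exact h5) (by rw [vc_map]; exact h6)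
      have := redMap_apply π σ (P e)
      rw [h0, map_zero, ← LinearMap.comp_apply, hσ] at this
      exact this.symm
  rcases hκ.chart (by simp) with H | H
  · obtain ⟨T, t, hT⟩ := hA.exists_normalForm h2 fun e h3 h4 h5 h6 => by
      have := H (π ∘ e)
      simp only [redMap_apply] at this
      exact congrFun (this h3 h4 h5 h6)
    -- `y₂ = t y₁ - t² y₀` means that `y` is `(1, t)` times `(y₀, y₁ - t y₀)`
    have key : ∀ e, P (T e) = psi 1 t ![e 0, e 1 - t * e 0, e 2, e 3] := fun e => by
      obtain ⟨h3, h4, h5, h6⟩ := hT e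
      refine (hlin _).ext (isLin_ofCoords ..) ?_ ?_ ?_ ?_
      · simpa [psi_apply] using h3
      · simp only [psi_apply, yc_ofCoords]
        refine Eq.trans h4 ?_
        funext k; fin_cases k <;> simp
        ring
      · simpa [psi_apply] using h5
      · simpa [psi_apply] using h6
    refine ⟨1, t, Or.inl rfl, le_antisymm ?_ ?_⟩
    · rintro _ ⟨e, rfl⟩
      rw [← T.apply_symm_apply e, key]
      exact ⟨_, rfl⟩
    · rintro _ ⟨e, rfl⟩
      refine ⟨T ![e 0, e 1 + t * e 0, e 2, e 3], ?_⟩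
      rw [key]
      congr 1
      funext k; fin_cases k <;> simp
  · obtain ⟨T, t, hT⟩ := hA.rev.exists_normalForm h2 fun e h3 h4 h5 h6 => by
      have := H (π ∘ e)
      simp only [redMap_apply] at this
      exact congrFun (this h3 h4 h5 h6)
    have key : ∀ e, P (T e) = psi t 1 ![e 1 - t * e 0, e 0, e 2, e 3] := fun e => by
      obtain ⟨h3, h4, h5, h6⟩ := hT e
      have rv : ∀ {n : ℕ} (k : Fin n) (f g : Fin n → A), LinearMap.funLeft A A Fin.rev f = g →
        f k = g (Fin.rev k) := fun k f g h => by
          rw [← h]; simp [LinearMap.funLeft_apply]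
      refine (hlin _).ext (isLin_ofCoords ..) ?_ ?_ ?_ ?_
      · simpa [psi_apply] using h3
      · simp only [psi_apply, yc_ofCoords]
        funext k
        refine (rv k _ _ h4).trans ?_
        fin_cases k <;> simp [Fin.rev]
        ring
      · simp only [psi_apply, uc_ofCoords]
        funext k
        refine (rv k _ _ h5).trans ?_
        fin_cases k <;> simp [Fin.rev]
      · simp only [psi_apply, vc_ofCoords]
        funext k
        refine (rv k _ _ h6).trans ?_
        fin_cases k <;> simp [Fin.rev]
    refine ⟨t, 1, Or.inr rfl, le_antisymm ?_ ?_⟩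
    · rintro _ ⟨e, rfl⟩
      rw [← T.apply_symm_apply e, key]
      exact ⟨_, rfl⟩
    · rintro _ ⟨e, rfl⟩
      refine ⟨T ![e 1, e 0 + t * e 1, e 2, e 3], ?_⟩
      rw [key]
      congr 1
      funext k; fin_cases k <;> simp

end Reduction

/-! ### The linear equations of the variety -/

section Exterior

lemma x_mul_self (i : Fin 7) : x i * x i = 0 := ExteriorAlgebra.ι_sq_zero _

lemma x_mul_self_mul (i : Fin 7) (a : ExteriorAlgebra ℂ V) : x i * (x i * a) = 0 := by
  rw [← mul_assoc, x_mul_self, zero_mul]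

lemma x_mul_comm (i j : Fin 7) (_ : j < i) : x i * x j = -(x j * x i) :=
  eq_neg_of_add_eq_zero_left (ExteriorAlgebra.ι_add_mul_swap _ _)

lemma x_mul_comm_mul (i j : Fin 7) (h : j < i) (a : ExteriorAlgebra ℂ V) :
    x i * (x j * a) = -(x j * (x i * a)) := by
  rw [← mul_assoc, x_mul_comm i j h, neg_mul, mul_assoc]

lemma ι_eq_sum (v : V) : ExteriorAlgebra.ι ℂ v = ∑ i, v i • x i := by
  conv_lhs => rw [pi_eq_sum_univ' v]
  rw [map_sum]
  refine Finset.sum_congr rfl fun i _ => ?_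
  rw [map_smul]; rfl

/-- The wedge product with `ω₀`: its coefficients are the seven linear equations. -/
lemma ι_mul_ι_mul_omega0 (v w : V) :
    ExteriorAlgebra.ι ℂ v * ExteriorAlgebra.ι ℂ w * omega0 =
      (wedge v w (ix 1 2) + wedge v w (ix 3 6)) • (x 1 * (x 2 * (x 3 * (x 4 * (x 5 * x 6))))) +
      (wedge v w (ix 0 2) - wedge v w (ix 4 6)) • (x 0 * (x 2 * (x 3 * (x 4 * (x 5 * x 6))))) +
      (wedge v w (ix 0 1)) • (x 0 * (x 1 * (x 3 * (x 4 * (x 5 * x 6))))) +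
      (wedge v w (ix 4 5) + wedge v w (ix 0 6)) • (x 0 * (x 1 * (x 2 * (x 4 * (x 5 * x 6))))) +
      (wedge v w (ix 3 5) - wedge v w (ix 1 6)) • (x 0 * (x 1 * (x 2 * (x 3 * (x 5 * x 6))))) +
      (wedge v w (ix 3 4)) • (x 0 * (x 1 * (x 2 * (x 3 * (x 4 * x 6))))) +
      (wedge v w (ix 0 3) + wedge v w (ix 1 4)) • (x 0 * (x 1 * (x 2 * (x 3 * (x 4 * x 5))))) := by
  have key : ∀ i j : Fin 7, x i * (x j * omega0) =
      x i * (x j * (x 0 * (x 1 * (x 2 * x 6)))) + x i * (x j * (x 3 * (x 4 * (x 5 * x 6)))) +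
      x i * (x j * (x 1 * (x 2 * (x 4 * x 5)))) + x i * (x j * (x 0 * (x 2 * (x 3 * x 5)))) := by
    intro i j
    simp only [omega0, mul_add, mul_assoc]
  rw [ι_eq_sum v, ι_eq_sum w, mul_assoc, Finset.sum_mul, Finset.sum_mul]
  simp only [Finset.mul_sum, smul_mul_assoc, mul_smul_comm, key]
  simp only [Fin.sum_univ_seven]
  simp (discharger := decide) only [x_mul_self, x_mul_self_mul, x_mul_comm, x_mul_comm_mul,
    mul_neg, mul_zero, neg_neg, neg_zero, add_zero, zero_add, smul_zero, smul_neg, wedge]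
  module

lemma detRowAlternating_single (n : ℕ) :
    Matrix.detRowAlternating (fun i : Fin n => (Pi.single i 1 : Fin n → ℂ)) = 1 := by
  have h : (Matrix.of fun i : Fin n => (Pi.single i 1 : Fin n → ℂ)) = 1 := by
    ext i j
    simp [Matrix.one_apply, Pi.single_apply, eq_comm]
  exact (congrArg Matrix.det h).trans Matrix.det_one

/-- The product of the seven basis vectors is detected by the determinant. -/
lemma top_ne_zero : x 0 * (x 1 * (x 2 * (x 3 * (x 4 * (x 5 * x 6))))) ≠ 0 := by
  intro h
  have h0 : ExteriorAlgebra.ιMulti ℂ 7 (fun i => (Pi.single i 1 : V)) = 0 := by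
    rw [ExteriorAlgebra.ιMulti_apply, ← h]
    have h3 : (List.ofFn fun i => ExteriorAlgebra.ι ℂ (Pi.single i 1 : V)) =
        [x 0, x 1, x 2, x 3, x 4, x 5, x 6] := rfl
    rw [h3]
    simp only [List.prod_cons, List.prod_nil, mul_one]
  have h1 := ExteriorAlgebra.liftAlternating_apply_ιMulti (R := ℂ) (M := V) (N := ℂ) (n := 7)
    (Pi.single 7 (Matrix.detRowAlternating (R := ℂ) (n := Fin 7))) (fun i => (Pi.single i 1 : V))
  rw [h0, map_zero, Pi.single_eq_same, detRowAlternating_single] at h1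
  exact zero_ne_one h1

/-- The seven products `∏_{i ≠ k} x_i` are linearly independent, so the wedge product with `ω₀`
vanishes exactly when the seven linear equations hold. -/
lemma wedge_omega0_eq_zero_iff (v w : V) :
    ExteriorAlgebra.ι ℂ v * ExteriorAlgebra.ι ℂ w * omega0 = 0 ↔ IsLin (wedge v w) := by
  rw [ι_mul_ι_mul_omega0]
  constructor
  · intro h
    -- multiplication by `x k` isolates the coefficient of `∏_{i ≠ k} x_i`
    have key : ∀ k, x k * _ = 0 := fun k => (congrArg (x k * ·) h).trans (mul_zero _)
    simp only [mul_add, mul_smul_comm] at key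
    have e0 := key 0
    have e1 := key 1
    have e2 := key 2
    have e3 := key 3
    have e4 := key 4
    have e5 := key 5
    have e6 := key 6
    simp (discharger := decide) only [x_mul_self, x_mul_self_mul, x_mul_comm, x_mul_comm_mul,
      mul_neg, mul_zero, neg_neg, neg_zero, add_zero, zero_add, smul_zero, smul_neg, neg_eq_zero,
      smul_eq_zero, top_ne_zero, or_false] at e0 e1 e2 e3 e4 e5 e6
    exact ⟨e2, e5, by linear_combination e6, by linear_combination e0, by linear_combination -e1,
      by linear_combination e3, by linear_combination e4⟩
  · rintro ⟨h1, h2, h3, h4, h5, h6, h7⟩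
    simp [h1, h2, h3, h4, h5, h6, h7]

end Exterior

/-! ### The union of the 3-spaces -/

section Variety

/-- The embedding of the plane of the conic into `ℙ(V)`, with image spanned by `x₂, x₅, x₆`
(indices from `0`), which is the summand `S²B` of `V`. -/
def conicPlane : (Fin 3 → ℂ) →ₗ[ℂ] V where
  toFun a := ![0, 0, a 0, 0, 0, -a 2, a 1]
  map_add' a b := by ext k; fin_cases k <;> simp; ring
  map_smul' r a := by ext k; fin_cases k <;> simp

lemma conicPlane_apply (a : Fin 3 → ℂ) : conicPlane a = ![0, 0, a 0, 0, 0, -a 2, a 1] := rfl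

lemma conicPlane_injective : Function.Injective conicPlane := by
  intro a b h
  have h2 := congrFun h 2
  have h5 := congrFun h 5
  have h6 := congrFun h 6
  simp [conicPlane_apply] at h2 h5 h6
  funext k
  fin_cases k <;> assumption

/-- The variety is the intersection of the Grassmannian with the seven hyperplanes. -/
lemma mk_mem_variety_iff {z : W} (hz : z ≠ 0) :
    Projectivization.mk ℂ z hz ∈ variety ↔ IsLin z ∧ ∃ v w, z = wedge v w := by
  constructor
  · rintro ⟨v, w, h, he, h0⟩
    obtain ⟨a, ha⟩ := (Projectivization.mk_eq_mk_iff' ℂ z (wedge v w) hz h).1 he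
    have hw : z = wedge (a • v) w := by
      rw [← ha]
      funext k
      simp [wedge]
      ring
    refine ⟨?_, _, _, hw⟩
    rw [hw, ← wedge_omega0_eq_zero_iff, map_smul, smul_mul_assoc, smul_mul_assoc, h0, smul_zero]
  · rintro ⟨hl, v, w, rfl⟩
    exact ⟨v, w, hz, rfl, (wedge_omega0_eq_zero_iff v w).2 hl⟩

lemma pluPolar_wedge (v w : V) (i j k l : Fin 7) (hij : i < j) (hjk : j < k) (hkl : k < l) :
    pluPolar (wedge v w) (wedge v w) i j k l hij hjk hkl = 0 := by
  simp only [pluPolar, wedge]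
  ring

lemma isLin_psi {A : Type} [CommRing A] (s t : A) (e : Fin 4 → A) : IsLin (psi s t e) :=
  isLin_ofCoords ..

/-- The points of `psi s t` are the lines through a point of the conic. -/
lemma psi_eq_wedge {s t : ℂ} (h : s ≠ 0 ∨ t ≠ 0) (e : Fin 4 → ℂ) :
    ∃ w : V, psi s t e = wedge (conicPlane ![s ^ 2, s * t, t ^ 2]) w := by
  have key : ∃ c2 c5 c6 : ℂ, t * c2 - s * c6 = e 0 ∧ t * c6 + s * c5 = e 1 := by
    rcases h with h | h
    · exact ⟨0, (e 1 + t * (e 0 / s)) / s, -(e 0 / s), by field_simp; ring, by field_simp; ring⟩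
    · exact ⟨(e 0 + s * (e 1 / t)) / t, 0, e 1 / t, by field_simp; ring, by field_simp; ring⟩
  obtain ⟨c2, c5, c6, h0, h1⟩ := key
  refine ⟨![e 2 * t, -(e 3 * t), c2, e 3 * s, e 2 * s, c5, c6], ?_⟩
  funext k
  rw [psi_apply, ← h0, ← h1]
  revert k
  refine PIdx.forall_of ?_
  simp only [ofCoords, wedge, conicPlane_apply]
  refine ⟨?_, ?_, ?_, ?_, ?_, ?_, ?_, ?_, ?_, ?_, ?_, ?_, ?_, ?_, ?_, ?_, ?_, ?_, ?_, ?_, ?_⟩ <;>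
    simp <;> ring

lemma psi_zero {A : Type} [CommRing A] (e : Fin 4 → A) : psi 0 0 e = 0 := by
  funext k
  revert k
  refine PIdx.forall_of ?_
  simp [psi_apply, ofCoords]

lemma mk_psi_mem_variety {s t : ℂ} {e : Fin 4 → ℂ} (hz : psi s t e ≠ 0) :
    Projectivization.mk ℂ (psi s t e) hz ∈ variety := by
  refine (mk_mem_variety_iff hz).2 ⟨isLin_psi s t e, ?_⟩
  have h : s ≠ 0 ∨ t ≠ 0 := by
    by_contra! h
    exact hz (by rw [h.1, h.2, psi_zero])
  obtain ⟨w, hw⟩ := psi_eq_wedge h e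
  exact ⟨_, w, hw⟩

lemma psi_injective {K : Type} [Field K] {s t : K} (h : s ≠ 0 ∨ t ≠ 0) :
    Function.Injective (psi s t) := by
  rw [← LinearMap.ker_eq_bot, LinearMap.ker_eq_bot']
  intro e he
  have hy := congrArg yc he
  have hu := congrArg uc he
  have hv := congrArg vc he
  rw [psi_apply, map_zero] at hy hu hv
  rw [yc_ofCoords] at hy
  rw [uc_ofCoords] at hu
  rw [vc_ofCoords] at hv
  have y0 := congrFun hy 0
  have y1 := congrFun hy 1
  have y2 := congrFun hy 2
  have u0 := congrFun hu 0
  have u3 := congrFun hu 3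
  have v0 := congrFun hv 0
  have v3 := congrFun hv 3
  simp at y0 y1 y2 u0 u3 v0 v3
  rcases h with h | h <;> simp only [h, false_or] at y0 y1 y2 u0 u3 v0 v3 <;> funext k <;>
    fin_cases k <;> simp [*] at * <;> assumption

/-- A point of the variety with vanishing `q` lies on one of the 3-spaces: if `(u, v) ≠ 0`, it is of
the form `(c, d) ⊗ b³`, and `y` is divisible by `b`; otherwise `b` is a linear factor of `y`. -/
lemma exists_psi_of_rel {z : W} (hl : IsLin z)
    (hr : Rel (qc z) (yc z) (uc z) (vc z) (qc z) (yc z) (uc z) (vc z)) (hq : qc z = 0) :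
    ∃ s t e, z = psi s t e := by
  rw [isLin_iff_eq_ofCoords.1 hl, hq]
  rw [hq] at hr
  generalize yc z = y at *
  generalize uc z = u at *
  generalize vc z = v at *
  have H0 : u 0 * u 2 = u 1 ^ 2 := by have := hr.qy00; simp at this; linear_combination -this / 2
  have H1 : u 0 * u 3 = u 1 * u 2 := by have := hr.qy01; simp at this; linear_combination -this / 2
  have H2 : u 1 * u 3 = u 2 ^ 2 := by have := hr.qy02; simp at this; linear_combination -this / 2
  have K0 : v 0 * v 2 = v 1 ^ 2 := by have := hr.qy20; simp at this; linear_combination -this / 2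
  have K1 : v 0 * v 3 = v 1 * v 2 := by have := hr.qy21; simp at this; linear_combination -this / 2
  have K2 : v 1 * v 3 = v 2 ^ 2 := by have := hr.qy22; simp at this; linear_combination -this / 2
  have M : ∀ j k, u j * v k = u k * v j := fun j k => by linear_combination (hr.minor j k) / 2
  have Y0 : u 0 * y 2 - u 1 * y 1 + u 2 * y 0 = 0 := by linear_combination hr.uy0 / 2
  have Y1 : u 1 * y 2 - u 2 * y 1 + u 3 * y 0 = 0 := by linear_combination hr.uy1 / 2
  have Z0 : v 0 * y 2 - v 1 * y 1 + v 2 * y 0 = 0 := by linear_combination hr.vy0 / 2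
  have Z1 : v 1 * y 2 - v 2 * y 1 + v 3 * y 0 = 0 := by linear_combination hr.vy1 / 2
  have goal : ∀ s t m n c d : ℂ, y = ![s * m, s * n + t * m, t * n] →
      u = ![s ^ 3 * c, s ^ 2 * t * c, s * t ^ 2 * c, t ^ 3 * c] →
      v = ![s ^ 3 * d, s ^ 2 * t * d, s * t ^ 2 * d, t ^ 3 * d] →
      ∃ s t e, ofCoords 0 y u v = psi s t e := by
    rintro s t m n c d rfl rfl rfl
    exact ⟨s, t, ![m, n, c, d], by simp [psi_apply]⟩
  have ext4 : ∀ a b : Fin 4 → ℂ, a 0 = b 0 → a 1 = b 1 → a 2 = b 2 → a 3 = b 3 → a = b := by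
    intro a b h0 h1 h2 h3
    funext k
    fin_cases k <;> assumption
  have ext3 : ∀ a b : Fin 3 → ℂ, a 0 = b 0 → a 1 = b 1 → a 2 = b 2 → a = b := by
    intro a b h0 h1 h2
    funext k
    fin_cases k <;> assumption
  by_cases hu0 : u 0 = 0
  · have hu1 : u 1 = 0 := by rw [hu0] at H0; simpa using H0.symm
    have hu2 : u 2 = 0 := by rw [hu1] at H2; simpa using H2.symm
    by_cases hv0 : v 0 = 0
    · have hv1 : v 1 = 0 := by rw [hv0] at K0; simpa using K0.symm
      have hv2 : v 2 = 0 := by rw [hv1] at K2; simpa using K2.symm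
      rw [hu1, hu2] at Y1
      rw [hv1, hv2] at Z1
      by_cases hy0 : y 0 = 0
      · refine goal 0 1 (y 1) (y 2) (u 3) (v 3) ?_ ?_ ?_
        · exact ext3 _ _ (by simp [hy0]) (by simp) (by simp)
        · exact ext4 _ _ (by simp [hu0]) (by simp [hu1]) (by simp [hu2]) (by simp)
        · exact ext4 _ _ (by simp [hv0]) (by simp [hv1]) (by simp [hv2]) (by simp)
      · have hu3 : u 3 = 0 := by simpa [hy0] using Y1
        have hv3 : v 3 = 0 := by simpa [hy0] using Z1
        -- over `ℂ` the binary quadric `y` has a linear factor `(1, t)`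
        obtain ⟨r, hr⟩ := IsAlgClosed.exists_pow_nat_eq (y 1 ^ 2 - 4 * y 0 * y 2)
          (n := 2) (by norm_num)
        refine goal 1 ((y 1 + r) / (2 * y 0)) (y 0) ((y 1 - r) / 2) 0 0 ?_ ?_ ?_
        · refine ext3 _ _ (by simp) (by simp; field_simp; ring) ?_
          simp
          field_simp
          linear_combination hr
        · exact ext4 _ _ (by simp [hu0]) (by simp [hu1]) (by simp [hu2]) (by simp [hu3])
        · exact ext4 _ _ (by simp [hv0]) (by simp [hv1]) (by simp [hv2]) (by simp [hv3])
    · have hu3 : u 3 = 0 := by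
        have := M 0 3
        rw [hu0] at this
        simpa [hv0] using this.symm
      have hv2 : v 2 = v 1 ^ 2 / v 0 := by field_simp; linear_combination K0
      have hv3 : v 3 = v 1 ^ 3 / v 0 ^ 2 := by
        rw [hv2] at K1; field_simp at K1 ⊢; linear_combination K1
      have hy2 : y 2 = (v 1 * y 1 - v 2 * y 0) / v 0 := by field_simp; linear_combination Z0
      refine goal 1 (v 1 / v 0) (y 0) (y 1 - v 1 / v 0 * y 0) 0 (v 0) ?_ ?_ ?_
      · refine ext3 _ _ (by simp) (by simp) ?_
        rw [hy2, hv2]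
        simp
        field_simp
      · exact ext4 _ _ (by simp [hu0]) (by simp [hu1]) (by simp [hu2]) (by simp [hu3])
      · refine ext4 _ _ (by simp) (by simp; field_simp) ?_ ?_
        · rw [hv2]; simp; field_simp
        · rw [hv3]; simp; field_simp
  · have hu2 : u 2 = u 1 ^ 2 / u 0 := by field_simp; linear_combination H0
    have hu3 : u 3 = u 1 ^ 3 / u 0 ^ 2 := by
      rw [hu2] at H1; field_simp at H1 ⊢; linear_combination H1
    have hy2 : y 2 = (u 1 * y 1 - u 2 * y 0) / u 0 := by field_simp; linear_combination Y0
    have hv : ∀ j, v j = u j * v 0 / u 0 := fun j => by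
      field_simp; linear_combination M 0 j
    refine goal 1 (u 1 / u 0) (y 0) (y 1 - u 1 / u 0 * y 0) (u 0) (v 0) ?_ ?_ ?_
    · refine ext3 _ _ (by simp) (by simp) ?_
      rw [hy2, hu2]
      simp
      field_simp
    · refine ext4 _ _ (by simp) (by simp; field_simp) ?_ ?_
      · rw [hu2]; simp; field_simp
      · rw [hu3]; simp; field_simp
    · refine ext4 _ _ (by simp) ?_ ?_ ?_
      · rw [hv 1]; simp; field_simp
      · rw [hv 2, hu2]; simp; field_simp
      · rw [hv 3, hu3]; simp; field_simp

/-- Where `2` is invertible, a quadric that vanishes on a linear subspace has vanishing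
polarization. -/
lemma pluPolar_eq_zero_of_add {A : Type} [CommRing A] (h2 : IsUnit (2 : A)) {z w : PIdx → A}
    {i j k l : Fin 7} (hij : i < j) (hjk : j < k) (hkl : k < l)
    (hz : pluPolar z z i j k l hij hjk hkl = 0) (hw : pluPolar w w i j k l hij hjk hkl = 0)
    (hzw : pluPolar (z + w) (z + w) i j k l hij hjk hkl = 0) :
    pluPolar z w i j k l hij hjk hkl = 0 := by
  rw [← h2.mul_right_eq_zero]
  simp only [pluPolar, Pi.add_apply] at *
  linear_combination hzw - hz - hw

/-- The points of a linear subspace of the cone over the variety satisfy the polarized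
relations. -/
lemma rel_of_linearSpace_subset {L : Submodule ℂ W} (hL : linearSpace L ⊆ variety) {z w : W}
    (hz : z ∈ L) (hw : w ∈ L) :
    Rel (qc z) (yc z) (uc z) (vc z) (qc w) (yc w) (uc w) (vc w) := by
  have lin : ∀ z ∈ L, IsLin z ∧ ∃ v w, z = wedge v w := by
    intro z hz
    by_cases h0 : z = 0
    · refine ⟨by rw [h0]; constructor <;> simp, 0, 0, ?_⟩
      rw [h0]
      funext k
      simp [wedge]
    · exact (mk_mem_variety_iff h0).1 (hL (by
        simpa [linearSpace, Projectivization.submodule_mk] using hz))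
  have plu : ∀ z ∈ L, ∀ (i j k l : Fin 7) (hij : i < j) (hjk : j < k) (hkl : k < l),
      pluPolar z z i j k l hij hjk hkl = 0 := by
    intro z hz
    obtain ⟨-, v, w, rfl⟩ := lin z hz
    exact pluPolar_wedge v w
  exact rel_of_pluPolar (lin z hz).1 (lin w hw).1 fun i j k l hij hjk hkl =>
    pluPolar_eq_zero_of_add (by norm_num) hij hjk hkl (plu z hz _ _ _ _ hij hjk hkl)
      (plu w hw _ _ _ _ hij hjk hkl) (plu _ (L.add_mem hz hw) _ _ _ _ hij hjk hkl)

/-- The union of the 3-spaces is parametrized by `psi`. -/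
lemma mk_mem_unionOfP3_iff {z : W} (hz : z ≠ 0) :
    Projectivization.mk ℂ z hz ∈ unionOfP3 variety ↔ ∃ s t e, z = psi s t e := by
  constructor
  · rintro ⟨L, hL4, hL, hzL⟩
    have hzL : z ∈ L := by simpa [linearSpace, Projectivization.submodule_mk] using hzL
    have hlin : ∀ w : L, IsLin (w : W) := by
      intro w
      by_cases h0 : (w : W) = 0
      · rw [h0]; constructor <;> simp
      · exact ((mk_mem_variety_iff h0).1 (hL (by
          simp [linearSpace, Projectivization.submodule_mk]))).1
    have fam : LinFamily (qc ∘ₗ L.subtype) (yc ∘ₗ L.subtype) (uc ∘ₗ L.subtype)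
        (vc ∘ₗ L.subtype) :=
      { rel := fun e f => rel_of_linearSpace_subset hL e.2 f.2
        sep := fun e h1 h2 h3 h4 => Subtype.ext
          ((hlin e).ext (by constructor <;> simp) (by simpa using h1) (by simpa using h2)
            (by simpa using h3) (by simpa using h4)) }
    exact exists_psi_of_rel (hlin ⟨z, hzL⟩) (rel_of_linearSpace_subset hL hzL hzL)
      (fam.q_eq_zero (by omega) ⟨z, hzL⟩)
  · rintro ⟨s, t, e, rfl⟩
    have h : s ≠ 0 ∨ t ≠ 0 := by
      by_contra! h
      exact hz (by rw [h.1, h.2, psi_zero])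
    refine ⟨LinearMap.range (psi s t), ?_, ?_, ?_⟩
    · rw [LinearMap.finrank_range_of_inj (psi_injective h)]
      simp
    · intro p hp
      induction p using Projectivization.ind with
      | h w hw =>
        have : w ∈ LinearMap.range (psi s t) := by
          simpa [linearSpace, Projectivization.submodule_mk] using hp
        obtain ⟨f, rfl⟩ := this
        exact mk_psi_mem_variety hw
    · simp [linearSpace, Projectivization.submodule_mk]

lemma unionOfP3_subset : unionOfP3 variety ⊆ variety := by
  rintro p ⟨L, -, hL, hp⟩
  exact hL hp

/-- The generic point of the family of 3-spaces. -/
def genPsi : PIdx → MvPolynomial (Fin 6) ℂ := psi (X 0) (X 1) ![X 2, X 3, X 4, X 5]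

lemma map_psi {A B : Type} [CommRing A] [CommRing B] (f : A →+* B) (s t : A) (e : Fin 4 → A)
    (k : PIdx) : f (psi s t e k) = psi (f s) (f t) (f ∘ e) k := by
  revert k
  refine PIdx.forall_of ?_
  simp [psi_apply, ofCoords]

lemma map_genPsi {B : Type} [CommRing B] (g : MvPolynomial (Fin 6) ℂ →+* B) (k : PIdx) :
    g (genPsi k) = psi (g (X 0)) (g (X 1)) ![g (X 2), g (X 3), g (X 4), g (X 5)] k := by
  have h : g ∘ ![X 2, X 3, X 4, X 5] = ![g (X 2), g (X 3), g (X 4), g (X 5)] := by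
    funext j
    fin_cases j <;> rfl
  rw [genPsi, map_psi, h]

lemma eval_aeval_genPsi (c : Fin 6 → ℂ) (f : MvPolynomial PIdx ℂ) :
    eval c (aeval genPsi f) = eval (psi (c 0) (c 1) ![c 2, c 3, c 4, c 5]) f := by
  have h : ∀ k, eval c (genPsi k) = psi (c 0) (c 1) ![c 2, c 3, c 4, c 5] k := by
    intro k
    rw [map_genPsi (eval c)]
    simp
  rw [aeval_eq_bind₁, ← coe_aeval_eq_eval, ← coe_aeval_eq_eval, RingHom.coe_coe, RingHom.coe_coe,
    aeval_bind₁]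
  congr 2
  funext k
  simpa using h k

/-- The ideal of the union of the 3-spaces is the kernel of the substitution of the generic
point. -/
lemma mem_idealOf_unionOfP3_iff (f : MvPolynomial PIdx ℂ) :
    f ∈ idealOf (unionOfP3 variety) ↔ aeval genPsi f = 0 := by
  constructor
  · intro hf
    -- only nonzero vectors are points; the factor `s c` makes up for the others
    have h0 : aeval genPsi f * (X 0 * X 4) = 0 := by
      refine MvPolynomial.funext fun c => ?_
      rw [map_mul, eval_aeval_genPsi, map_zero]
      by_cases hc : c 0 = 0 ∨ c 4 = 0
      · rcases hc with hc | hc <;> simp [hc]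
      · push Not at hc
        have hz : psi (c 0) (c 1) ![c 2, c 3, c 4, c 5] ≠ 0 := by
          rw [Ne, ← map_zero (psi (c 0) (c 1)), (psi_injective (Or.inl hc.1)).eq_iff]
          exact fun h => hc.2 (congrFun h 2)
        rw [show eval _ f = 0 from hf _ ⟨hz, (mk_mem_unionOfP3_iff hz).2 ⟨_, _, _, rfl⟩⟩, zero_mul]
    simpa [X_ne_zero] using h0
  · rintro hf z ⟨hz, hm⟩
    obtain ⟨s, t, e, rfl⟩ := (mk_mem_unionOfP3_iff hz).1 hm
    have := eval_aeval_genPsi ![s, t, e 0, e 1, e 2, e 3] f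
    rw [hf, map_zero] at this
    have he : ![e 0, e 1, e 2, e 3] = e := by
      funext j
      fin_cases j <;> rfl
    rw [← he]
    exact this.symm

lemma idealOf_anti {Y Z : Set (ℙ ℂ W)} (h : Y ⊆ Z) : idealOf Z ≤ idealOf Y :=
  fun _ hf z ⟨hz, hm⟩ => hf z ⟨hz, h hm⟩

/-- The equations of the variety hold at the points of the 3-spaces with coefficients in any
`ℂ`-algebra. -/
lemma aeval_psi_eq_zero {B : Type} [CommRing B] [Algebra ℂ B] (s t : B) (e : Fin 4 → B)
    {f : MvPolynomial PIdx ℂ} (hf : f ∈ idealOf variety) : aeval (psi s t e) f = 0 := by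
  have h := (mem_idealOf_unionOfP3_iff f).1 (idealOf_anti unionOfP3_subset hf)
  have h2 := congrArg (aeval ![s, t, e 0, e 1, e 2, e 3]) h
  rw [map_zero, aeval_eq_bind₁, aeval_bind₁] at h2
  rw [← h2]
  congr 2
  funext k
  have h3 := map_genPsi (aeval ![s, t, e 0, e 1, e 2, e 3] :
    MvPolynomial (Fin 6) ℂ →ₐ[ℂ] B).toRingHom k
  have he : ![e 0, e 1, e 2, e 3] = e := by
    funext j
    fin_cases j <;> rfl
  simpa [he] using h3.symm

end Variety

/-! ### The linear forms attached to a point of the conic -/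

section ConicForms

variable {A B : Type} [CommRing A] [CommRing B]

/-- The coefficient vector of a linear functional on a coordinate space. -/
def formCoeff {σ : Type} [DecidableEq σ] : ((σ → A) →ₗ[A] A) →ₗ[A] (σ → A) where
  toFun F k := F (Pi.single k 1)
  map_add' _ _ := rfl
  map_smul' _ _ := rfl

lemma formCoeff_dot {σ : Type} [Fintype σ] [DecidableEq σ] (F : (σ → A) →ₗ[A] A) (z : σ → A) :
    ∑ k, formCoeff F k * z k = F z := by
  conv_rhs => rw [pi_eq_sum_univ' z]
  rw [map_sum]
  refine Finset.sum_congr rfl fun k _ => ?_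
  rw [map_smul, smul_eq_mul, mul_comm]
  rfl

lemma exists_formCoeff_eq {σ : Type} [Fintype σ] [DecidableEq σ] (a : σ → A) :
    ∃ F : (σ → A) →ₗ[A] A, formCoeff F = a :=
  ⟨Fintype.linearCombination A a, by funext k; simp [formCoeff, Fintype.linearCombination_apply,
    Pi.single_apply]⟩

lemma formCoeff_comp_mem {σ : Type} [DecidableEq σ] {n : ℕ} (G : (Fin n → A) →ₗ[A] A)
    (T : (σ → A) →ₗ[A] (Fin n → A)) {N : Submodule A (σ → A)}
    (h : ∀ i, formCoeff (LinearMap.proj i ∘ₗ T) ∈ N) : formCoeff (G ∘ₗ T) ∈ N := by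
  have : G ∘ₗ T = ∑ i, formCoeff G i • (LinearMap.proj i ∘ₗ T) := by
    ext z
    simp only [LinearMap.sum_apply, LinearMap.smul_apply, LinearMap.comp_apply,
      LinearMap.proj_apply, smul_eq_mul, ← formCoeff_dot G (T _)]
  rw [this, map_sum]
  exact N.sum_mem fun i _ => by rw [map_smul]; exact N.smul_mem _ (h i)

/-- The linear forms that vanish on all the 3-spaces: the seven equations of the variety, and the
coordinates `q`. -/
def fixedMap : (PIdx → A) →ₗ[A] (Fin 10 → A) where
  toFun z := ![z (ix 0 1), z (ix 3 4), z (ix 1 4) + z (ix 0 3), z (ix 3 6) + z (ix 1 2),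
    z (ix 4 6) - z (ix 0 2), z (ix 4 5) + z (ix 0 6), z (ix 3 5) - z (ix 1 6),
    qc z 0, qc z 1, qc z 2]
  map_add' z w := by ext k; fin_cases k <;> simp <;> ring
  map_smul' r z := by ext k; fin_cases k <;> simp <;> ring

/-- The linear forms that vanish on the 3-space of the point `α = b²` of the conic, besides those
of `fixedMap`: `y` is divisible by `b`, and `u` and `v` are multiples of `b³`. They are linear in
`α`, and are stated with both ratios `α₀ : α₁` and `α₁ : α₂`, so that they suffice at all points.
-/
def conicMap (α : Fin 3 → A) : (PIdx → A) →ₗ[A] (Fin 13 → A) where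
  toFun z := ![α 0 * yc z 2 - α 1 * yc z 1 + α 2 * yc z 0,
    α 0 * uc z 1 - α 1 * uc z 0, α 0 * uc z 2 - α 1 * uc z 1, α 0 * uc z 3 - α 1 * uc z 2,
    α 1 * uc z 1 - α 2 * uc z 0, α 1 * uc z 2 - α 2 * uc z 1, α 1 * uc z 3 - α 2 * uc z 2,
    α 0 * vc z 1 - α 1 * vc z 0, α 0 * vc z 2 - α 1 * vc z 1, α 0 * vc z 3 - α 1 * vc z 2,
    α 1 * vc z 1 - α 2 * vc z 0, α 1 * vc z 2 - α 2 * vc z 1, α 1 * vc z 3 - α 2 * vc z 2]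
  map_add' z w := by ext k; fin_cases k <;> simp <;> ring
  map_smul' r z := by ext k; fin_cases k <;> simp <;> ring

/-- The coefficient vectors of the forms `fixedMap`. -/
def fixedForm (i : Fin 10) : PIdx → A := formCoeff (LinearMap.proj i ∘ₗ fixedMap)

/-- The coefficient vectors of the forms `conicMap α`, as linear functions of `α`. -/
def conicForm (i : Fin 13) : (Fin 3 → A) →ₗ[A] (PIdx → A) where
  toFun α := formCoeff (LinearMap.proj i ∘ₗ conicMap α)
  map_add' α β := by
    rw [← map_add]
    congr 1
    ext k
    simp [conicMap]
    fin_cases i <;> simp <;> ring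
  map_smul' r α := by
    rw [RingHom.id_apply, ← map_smul]
    congr 1
    ext k
    simp [conicMap]
    fin_cases i <;> simp <;> ring

lemma conicForm_apply (i : Fin 13) (α : Fin 3 → A) :
    conicForm i α = formCoeff (LinearMap.proj i ∘ₗ conicMap α) := rfl

/-- The linear forms attached to a submodule of `A³`; for a point of the conic, these are the linear
forms that vanish on the corresponding 3-space. -/
def conicForms (ℓ : Submodule A (Fin 3 → A)) : Submodule A (PIdx → A) :=
  Submodule.span A (Set.range fixedForm ∪ ⋃ i, conicForm i '' (ℓ : Set (Fin 3 → A)))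

lemma conicForms_span (T : Set (Fin 3 → A)) : conicForms (Submodule.span A T) =
    Submodule.span A (Set.range fixedForm ∪ ⋃ i, conicForm i '' T) := by
  apply le_antisymm
  · refine Submodule.span_le.2 (Set.union_subset ?_ (Set.iUnion_subset fun i => ?_))
    · exact Set.subset_union_left.trans Submodule.subset_span
    · rw [← Submodule.map_coe, SetLike.coe_subset_coe, Submodule.map_span]
      refine Submodule.span_mono ?_
      exact (Set.subset_iUnion (fun i => conicForm i '' T) i).trans Set.subset_union_right
  · refine Submodule.span_mono (Set.union_subset_union_right _ (Set.iUnion_mono fun i => ?_))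
    exact Set.image_mono Submodule.subset_span

lemma map_fixedForm (f : A →+* B) (i : Fin 10) :
    (fun k => f (fixedForm i k)) = fixedForm i := by
  funext k
  simp only [fixedForm, formCoeff, fixedMap, LinearMap.coe_mk, AddHom.coe_mk, LinearMap.comp_apply,
    LinearMap.proj_apply, qc, Pi.single_apply]
  fin_cases i <;> simp [apply_ite f]

lemma map_conicForm (f : A →+* B) (i : Fin 13) (α : Fin 3 → A) :
    (fun k => f (conicForm i α k)) = conicForm i (fun k => f (α k)) := by
  funext k
  simp only [conicForm, formCoeff, conicMap, LinearMap.coe_mk, AddHom.coe_mk, LinearMap.comp_apply,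
    LinearMap.proj_apply, yc, uc, vc, Pi.single_apply]
  fin_cases i <;> simp [apply_ite f]

/-- The formation of the linear forms commutes with base change. -/
lemma vecSpan_conicForms (f : A →+* B) (ℓ : Submodule A (Fin 3 → A)) :
    vecSpan f (conicForms ℓ) = conicForms (vecSpan f ℓ) := by
  rw [conicForms, vecSpan_span]
  change _ = conicForms (Submodule.span B _)
  rw [conicForms_span, Set.image_union, Set.image_iUnion]
  congr 2
  · rw [← Set.range_comp]
    exact congrArg Set.range (funext fun i => map_fixedForm f i)
  · refine Set.iUnion_congr fun i => ?_
    rw [Set.image_image, Set.image_image]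
    exact Set.image_congr fun α _ => map_conicForm f i α

lemma conicForms_fg {ℓ : Submodule A (Fin 3 → A)} (h : ℓ.FG) : (conicForms ℓ).FG := by
  obtain ⟨T, rfl⟩ := h
  rw [conicForms_span]
  refine Submodule.fg_span ((Set.finite_range _).union (Set.finite_iUnion fun i => ?_))
  exact T.finite_toSet.image _

/-- The projection from linear forms to the plane of the conic that recovers `α` from the form
`α₀ y₂ - α₁ y₁ + α₂ y₀`. -/
def conicProj : (PIdx → A) →ₗ[A] (Fin 3 → A) where
  toFun a := ![-a (ix 5 6), -a (ix 2 5), -a (ix 2 6)]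
  map_add' z w := by ext k; fin_cases k <;> simp <;> ring
  map_smul' r z := by ext k; fin_cases k <;> simp

lemma conicProj_fixedForm (i : Fin 10) : conicProj (fixedForm i : PIdx → A) = 0 := by
  funext k
  simp only [fixedForm, formCoeff, fixedMap, LinearMap.coe_mk, AddHom.coe_mk, LinearMap.comp_apply,
    LinearMap.proj_apply, qc, Pi.single_apply, conicProj]
  fin_cases i <;> fin_cases k <;> simp

lemma conicProj_conicForm (i : Fin 13) (α : Fin 3 → A) :
    conicProj (conicForm i α) = if i = 0 then α else 0 := by
  funext k
  simp only [conicForm, formCoeff, conicMap, LinearMap.coe_mk, AddHom.coe_mk, LinearMap.comp_apply,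
    LinearMap.proj_apply, yc, uc, vc, Pi.single_apply, conicProj]
  fin_cases i <;> fin_cases k <;> simp

lemma map_conicProj_conicForms (ℓ : Submodule A (Fin 3 → A)) :
    (conicForms ℓ).map conicProj = ℓ := by
  rw [conicForms, Submodule.map_span]
  apply le_antisymm
  · refine Submodule.span_le.2 ?_
    rintro _ ⟨_, ⟨i, rfl⟩ | h, rfl⟩
    · rw [conicProj_fixedForm]; exact ℓ.zero_mem
    · obtain ⟨i, α, hα, rfl⟩ := Set.mem_iUnion.1 h
      rw [conicProj_conicForm]
      split_ifs
      · exact hα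
      · exact ℓ.zero_mem
  · intro α hα
    refine Submodule.subset_span ⟨conicForm 0 α, Or.inr (Set.mem_iUnion.2 ⟨0, α, hα, rfl⟩), ?_⟩
    rw [conicProj_conicForm, if_pos rfl]

lemma vecSpan_map_conicProj (f : A →+* B) (N : Submodule A (PIdx → A)) :
    vecSpan f (N.map conicProj) = (vecSpan f N).map conicProj := by
  rw [vecSpan, vecSpan, Submodule.map_span, Submodule.map_coe, Set.image_image, Set.image_image]
  congr 2
  funext a k
  fin_cases k <;> simp [conicProj]

end ConicForms

/-! ### The linear forms vanishing on a 3-space, and points of the conic -/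

section Annihilator

variable {A B : Type} [CommRing A] [CommRing B]

/-- The point `(s², st, t²)` of the conic. -/
def conicVec (s t : A) : Fin 3 → A := ![s ^ 2, s * t, t ^ 2]

/-- The line bundle spanned by a point of the conic, at a local ring. -/
abbrev conicLine (s t : A) : Submodule A (Fin 3 → A) := Submodule.span A {conicVec s t}

lemma vecSpan_conicLine (f : A →+* B) (s t : A) :
    vecSpan f (conicLine s t) = conicLine (f s) (f t) := by
  rw [conicLine, vecSpan_span, Set.image_singleton]
  congr 2
  funext k
  fin_cases k <;> simp [conicVec]

/-- The transpose of a linear map between coordinate spaces. -/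
def transp {m n : Type} [Fintype n] [DecidableEq m] (P : (m → A) →ₗ[A] (n → A)) :
    (n → A) →ₗ[A] (m → A) where
  toFun a i := ∑ k, a k * P (Pi.single i 1) k
  map_add' a b := by funext i; simp [add_mul, Finset.sum_add_distrib]
  map_smul' r a := by funext i; simp [mul_assoc, Finset.mul_sum]

lemma transp_dot {m n : Type} [Fintype m] [Fintype n] [DecidableEq m] (P : (m → A) →ₗ[A] (n → A))
    (a : n → A) (e : m → A) : ∑ i, transp P a i * e i = ∑ k, a k * P e k := by
  conv_rhs => rw [pi_eq_sum_univ' e]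
  simp only [transp, LinearMap.coe_mk, AddHom.coe_mk, map_sum, map_smul, Finset.sum_apply,
    Pi.smul_apply, smul_eq_mul, Finset.mul_sum, Finset.sum_mul]
  rw [Finset.sum_comm]
  exact Finset.sum_congr rfl fun k _ => Finset.sum_congr rfl fun i _ => by ring

lemma mem_ker_transp {m n : Type} [Fintype m] [Fintype n] [DecidableEq m]
    (P : (m → A) →ₗ[A] (n → A)) (a : n → A) :
    a ∈ LinearMap.ker (transp P) ↔ ∀ z ∈ LinearMap.range P, ∑ k, a k * z k = 0 := by
  rw [LinearMap.mem_ker]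
  constructor
  · rintro h _ ⟨e, rfl⟩
    rw [← transp_dot, h]
    simp
  · intro h
    funext i
    have := h _ ⟨Pi.single i 1, rfl⟩
    rw [← transp_dot] at this
    simpa [Pi.single_apply] using this

lemma ker_transp_eq {m n : Type} [Fintype m] [Fintype n] [DecidableEq m]
    {P Q : (m → A) →ₗ[A] (n → A)} (h : LinearMap.range P = LinearMap.range Q) :
    LinearMap.ker (transp P) = LinearMap.ker (transp Q) := by
  ext a
  rw [mem_ker_transp, mem_ker_transp, h]

lemma transp_transp {m n : Type} [Fintype m] [Fintype n] [DecidableEq m] [DecidableEq n]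
    (P : (m → A) →ₗ[A] (n → A)) : transp (transp P) = P := by
  refine LinearMap.ext fun e => funext fun k => ?_
  have h := transp_dot P (Pi.single k 1) e
  simp only [Pi.single_apply, ite_mul, one_mul, zero_mul, Finset.sum_ite_eq', Finset.mem_univ,
    if_true] at h
  rw [← h]
  exact Finset.sum_congr rfl fun i _ => mul_comm _ _

lemma transp_comp {l m n : Type} [Fintype l] [Fintype m] [Fintype n] [DecidableEq l]
    [DecidableEq m] [DecidableEq n] (P : (m → A) →ₗ[A] (n → A)) (Q : (l → A) →ₗ[A] (m → A)) :
    transp (P ∘ₗ Q) = transp Q ∘ₗ transp P := by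
  refine LinearMap.ext fun a => funext fun i => ?_
  exact (transp_dot P a (Q (Pi.single i 1))).symm

lemma transp_id {m : Type} [Fintype m] [DecidableEq m] :
    transp (LinearMap.id : (m → A) →ₗ[A] (m → A)) = LinearMap.id := by
  refine LinearMap.ext fun a => funext fun i => ?_
  simp [transp, Pi.single_apply]

/-- A vector at which the seven linear equations of the variety take given values. -/
def defectVec (r : Fin 7 → A) : PIdx → A := fun k =>
  !![0, r 0, 0, 0, 0, 0, 0;
     0, 0, 0, 0, r 2, 0, 0;
     0, 0, 0, 0, 0, 0, 0;
     0, 0, 0, 0, r 1, r 6, r 3;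
     0, 0, 0, 0, 0, r 5, r 4;
     0, 0, 0, 0, 0, 0, 0;
     0, 0, 0, 0, 0, 0, 0] k.1.1 k.1.2

lemma fixedMap_psi (s t : A) (e : Fin 4 → A) : fixedMap (psi s t e) = 0 := by
  have h := isLin_psi s t e
  have hq : qc (psi s t e) = 0 := by rw [psi_apply, qc_ofCoords]
  funext i
  simp only [fixedMap, LinearMap.coe_mk, AddHom.coe_mk, hq, h.h01, h.h34, h.h14, h.h36, h.h46,
    h.h45, h.h35]
  fin_cases i <;> simp

lemma conicMap_psi (s t : A) (e : Fin 4 → A) : conicMap (conicVec s t) (psi s t e) = 0 := by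
  funext i
  simp only [conicMap, conicVec, LinearMap.coe_mk, AddHom.coe_mk, psi_apply, yc_ofCoords,
    uc_ofCoords, vc_ofCoords]
  fin_cases i <;> simp <;> ring

/-- A vector is determined by its values under `fixedMap` and `conicMap`, up to a point of the
3-space. The maps `ρ` and `ρ'` reconstruct a vector from these values, modulo the 3-space; `ρ'`
solves the recursions `u (i + 1) - t u i = c i` for `s = 1`, and those in the opposite direction
for `t = 1`. -/
lemma exists_decomp (s t : A) (h : s = 1 ∨ t = 1) :
    ∃ (ρ : (Fin 10 → A) →ₗ[A] (PIdx → A)) (ρ' : (Fin 13 → A) →ₗ[A] (PIdx → A)),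
      ∀ z, ∃ e, z = psi s t e + ρ (fixedMap z) + ρ' (conicMap (conicVec s t) z) := by
  let ρ : (Fin 10 → A) →ₗ[A] (PIdx → A) :=
    { toFun := fun r => ofCoords ![r 7, r 8, r 9] 0 0 0 +
        defectVec ![r 0, r 1, r 2, r 3, r 4, r 5, r 6]
      map_add' := fun a b => by
        funext k; revert k
        refine PIdx.forall_of ?_
        simp [ofCoords, defectVec]
        ring_nf
        simp
      map_smul' := fun a b => by
        funext k; revert k
        refine PIdx.forall_of ?_
        simp [ofCoords, defectVec]
        ring }
  rcases h with rfl | rfl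
  · let ρ' : (Fin 13 → A) →ₗ[A] (PIdx → A) :=
      { toFun := fun c => ofCoords 0 ![0, 0, c 0]
          ![0, c 1, c 2 + t * c 1, c 3 + t * c 2 + t ^ 2 * c 1]
          ![0, c 7, c 8 + t * c 7, c 9 + t * c 8 + t ^ 2 * c 7]
        map_add' := fun a b => by
          funext k; revert k
          refine PIdx.forall_of ?_
          simp [ofCoords]
          ring_nf
          simp
        map_smul' := fun a b => by
          funext k; revert k
          refine PIdx.forall_of ?_
          simp [ofCoords]
          ring_nf
          simp }
    refine ⟨ρ, ρ', fun z => ⟨![yc z 0, yc z 1 - t * yc z 0, uc z 0, vc z 0], ?_⟩⟩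
    funext k; revert k
    refine PIdx.forall_of ?_
    simp [ρ, ρ', psi_apply, ofCoords, defectVec, fixedMap, conicMap, conicVec, qc, yc, uc, vc]
    ring_nf
    simp
  · let ρ' : (Fin 13 → A) →ₗ[A] (PIdx → A) :=
      { toFun := fun c => ofCoords 0 ![c 0, 0, 0]
          ![-(c 4 + s * c 5 + s ^ 2 * c 6), -(c 5 + s * c 6), -c 6, 0]
          ![-(c 10 + s * c 11 + s ^ 2 * c 12), -(c 11 + s * c 12), -c 12, 0]
        map_add' := fun a b => by
          funext k; revert k
          refine PIdx.forall_of ?_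
          simp [ofCoords]
          ring_nf
          simp
        map_smul' := fun a b => by
          funext k; revert k
          refine PIdx.forall_of ?_
          simp [ofCoords]
          ring_nf
          simp }
    refine ⟨ρ, ρ', fun z => ⟨![yc z 1 - s * yc z 2, yc z 2, uc z 3, vc z 3], ?_⟩⟩
    funext k; revert k
    refine PIdx.forall_of ?_
    simp [ρ, ρ', psi_apply, ofCoords, defectVec, fixedMap, conicMap, conicVec, qc, yc, uc, vc]
    ring_nf
    simp

/-- The linear forms attached to the point `(s², st, t²)` are those that vanish on the 3-space
parametrized by `psi s t`. -/
lemma conicForms_conicLine {s t : A} (h : s = 1 ∨ t = 1) :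
    conicForms (conicLine s t) = LinearMap.ker (transp (psi s t)) := by
  rw [conicLine, conicForms_span]
  simp only [Set.image_singleton]
  apply le_antisymm
  · refine Submodule.span_le.2 ?_
    rintro a (⟨i, rfl⟩ | ha)
    · refine (mem_ker_transp _ _).2 ?_
      rintro _ ⟨e, rfl⟩
      rw [fixedForm, formCoeff_dot, LinearMap.comp_apply, fixedMap_psi, map_zero]
    · obtain ⟨i, rfl⟩ := Set.mem_iUnion.1 ha
      refine (mem_ker_transp _ _).2 ?_
      rintro _ ⟨e, rfl⟩
      rw [conicForm_apply, formCoeff_dot, LinearMap.comp_apply, conicMap_psi, map_zero]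
  · intro a ha
    rw [mem_ker_transp] at ha
    obtain ⟨F, rfl⟩ := exists_formCoeff_eq a
    simp only [formCoeff_dot] at ha
    obtain ⟨ρ, ρ', hd⟩ := exists_decomp s t h
    have hF : F = (F ∘ₗ ρ) ∘ₗ fixedMap + (F ∘ₗ ρ') ∘ₗ conicMap (conicVec s t) := by
      refine LinearMap.ext fun z => ?_
      obtain ⟨e, he⟩ := hd z
      conv_lhs => rw [he]
      rw [map_add, map_add, ha _ ⟨e, rfl⟩, zero_add]
      rfl
    rw [hF, map_add]
    refine Submodule.add_mem _ (formCoeff_comp_mem _ _ fun i => ?_)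
      (formCoeff_comp_mem _ _ fun i => ?_)
    · exact Submodule.subset_span (Or.inl ⟨i, rfl⟩)
    · exact Submodule.subset_span (Or.inr (Set.mem_iUnion.2 ⟨i, rfl⟩))

/-- A common zero of the linear forms attached to a point of the conic lies on the 3-space. -/
lemma exists_psi_of_forall_conicForms {s t : A} (h : s = 1 ∨ t = 1) {z : PIdx → A}
    (hz : ∀ a ∈ conicForms (conicLine s t), ∑ k, a k * z k = 0) : ∃ e, z = psi s t e := by
  obtain ⟨ρ, ρ', hd⟩ := exists_decomp s t h
  obtain ⟨e, he⟩ := hd z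
  have h1 : fixedMap z = 0 := by
    funext i
    have := hz (fixedForm i) (Submodule.subset_span (Or.inl ⟨i, rfl⟩))
    rwa [fixedForm, formCoeff_dot] at this
  have h2 : conicMap (conicVec s t) z = 0 := by
    funext i
    have := hz (conicForm i (conicVec s t)) (Submodule.subset_span (Or.inr (Set.mem_iUnion.2
      ⟨i, _, Submodule.mem_span_singleton_self _, rfl⟩)))
    rwa [conicForm_apply, formCoeff_dot] at this
  exact ⟨e, by rw [he, h1, h2, map_zero, map_zero, add_zero, add_zero]⟩

/-- The parametrization of a 3-space splits. -/
lemma exists_section_psi {s t : A} (h : s = 1 ∨ t = 1) :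
    ∃ σ : (PIdx → A) →ₗ[A] (Fin 4 → A), σ ∘ₗ psi s t = LinearMap.id := by
  rcases h with rfl | rfl
  · refine ⟨LinearMap.pi ![LinearMap.proj 0 ∘ₗ yc,
      LinearMap.proj 1 ∘ₗ yc - t • LinearMap.proj 0 ∘ₗ yc, LinearMap.proj 0 ∘ₗ uc,
      LinearMap.proj 0 ∘ₗ vc], LinearMap.ext fun e => funext fun i => ?_⟩
    rw [LinearMap.comp_apply, psi_apply]
    fin_cases i <;> simp
  · refine ⟨LinearMap.pi ![LinearMap.proj 1 ∘ₗ yc - s • LinearMap.proj 2 ∘ₗ yc,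
      LinearMap.proj 2 ∘ₗ yc,
      LinearMap.proj 3 ∘ₗ uc, LinearMap.proj 3 ∘ₗ vc], LinearMap.ext fun e => funext fun i => ?_⟩
    rw [LinearMap.comp_apply, psi_apply]
    fin_cases i <;> simp

/-- The substitution attached to the transpose of `psi s t` is the generic point of the 3-space. -/
lemma linSubst_transp_psi (s t : A) (k : PIdx) :
    linSubst (transp (psi s t)) (X k) = psi (C s) (C t) (X : Fin 4 → MvPolynomial (Fin 4) A) k := by
  rw [← linForm_single, linSubst_linForm, linForm_apply]
  have h : ∀ i : Fin 4, psi (C s) (C t) (Pi.single i 1 : Fin 4 → MvPolynomial (Fin 4) A) k =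
      C (psi s t (Pi.single i 1) k) := by
    intro i
    have he : (Pi.single i 1 : Fin 4 → MvPolynomial (Fin 4) A) = C ∘ Pi.single i 1 := by
      funext j
      simp [Pi.single_apply, apply_ite C]
    rw [map_psi, he]
  conv_rhs => rw [pi_eq_sum_univ' (X : Fin 4 → MvPolynomial (Fin 4) A)]
  simp only [map_sum, map_smul, Finset.sum_apply, Pi.smul_apply, smul_eq_mul, h]
  refine Finset.sum_congr rfl fun i _ => ?_
  simp [transp, Pi.single_apply, smul_eq_C_mul, mul_comm]

/-- The equations of the variety belong to the ideal of each of the 3-spaces. -/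
lemma map_mem_linIdeal_conicForms [Algebra ℂ A] {s t : A} (h : s = 1 ∨ t = 1)
    {f : MvPolynomial PIdx ℂ} (hf : f ∈ idealOf variety) :
    MvPolynomial.map (algebraMap ℂ A) f ∈ linIdeal (conicForms (conicLine s t)) := by
  obtain ⟨σ, hσ⟩ := exists_section_psi h
  have hs : transp (psi s t) ∘ₗ transp σ = LinearMap.id := by rw [← transp_comp, hσ, transp_id]
  rw [conicForms_conicLine h, mem_linIdeal_ker_iff hs,
    ← aeval_psi_eq_zero (C s) (C t) (X : Fin 4 → MvPolynomial (Fin 4) A) hf]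
  rw [linSubst, aeval_map_algebraMap]
  congr 2
  funext k
  have := linSubst_transp_psi s t k
  rwa [linSubst, aeval_X] at this

/-- Over a local ring, a direct summand of rank one of `A³` on which the conic vanishes is spanned
by a point `(s², st, t²)`. -/
lemma exists_eq_conicLine [IsLocalRing A] {ℓ : Submodule A (Fin 3 → A)}
    {φ : (Fin 3 → A) →ₗ[A] (Fin 2 → A)} {σ : (Fin 2 → A) →ₗ[A] (Fin 3 → A)}
    (hφ : LinearMap.ker φ = ℓ) (hσ : φ ∘ₗ σ = LinearMap.id)
    (hq : ∀ v ∈ ℓ, v 0 * v 2 = v 1 ^ 2) : ∃ s t : A, (s = 1 ∨ t = 1) ∧ ℓ = conicLine s t := by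
  let a : Fin 3 → A := fun k => φ (Pi.single k 1) 0
  let b : Fin 3 → A := fun k => φ (Pi.single k 1) 1
  let p := σ (Pi.single 0 1)
  let r := σ (Pi.single 1 1)
  have h0 : ∀ v, φ v 0 = v 0 * a 0 + v 1 * a 1 + v 2 * a 2 := fun v => by
    conv_lhs => rw [pi_eq_sum_univ' v]
    simp [map_sum, Fin.sum_univ_three, a]
  have h1 : ∀ v, φ v 1 = v 0 * b 0 + v 1 * b 1 + v 2 * b 2 := fun v => by
    conv_lhs => rw [pi_eq_sum_univ' v]
    simp [map_sum, Fin.sum_univ_three, b]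
  have hp : φ p = Pi.single 0 1 := LinearMap.congr_fun hσ _
  have hr : φ r = Pi.single 1 1 := LinearMap.congr_fun hσ _
  have hp0 := congrFun hp 0
  have hp1 := congrFun hp 1
  have hr0 := congrFun hr 0
  have hr1 := congrFun hr 1
  rw [h0] at hp0 hr0
  rw [h1] at hp1 hr1
  simp at hp0 hp1 hr0 hr1
  -- the cross product of the two rows of `φ` spans the kernel; `c` is the dual cross product
  let w : Fin 3 → A := ![a 1 * b 2 - a 2 * b 1, a 2 * b 0 - a 0 * b 2, a 0 * b 1 - a 1 * b 0]
  let c : Fin 3 → A := ![p 1 * r 2 - p 2 * r 1, p 2 * r 0 - p 0 * r 2, p 0 * r 1 - p 1 * r 0]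
  have hcw : c 0 * w 0 + c 1 * w 1 + c 2 * w 2 = 1 := by
    simp [c, w]
    linear_combination (p 0 * a 0 + p 1 * a 1 + p 2 * a 2) * hr1 + hp0 -
      (r 0 * a 0 + r 1 * a 1 + r 2 * a 2) * hp1
  have hker : ∀ v, v ∈ ℓ ↔ φ v 0 = 0 ∧ φ v 1 = 0 := fun v => by
    rw [← hφ, LinearMap.mem_ker]
    exact ⟨fun h => by simp [h], fun h => by funext i; fin_cases i <;> simp [h]⟩
  have hw : w ∈ ℓ := by
    rw [hker, h0, h1]
    constructor <;> simp [w] <;> ring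
  have hspan : ∀ v ∈ ℓ, v = (c 0 * v 0 + c 1 * v 1 + c 2 * v 2) • w := by
    intro v hv
    rw [hker, h0, h1] at hv
    obtain ⟨ha, hb⟩ := hv
    have e0 : v 1 * w 2 = v 2 * w 1 := by
      simp [w]; linear_combination a 0 * hb - b 0 * ha
    have e1 : v 2 * w 0 = v 0 * w 2 := by
      simp [w]; linear_combination a 1 * hb - b 1 * ha
    have e2 : v 0 * w 1 = v 1 * w 0 := by
      simp [w]; linear_combination a 2 * hb - b 2 * ha
    have f0 : v 0 = (c 0 * v 0 + c 1 * v 1 + c 2 * v 2) * w 0 := by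
      linear_combination -v 0 * hcw + c 1 * e2 - c 2 * e1
    have f1 : v 1 = (c 0 * v 0 + c 1 * v 1 + c 2 * v 2) * w 1 := by
      linear_combination -v 1 * hcw - c 0 * e2 + c 2 * e0
    have f2 : v 2 = (c 0 * v 0 + c 1 * v 1 + c 2 * v 2) * w 2 := by
      linear_combination -v 2 * hcw + c 0 * e1 - c 1 * e0
    funext i
    fin_cases i
    · exact f0
    · exact f1
    · exact f2
  have hle : ∀ s t : A, ∀ u x : A, w = u • conicVec s t → x • w = conicVec s t →
      ℓ = conicLine s t := by
    intro s t u x hu hx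
    apply le_antisymm
    · intro v hv
      rw [hspan v hv, hu, smul_smul]
      exact Submodule.mem_span_singleton.2 ⟨_, rfl⟩
    · rw [conicLine, Submodule.span_singleton_le_iff_mem, ← hx]
      exact ℓ.smul_mem _ hw
  have hQ := hq w hw
  -- if `w₀` and `w₂` lie in the maximal ideal, so does `w₁`, as `w₁² = w₀ w₂`
  have hunit : IsUnit (w 0) ∨ IsUnit (w 2) := by
    by_contra! hn
    have n1 : ¬ IsUnit (w 1) := fun h => hn.1 (isUnit_of_mul_isUnit_left (hQ ▸ h.pow 2))
    have : (1 : A) ∈ IsLocalRing.maximalIdeal A := by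
      rw [← hcw]
      refine Ideal.add_mem _ (Ideal.add_mem _ ?_ ?_) ?_ <;> refine Ideal.mul_mem_left _ _ ?_
      · exact hn.1
      · exact n1
      · exact hn.2
    exact this isUnit_one
  rcases hunit with ⟨u, hu⟩ | ⟨u, hu⟩
  · have hi : (↑u⁻¹ : A) * w 0 = 1 := by rw [← hu]; exact u.inv_mul
    refine ⟨1, ↑u⁻¹ * w 1, Or.inl rfl, hle _ _ (w 0) ↑u⁻¹ ?_ ?_⟩
    · funext i
      fin_cases i <;> simp only [conicVec, Pi.smul_apply, smul_eq_mul] <;> simp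
      · linear_combination -w 1 * hi
      · linear_combination (-w 2 - ↑u⁻¹ * w 0 * w 2) * hi + ↑u⁻¹ ^ 2 * w 0 * hQ
    · funext i
      fin_cases i <;> simp only [conicVec, Pi.smul_apply, smul_eq_mul] <;> simp
      · exact hu
      · linear_combination (-↑u⁻¹ * w 2) * hi + ↑u⁻¹ ^ 2 * hQ
  · have hi : (↑u⁻¹ : A) * w 2 = 1 := by rw [← hu]; exact u.inv_mul
    refine ⟨↑u⁻¹ * w 1, 1, Or.inr rfl, hle _ _ (w 2) ↑u⁻¹ ?_ ?_⟩
    · funext i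
      fin_cases i <;> simp only [conicVec, Pi.smul_apply, smul_eq_mul] <;> simp
      · linear_combination (-w 0 - ↑u⁻¹ * w 2 * w 0) * hi + ↑u⁻¹ ^ 2 * w 2 * hQ
      · linear_combination -w 1 * hi
    · funext i
      fin_cases i <;> simp only [conicVec, Pi.smul_apply, smul_eq_mul] <;> simp
      · linear_combination (-↑u⁻¹ * w 0) * hi + ↑u⁻¹ ^ 2 * hQ
      · exact hu

end Annihilator

/-! ### The Hilbert functor -/

section Functor

/-- The matrix of the conic `2 (α₀ α₂ - α₁²) = 0`. -/
def conicMatrix : Matrix (Fin 3) (Fin 3) ℂ := !![0, 0, 1; 0, -2, 0; 1, 0, 0]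

lemma conicMatrix_form {R : Type} [CommRing R] [Algebra ℂ R] (v : Fin 3 → R) :
    v ⬝ᵥ ((conicMatrix.map (algebraMap ℂ R)).mulVec v) = 2 * (v 0 * v 2 - v 1 ^ 2) := by
  have h2 : algebraMap ℂ R 2 = 2 := map_ofNat _ 2
  simp [dotProduct, Matrix.mulVec, conicMatrix, Fin.sum_univ_three, h2]
  ring

lemma isUnit_two (R : Type) [CommRing R] [Algebra ℂ R] : IsUnit (2 : R) := by
  have : IsUnit (2 : ℂ) := by simp
  have := this.map (algebraMap ℂ R)
  rwa [map_ofNat] at this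

/-- A submodule of `R³` that is locally spanned by points `(s², st, t²)` of the conic. -/
structure IsConicLine {R : Type} [CommRing R] (ℓ : Submodule R (Fin 3 → R)) : Prop where
  fg : ℓ.FG
  loc : ∀ p : PrimeSpectrum R, ∃ s t, (s = 1 ∨ t = 1) ∧ vecSpan (toLocal p) ℓ = conicLine s t

variable {R : Type} [CommRing R]

lemma fg_of_projective_quotient {ι : Type} [Finite ι] (N : Submodule R (ι → R))
    [Module.Projective R ((ι → R) ⧸ N)] : N.FG := by
  have : Module.FinitePresentation R ((ι → R) ⧸ N) := Module.finitePresentation_of_projective _ _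
  have := Module.FinitePresentation.fg_ker N.mkQ N.mkQ_surjective
  rwa [Submodule.ker_mkQ] at this

lemma IsConicLine.baseChange {S : Type} [CommRing S] {ℓ : Submodule R (Fin 3 → R)}
    (h : IsConicLine ℓ) (f : R →+* S) : IsConicLine (vecSpan f ℓ) where
  fg := by
    obtain ⟨T, hT⟩ := h.fg
    rw [← hT, vecSpan_span]
    exact Submodule.fg_span (T.finite_toSet.image _)
  loc p := by
    obtain ⟨s, t, hst, he⟩ := h.loc (PrimeSpectrum.comap f p)
    let g := Localization.localRingHom (PrimeSpectrum.comap f p).asIdeal p.asIdeal f rfl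
    have hg : (toLocal p).comp f = g.comp (toLocal (PrimeSpectrum.comap f p)) :=
      RingHom.ext fun r => (Localization.localRingHom_to_map _ _ f rfl r).symm
    refine ⟨g s, g t, hst.imp (fun h => by rw [h, map_one]) (fun h => by rw [h, map_one]), ?_⟩
    rw [vecSpan_comp, hg, ← vecSpan_comp, he, vecSpan_conicLine]

variable [Algebra ℂ R]

/-- The polarization of the quadratic form `x₀ x₂ - x₁²`. -/
def conicPolar {A : Type} [CommRing A] (x : Fin 3 → A) : (Fin 3 → A) →ₗ[A] A :=
  x 0 • LinearMap.proj 2 + x 2 • LinearMap.proj 0 - (2 * x 1) • LinearMap.proj 1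

lemma conicPolar_apply {A : Type} [CommRing A] (x y : Fin 3 → A) :
    conicPolar x y = x 0 * y 2 + x 2 * y 0 - 2 * x 1 * y 1 := by
  simp [conicPolar]

/-- The equation of the conic holds on the base change of `ℓ` if it holds on `ℓ`: its polarization
vanishes on generators, hence on their span. -/
lemma quadric_of_mem_vecSpan {A : Type} [CommRing A] (f : R →+* A) (h2 : IsUnit (2 : A))
    {ℓ : Submodule R (Fin 3 → R)} (hq : ∀ a ∈ ℓ, a 0 * a 2 - a 1 ^ 2 = 0) {v : Fin 3 → A}
    (hv : v ∈ vecSpan f ℓ) : v 0 * v 2 = v 1 ^ 2 := by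
  have hK0 : ∀ a ∈ ℓ, ∀ b ∈ ℓ, conicPolar (fun k => f (a k)) (fun k => f (b k)) = 0 := by
    intro a ha b hb
    have hab := hq _ (ℓ.add_mem ha hb)
    have h : a 0 * b 2 + a 2 * b 0 - 2 * a 1 * b 1 = 0 := by
      simp only [Pi.add_apply] at hab
      linear_combination hab - hq a ha - hq b hb
    refine (conicPolar_apply _ _).trans ?_
    simpa only [map_sub, map_add, map_mul, map_ofNat f 2, map_zero] using congrArg f h
  have hK1 : ∀ a ∈ ℓ, ∀ y ∈ vecSpan f ℓ, conicPolar (fun k => f (a k)) y = 0 := fun a ha y hy => by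
    have hle : vecSpan f ℓ ≤ LinearMap.ker (conicPolar fun k => f (a k)) := by
      refine Submodule.span_le.2 ?_
      rintro _ ⟨b, hb, rfl⟩
      exact hK0 a ha b hb
    exact hle hy
  have hK2 : vecSpan f ℓ ≤ LinearMap.ker (conicPolar v) := by
    refine Submodule.span_le.2 ?_
    rintro _ ⟨a, ha, rfl⟩
    have h0 := (conicPolar_apply _ _).symm.trans (hK1 a ha v hv)
    refine LinearMap.mem_ker.2 ((conicPolar_apply _ _).trans ?_)
    linear_combination h0
  have hK3 : conicPolar v v = 0 := hK2 hv
  rw [conicPolar_apply] at hK3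
  refine h2.mul_right_inj.1 ?_
  linear_combination hK3

lemma ConicPoint.isConicLine (ℓ : ConicPoint conicMatrix R) : IsConicLine ℓ.line.toSubmodule where
  fg := fg_of_projective_quotient _
  loc p := by
    obtain ⟨φ, σ, hφ, hσ⟩ := exists_surjection_atPrime ℓ.line.toSubmodule p
      (ℓ.line.rankAtStalk_eq p)
    refine exists_eq_conicLine hφ hσ fun v hv => ?_
    have hq : ∀ a ∈ ℓ.line.toSubmodule, a 0 * a 2 - a 1 ^ 2 = 0 := fun a ha => by
      have := ℓ.vanish a ha
      rwa [conicMatrix_form, (isUnit_two R).mul_right_eq_zero] at this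
    exact quadric_of_mem_vecSpan (toLocal p) (isUnit_two _) hq hv

lemma IsConicLine.projective {ℓ : Submodule R (Fin 3 → R)} (h : IsConicLine ℓ) :
    Module.Projective R ((Fin 3 → R) ⧸ ℓ) ∧
      ∀ p : PrimeSpectrum R, Module.rankAtStalk (R := R) ((Fin 3 → R) ⧸ ℓ) p = 2 := by
  refine projective_quotient_of_forall_prime h.fg fun p => ?_
  obtain ⟨s, t, hst, he⟩ := h.loc p
  rw [he]
  rcases hst with rfl | rfl
  · refine ⟨LinearMap.pi ![LinearMap.proj 1 - t • LinearMap.proj 0,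
      LinearMap.proj 2 - t ^ 2 • LinearMap.proj 0], fun w => ⟨![0, w 0, w 1], ?_⟩, ?_⟩
    · funext i; fin_cases i <;> simp
    · ext v
      rw [LinearMap.mem_ker, Submodule.mem_span_singleton]
      constructor
      · intro h
        have h0 := congrFun h 0
        have h1 := congrFun h 1
        simp at h0 h1
        refine ⟨v 0, ?_⟩
        funext i
        fin_cases i <;> simp [conicVec]
        · linear_combination -h0
        · linear_combination -h1
      · rintro ⟨a, rfl⟩
        funext i
        fin_cases i <;> simp [conicVec] <;> ring
  · refine ⟨LinearMap.pi ![LinearMap.proj 0 - s ^ 2 • LinearMap.proj 2,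
      LinearMap.proj 1 - s • LinearMap.proj 2], fun w => ⟨![w 0, w 1, 0], ?_⟩, ?_⟩
    · funext i; fin_cases i <;> simp
    · ext v
      rw [LinearMap.mem_ker, Submodule.mem_span_singleton]
      constructor
      · intro h
        have h0 := congrFun h 0
        have h1 := congrFun h 1
        simp at h0 h1
        refine ⟨v 2, ?_⟩
        funext i
        fin_cases i <;> simp [conicVec]
        · linear_combination -h0
        · linear_combination -h1
      · rintro ⟨a, rfl⟩
        funext i
        fin_cases i <;> simp [conicVec] <;> ring

lemma IsConicLine.quadric {ℓ : Submodule R (Fin 3 → R)} (h : IsConicLine ℓ) {v : Fin 3 → R}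
    (hv : v ∈ ℓ) : v 0 * v 2 - v 1 ^ 2 = 0 := by
  refine Module.eq_zero_of_localization_maximal (fun P _ => Localization.AtPrime P)
    (fun P _ => Algebra.linearMap R (Localization.AtPrime P)) _ fun P hP => ?_
  obtain ⟨s, t, hst, he⟩ := h.loc ⟨P, hP.isPrime⟩
  have hv' : (fun k => toLocal ⟨P, hP.isPrime⟩ (v k)) ∈ conicLine s t :=
    he ▸ Submodule.subset_span ⟨v, hv, rfl⟩
  obtain ⟨a, ha⟩ := Submodule.mem_span_singleton.1 hv'
  have h0 := congrFun ha 0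
  have h1 := congrFun ha 1
  have h2 := congrFun ha 2
  simp [conicVec] at h0 h1 h2
  simp only [Algebra.linearMap_apply, map_sub, map_mul, map_pow, ← h0, ← h1, ← h2]
  ring

/-- A family of points of the conic, from a submodule that is locally of the standard form. -/
def IsConicLine.toConicPoint {ℓ : Submodule R (Fin 3 → R)} (h : IsConicLine ℓ) :
    ConicPoint conicMatrix R where
  line :=
    { toSubmodule := ℓ
      finite_quotient := inferInstance
      projective_quotient := h.projective.1
      rankAtStalk_eq := fun p => h.projective.2 p }
  vanish v hv := by rw [conicMatrix_form, h.quadric hv, mul_zero]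

lemma conicPoint_ext {ℓ ℓ' : ConicPoint conicMatrix R}
    (h : ℓ.line.toSubmodule = ℓ'.line.toSubmodule) : ℓ = ℓ' := by
  obtain ⟨l, hl⟩ := ℓ
  obtain ⟨l', hl'⟩ := ℓ'
  obtain rfl : l = l' := Module.Grassmannian.ext h
  rfl

lemma hilbP3_ext {X : Set (ℙ ℂ W)} {Z Z' : HilbP3 X R} (h : Z.ideal = Z'.ideal) : Z = Z' := by
  obtain ⟨I, _, _, _, _⟩ := Z
  obtain ⟨I', _, _, _, _⟩ := Z'
  obtain rfl : I = I' := h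
  rfl

lemma IsConicLine.projective_conicForms {ℓ : Submodule R (Fin 3 → R)} (h : IsConicLine ℓ) :
    Module.Projective R ((PIdx → R) ⧸ conicForms ℓ) ∧
      ∀ p : PrimeSpectrum R, Module.rankAtStalk (R := R) ((PIdx → R) ⧸ conicForms ℓ) p = 4 := by
  refine projective_quotient_of_forall_prime (conicForms_fg h.fg) fun p => ?_
  obtain ⟨s, t, hst, he⟩ := h.loc p
  obtain ⟨σ, hσ⟩ := exists_section_psi hst
  refine ⟨transp (psi s t), fun e => ⟨transp σ e, ?_⟩, ?_⟩
  · rw [← LinearMap.comp_apply, ← transp_comp, hσ, transp_id, LinearMap.id_apply]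
  · rw [vecSpan_conicForms, he, conicForms_conicLine hst]

/-- The family of 3-spaces attached to a family of points of the conic. -/
def hilbOfConic (ℓ : ConicPoint conicMatrix R) : HilbP3 variety R where
  ideal := linIdeal (conicForms ℓ.line.toSubmodule)
  homogeneous f hf d := homogeneousComponent_mem_linIdeal hf d
  projective d := by
    have := ℓ.isConicLine.projective_conicForms.1
    exact gradedPiece_linIdeal_projective _ d
  rank d p := by
    have := ℓ.isConicLine.projective_conicForms.1
    exact rankAtStalk_gradedPiece_linIdeal _ p (ℓ.isConicLine.projective_conicForms.2 p) d
  contained := by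
    refine Ideal.map_le_iff_le_comap.2 fun f hf => Ideal.mem_comap.2 ?_
    refine mem_of_forall_map_mem fun p => ?_
    obtain ⟨s, t, hst, he⟩ := ℓ.isConicLine.loc p
    rw [map_linIdeal, vecSpan_conicForms, he, MvPolynomial.map_map]
    exact map_mem_linIdeal_conicForms hst hf

lemma hilbOfConic_injective : Function.Injective (hilbOfConic (R := R)) := by
  intro ℓ ℓ' h
  have hI : linIdeal (conicForms ℓ.line.toSubmodule) =
      linIdeal (conicForms ℓ'.line.toSubmodule) :=
    congrArg HilbP3.ideal h
  have := ℓ.isConicLine.projective_conicForms.1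
  have := ℓ'.isConicLine.projective_conicForms.1
  have hN : conicForms ℓ.line.toSubmodule = conicForms ℓ'.line.toSubmodule := by
    ext a
    rw [← linForm_mem_linIdeal_iff, hI, linForm_mem_linIdeal_iff]
  refine conicPoint_ext ?_
  rw [← map_conicProj_conicForms ℓ.line.toSubmodule, hN, map_conicProj_conicForms]

/-- The polynomial equations of the variety, at the point with coordinates `X`. -/
lemma X_mem_idealOf :
    IsLin (fun k => (Ideal.Quotient.mk (idealOf variety) (X k))) ∧
    ∀ (i j k l : Fin 7) (hij : i < j) (hjk : j < k) (hkl : k < l),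
      pluPolar (X : PIdx → MvPolynomial PIdx ℂ) X i j k l hij hjk hkl ∈ idealOf variety := by
  have key : ∀ f : MvPolynomial PIdx ℂ, (∀ v w, IsLin (wedge v w) → eval (wedge v w) f = 0) →
      f ∈ idealOf variety := by
    rintro f hf z ⟨hz, hm⟩
    obtain ⟨hl, v, w, rfl⟩ := (mk_mem_variety_iff hz).1 hm
    exact hf v w hl
  constructor
  · constructor
    case h01 => exact Ideal.Quotient.eq_zero_iff_mem.2 (key _ fun v w h => by simp [h.h01])
    case h34 => exact Ideal.Quotient.eq_zero_iff_mem.2 (key _ fun v w h => by simp [h.h34])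
    case h14 =>
      rw [← map_neg]; exact Ideal.Quotient.eq.2 (key _ fun v w h => by simp [h.h14])
    case h36 =>
      rw [← map_neg]; exact Ideal.Quotient.eq.2 (key _ fun v w h => by simp [h.h36])
    case h46 => exact Ideal.Quotient.eq.2 (key _ fun v w h => by simp [h.h46])
    case h45 =>
      rw [← map_neg]; exact Ideal.Quotient.eq.2 (key _ fun v w h => by simp [h.h45])
    case h35 => exact Ideal.Quotient.eq.2 (key _ fun v w h => by simp [h.h35])
  · intro i j k l hij hjk hkl
    refine key _ fun v w _ => ?_
    rw [← pluPolar_wedge v w i j k l hij hjk hkl]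
    simp [pluPolar]

lemma pluPolar_map {A B : Type} [CommRing A] [CommRing B] (g : A →+* B) (z w : PIdx → A)
    (i j k l : Fin 7) (hij : i < j) (hjk : j < k) (hkl : k < l) :
    g (pluPolar z w i j k l hij hjk hkl) = pluPolar (g ∘ z) (g ∘ w) i j k l hij hjk hkl := by
  simp [pluPolar]

/-- Points with values in a `ℂ`-algebra at which the ideal of the variety vanishes satisfy the
linear and quadratic equations. -/
lemma isLin_of_aeval_eq_zero {B : Type} [CommRing B] [Algebra ℂ B] {z : PIdx → B}
    (h : ∀ f ∈ idealOf variety, aeval z f = 0) : IsLin z ∧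
    ∀ (i j k l : Fin 7) (hij : i < j) (hjk : j < k) (hkl : k < l),
      pluPolar z z i j k l hij hjk hkl = 0 := by
  constructor
  · have := X_mem_idealOf.1.map (Ideal.Quotient.lift (idealOf variety)
      (aeval z : MvPolynomial PIdx ℂ →ₐ[ℂ] B).toRingHom h)
    have hz : z = (Ideal.Quotient.lift (idealOf variety)
      (aeval z : MvPolynomial PIdx ℂ →ₐ[ℂ] B).toRingHom h) ∘
        fun k => (Ideal.Quotient.mk (idealOf variety) (X k)) := by
      funext k
      simp
    rwa [← hz] at this
  · intro i j k l hij hjk hkl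
    have h1 := h _ (X_mem_idealOf.2 i j k l hij hjk hkl)
    have h2 := pluPolar_map (aeval z : MvPolynomial PIdx ℂ →ₐ[ℂ] B).toRingHom X X i j k l hij hjk
      hkl
    have hz : z = (aeval z : MvPolynomial PIdx ℂ →ₐ[ℂ] B).toRingHom ∘ X := by
      funext k
      simp
    rw [← hz] at h2
    exact h2.symm.trans h1

/-- At a local ring, the linear forms of a family of 3-spaces in the variety are those of a point
of the conic. -/
lemma ker_eq_conicForms {A : Type} [CommRing A] [IsLocalRing A] [Algebra ℂ A]
    {φ : (PIdx → A) →ₗ[A] (Fin 4 → A)} {σ : (Fin 4 → A) →ₗ[A] (PIdx → A)}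
    (hσ : φ ∘ₗ σ = LinearMap.id)
    (h : (idealOf variety).map (MvPolynomial.map (algebraMap ℂ A)) ≤
      linIdeal (LinearMap.ker φ)) :
    ∃ s t : A, (s = 1 ∨ t = 1) ∧ LinearMap.ker φ = conicForms (conicLine s t) := by
  let P := transp φ
  have hP : transp σ ∘ₗ P = LinearMap.id := by rw [← transp_comp, hσ, transp_id]
  have hker : LinearMap.ker φ = LinearMap.ker (transp P) := by rw [transp_transp]
  have hz : ∀ e, ∀ f ∈ idealOf variety, aeval (P e) f = 0 := by
    intro e f hf
    have h1 := (mem_linIdeal_ker_iff hσ _).1 (h (Ideal.mem_map_of_mem _ hf))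
    have h2 := congrArg (aeval (R := A) e) h1
    rw [map_zero, linSubst, ← AlgHom.comp_apply, comp_aeval, aeval_map_algebraMap] at h2
    rw [← h2]
    congr 2
    funext k
    rw [aeval_eq_eval, eval_linForm]
    change ∑ i, e i * φ (Pi.single k 1) i = _
    exact Finset.sum_congr rfl fun i _ => mul_comm (e i) (φ (Pi.single k 1) i)
  have hlin := fun e => (isLin_of_aeval_eq_zero (hz e)).1
  have hplu := fun e => (isLin_of_aeval_eq_zero (hz e)).2
  obtain ⟨s, t, hst, hr⟩ := range_eq_range_psi P (transp σ) hP hlin fun e f =>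
    rel_of_pluPolar (hlin e) (hlin f) fun i j k l hij hjk hkl =>
      pluPolar_eq_zero_of_add (isUnit_two A) hij hjk hkl (hplu e _ _ _ _ _ _ _)
        (hplu f _ _ _ _ _ _ _) (by rw [← map_add]; exact hplu (e + f) _ _ _ _ _ _ _)
  exact ⟨s, t, hst, by rw [hker, ker_transp_eq hr, conicForms_conicLine hst]⟩

/-- The linear forms in the ideal of a family of 3-spaces. -/
def HilbP3.forms {X : Set (ℙ ℂ W)} (Z : HilbP3 X R) : Submodule R (PIdx → R) :=
  (Z.ideal.restrictScalars R).comap linForm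

lemma HilbP3.mem_forms {X : Set (ℙ ℂ W)} (Z : HilbP3 X R) (a : PIdx → R) :
    a ∈ Z.forms ↔ linForm a ∈ Z.ideal := Iff.rfl

/-- The space of linear forms modulo those of the family is the first graded piece. -/
def HilbP3.quotFormsEquiv {X : Set (ℙ ℂ W)} (Z : HilbP3 X R) :
    ((PIdx → R) ⧸ Z.forms) ≃ₗ[R] GradedPiece Z.ideal 1 := by
  let f : (PIdx → R) →ₗ[R] GradedPiece Z.ideal 1 := Submodule.mkQ _ ∘ₗ
    linForm.codRestrict (homogeneousSubmodule PIdx R 1) linForm_isHomogeneous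
  have hf : LinearMap.ker f = Z.forms := by
    ext a
    rw [LinearMap.mem_ker, Z.mem_forms]
    exact gradedPiece_mk_eq_zero (I := Z.ideal) ⟨linForm a, linForm_isHomogeneous a⟩
  refine (Submodule.quotEquivOfEq _ _ hf.symm).trans (f.quotKerEquivOfSurjective ?_)
  intro g
  obtain ⟨⟨g, hg⟩, rfl⟩ := Submodule.Quotient.mk_surjective _ g
  obtain ⟨a, rfl⟩ := exists_linForm_eq hg
  exact ⟨a, rfl⟩

/-- The ideal of a family of 3-spaces is generated by linear forms: its linear forms generate a
smaller ideal with the same Hilbert function, and a surjection between locally free modules of the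
same rank is bijective. -/
lemma HilbP3.ideal_eq {X : Set (ℙ ℂ W)} (Z : HilbP3 X R) : Z.ideal = linIdeal Z.forms := by
  have hle : linIdeal Z.forms ≤ Z.ideal := Ideal.span_le.2 (by rintro _ ⟨a, ha, rfl⟩; exact ha)
  refine le_antisymm ?_ hle
  have := Z.projective 1
  have hproj : Module.Projective R ((PIdx → R) ⧸ Z.forms) :=
    Module.Projective.of_equiv Z.quotFormsEquiv.symm
  have hrank : ∀ p, Module.rankAtStalk (R := R) ((PIdx → R) ⧸ Z.forms) p = 4 := fun p => by
    rw [Module.rankAtStalk_eq_of_equiv Z.quotFormsEquiv, Z.rank]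
    rfl
  intro f hf
  rw [← sum_homogeneousComponent f]
  refine Ideal.sum_mem _ fun d _ => ?_
  have := Z.projective d
  have := gradedPiece_linIdeal_projective Z.forms d
  let π : GradedPiece (linIdeal Z.forms) d →ₗ[R] GradedPiece Z.ideal d :=
    Submodule.factor fun g hg => hle hg
  have hπ : Function.Bijective π := by
    refine Module.bijective_of_surjective_of_rankAtStalk_eq (Submodule.factor_surjective _) ?_
    intro p hp
    rw [Z.rank, rankAtStalk_gradedPiece_linIdeal _ _ (hrank _)]
  let g : homogeneousSubmodule PIdx R d :=
    ⟨homogeneousComponent d f, homogeneousComponent_mem d f⟩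
  refine (gradedPiece_mk_eq_zero (I := linIdeal Z.forms) g).1 (hπ.1 ?_)
  rw [map_zero]
  exact (gradedPiece_mk_eq_zero (I := Z.ideal) g).2 (Z.homogeneous f hf d)

/-- A family of 3-spaces comes from the image of its linear forms under `conicProj`, which can be
checked at the local rings. -/
lemma hilbOfConic_surjective : Function.Surjective (hilbOfConic (R := R)) := by
  intro Z
  have := Z.projective 1
  have hproj : Module.Projective R ((PIdx → R) ⧸ Z.forms) :=
    Module.Projective.of_equiv Z.quotFormsEquiv.symm
  have hloc : ∀ p : PrimeSpectrum R, ∃ s t, (s = 1 ∨ t = 1) ∧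
      vecSpan (toLocal p) Z.forms = conicForms (conicLine s t) := fun p => by
    have hrank : Module.rankAtStalk (R := R) ((PIdx → R) ⧸ Z.forms) p = 4 := by
      rw [Module.rankAtStalk_eq_of_equiv Z.quotFormsEquiv, Z.rank]
      rfl
    obtain ⟨φ, σ, hφ, hσ⟩ := exists_surjection_atPrime Z.forms p hrank
    rw [← hφ]
    refine ker_eq_conicForms hσ ?_
    rw [hφ, ← map_linIdeal, ← Z.ideal_eq]
    refine le_trans (le_of_eq ?_) (Ideal.map_mono Z.contained)
    rw [Ideal.map_map]
    congr 1
    refine RingHom.ext fun f => ?_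
    rw [RingHom.comp_apply, MvPolynomial.map_map]
    rfl
  have hℓ : IsConicLine (Z.forms.map conicProj) := by
    refine ⟨(fg_of_projective_quotient Z.forms).map _, fun p => ?_⟩
    obtain ⟨s, t, hst, he⟩ := hloc p
    exact ⟨s, t, hst, by rw [vecSpan_map_conicProj, he, map_conicProj_conicForms]⟩
  refine ⟨hℓ.toConicPoint, hilbP3_ext ?_⟩
  change linIdeal (conicForms (Z.forms.map conicProj)) = Z.ideal
  rw [Z.ideal_eq]
  congr 1
  refine eq_of_vecSpan_eq fun p => ?_
  obtain ⟨s, t, hst, he⟩ := hloc p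
  rw [vecSpan_conicForms, vecSpan_map_conicProj, he, map_conicProj_conicForms]

variable (R) in
/-- The isomorphism between the Hilbert functor and the conic. -/
def hilbEquivConic : HilbP3 variety R ≃ ConicPoint conicMatrix R :=
  (Equiv.ofBijective _ ⟨hilbOfConic_injective, hilbOfConic_surjective⟩).symm

lemma hilbEquivConic_hilbOfConic (ℓ : ConicPoint conicMatrix R) :
    hilbEquivConic R (hilbOfConic ℓ) = ℓ := Equiv.symm_apply_apply _ _

/-- The isomorphism commutes with base change. -/
lemma hilbEquivConic_natural {S : Type} [CommRing S] [Algebra ℂ S] (φ : R →ₐ[ℂ] S)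
    (Z : HilbP3 variety R) : ∃ Z' : HilbP3 variety S,
      Z'.ideal = Z.ideal.map (MvPolynomial.map (φ : R →+* S)) ∧
      (hilbEquivConic S Z').line.toSubmodule =
        Submodule.span S ((fun v : Fin 3 → R => fun i => φ (v i)) ''
          ((hilbEquivConic R Z).line.toSubmodule : Set (Fin 3 → R))) := by
  obtain ⟨ℓ, rfl⟩ := hilbOfConic_surjective Z
  let ℓ' := (ℓ.isConicLine.baseChange (φ : R →+* S)).toConicPoint
  refine ⟨hilbOfConic ℓ', ?_, ?_⟩
  · change linIdeal (conicForms (vecSpan _ _)) = (linIdeal _).map _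
    rw [map_linIdeal, vecSpan_conicForms]
  · rw [hilbEquivConic_hilbOfConic, hilbEquivConic_hilbOfConic]
    rfl

/-- The point of the conic attached to a 3-space lies on all the lines that the 3-space
parametrizes. -/
lemma exists_common_point (Z : HilbP3 variety ℂ) (z : W)
    (hz : ∀ f ∈ Z.ideal, MvPolynomial.eval z f = 0) :
    ∃ v ∈ (hilbEquivConic ℂ Z).line.toSubmodule, ∃ w : V, z = wedge (conicPlane v) w := by
  obtain ⟨ℓ, rfl⟩ := hilbOfConic_surjective Z
  rw [hilbEquivConic_hilbOfConic]
  have hrank : Module.finrank ℂ ((Fin 3 → ℂ) ⧸ ℓ.line.toSubmodule) = 2 := by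
    have := ℓ.line.rankAtStalk_eq ⊥
    rwa [Module.rankAtStalk_eq_finrank_of_free] at this
  obtain ⟨φ, σ, hφ, hσ⟩ := exists_surjection _ hrank
  obtain ⟨s, t, hst, he⟩ := exists_eq_conicLine hφ hσ fun v hv =>
    sub_eq_zero.1 (ℓ.isConicLine.quadric hv)
  obtain ⟨e, rfl⟩ := exists_psi_of_forall_conicForms hst (z := z) fun a ha => by
    rw [← eval_linForm]
    exact hz _ (linForm_mem_linIdeal (he ▸ ha))
  have h : s ≠ 0 ∨ t ≠ 0 :=
    hst.imp (fun h => by rw [h]; exact one_ne_zero) (fun h => by rw [h]; exact one_ne_zero)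
  obtain ⟨w, hw⟩ := psi_eq_wedge h e
  exact ⟨conicVec s t, he ▸ Submodule.mem_span_singleton_self _, w, hw⟩

end Functor

/-! ### The union of the 3-spaces is a divisor -/

section Divisor

/-- The linear equations and the vanishing of `q`, as the vanishing of `fixedMap`. -/
lemma isLin_of_fixedMap_eq_zero {A : Type} [CommRing A] {z : PIdx → A} (h : fixedMap z = 0) :
    IsLin z ∧ qc z = 0 := by
  have h0 := congrFun h 0
  have h1 := congrFun h 1
  have h2 := congrFun h 2
  have h3 := congrFun h 3
  have h4 := congrFun h 4
  have h5 := congrFun h 5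
  have h6 := congrFun h 6
  have h7 := congrFun h 7
  have h8 := congrFun h 8
  have h9 := congrFun h 9
  simp only [fixedMap, LinearMap.coe_mk, AddHom.coe_mk] at h0 h1 h2 h3 h4 h5 h6 h7 h8 h9
  simp at h0 h1 h2 h3 h4 h5 h6 h7 h8 h9
  refine ⟨⟨h0, h1, eq_neg_of_add_eq_zero_left h2, eq_neg_of_add_eq_zero_left h3, sub_eq_zero.1 h4,
    eq_neg_of_add_eq_zero_left h5, sub_eq_zero.1 h6⟩, ?_⟩
  funext i
  fin_cases i
  · exact h7
  · exact h8
  · exact h9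

lemma pluPolar_psi (s t : ℂ) (e : Fin 4 → ℂ) (i j k l : Fin 7) (hij : i < j) (hjk : j < k)
    (hkl : k < l) : pluPolar (psi s t e) (psi s t e) i j k l hij hjk hkl = 0 := by
  by_cases h : s ≠ 0 ∨ t ≠ 0
  · obtain ⟨w, hw⟩ := psi_eq_wedge h e
    rw [hw, pluPolar_wedge]
  · push Not at h
    rw [h.1, h.2, psi_zero]
    simp [pluPolar]

/-- The union of the 3-spaces is cut out by the Plücker quadrics and the linear forms `fixedMap`. -/
lemma unionOfP3_isZariskiClosed : IsZariskiClosed (unionOfP3 variety) := by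
  refine ⟨Set.range (fun i => linForm (fixedForm i)) ∪
    {f | ∃ (i j k l : Fin 7) (hij : i < j) (hjk : j < k) (hkl : k < l),
      f = pluPolar (X : PIdx → MvPolynomial PIdx ℂ) X i j k l hij hjk hkl}, ?_, ?_⟩
  · rintro f (⟨i, rfl⟩ | ⟨i, j, k, l, hij, hjk, hkl, rfl⟩)
    · exact ⟨1, linForm_isHomogeneous _⟩
    · refine ⟨2, ?_⟩
      have hm : ∀ a b : PIdx, (X a * X b : MvPolynomial PIdx ℂ).IsHomogeneous 2 :=
        fun a b => (isHomogeneous_X ℂ a).mul (isHomogeneous_X ℂ b)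
      exact ((((hm _ _).add (hm _ _)).sub (hm _ _)).sub (hm _ _)).add (hm _ _) |>.add (hm _ _)
  · ext p
    conv_lhs => rw [← p.mk_rep, mk_mem_unionOfP3_iff]
    have hfix : ∀ z : W, ∀ i, eval z (linForm (fixedForm i)) = fixedMap z i := fun z i => by
      rw [eval_linForm, fixedForm, formCoeff_dot]
      rfl
    have hplu : ∀ (z : W) (i j k l : Fin 7) (hij : i < j) (hjk : j < k) (hkl : k < l),
        eval z (pluPolar X X i j k l hij hjk hkl) = pluPolar z z i j k l hij hjk hkl := by
      intro z i j k l hij hjk hkl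
      simp [pluPolar]
    constructor
    · rintro ⟨s, t, e, he⟩ f (⟨i, rfl⟩ | ⟨i, j, k, l, hij, hjk, hkl, rfl⟩)
      · rw [hfix, he, fixedMap_psi]
        rfl
      · rw [hplu, he, pluPolar_psi]
    · intro h
      have h1 : fixedMap p.rep = 0 := funext fun i => by
        rw [← hfix]
        exact h _ (Or.inl ⟨i, rfl⟩)
      obtain ⟨hl, hq⟩ := isLin_of_fixedMap_eq_zero h1
      refine exists_psi_of_rel hl (rel_of_pluPolar hl hl fun i j k l hij hjk hkl => ?_) hq
      rw [← hplu]
      exact h _ (Or.inr ⟨i, j, k, l, hij, hjk, hkl, rfl⟩)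

lemma idealOf_unionOfP3_eq_ker : idealOf (unionOfP3 variety) =
    RingHom.ker (aeval genPsi : MvPolynomial PIdx ℂ →ₐ[ℂ] MvPolynomial (Fin 6) ℂ) :=
  Ideal.ext mem_idealOf_unionOfP3_iff

instance isPrime_idealOf_unionOfP3 : (idealOf (unionOfP3 variety)).IsPrime := by
  rw [idealOf_unionOfP3_eq_ker]
  exact RingHom.ker_isPrime _

/-- A parametrization of points of the variety by pairs of a vector `(a, b)` of `A` and a binary
cubic `g`: up to sign, `q` is the square of `(a, b)` and `y` is the Hessian of `g`. -/
def chi {A : Type} [CommRing A] (a b : A) (g : Fin 4 → A) : PIdx → A :=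
  ofCoords ![-a ^ 2, -(a * b), -b ^ 2]
    ![g 1 ^ 2 - g 0 * g 2, g 1 * g 2 - g 0 * g 3, g 2 ^ 2 - g 1 * g 3] (fun i => a * g i)
    (fun i => b * g i)

lemma chi_eq_wedge (a b : ℂ) (g : Fin 4 → ℂ) :
    chi a b g = wedge ![0, 0, g 1, b, a, -g 3, g 2] ![a, -b, -g 0, 0, 0, g 2, -g 1] := by
  funext k
  revert k
  refine PIdx.forall_of ?_
  simp only [chi, ofCoords, wedge]
  refine ⟨?_, ?_, ?_, ?_, ?_, ?_, ?_, ?_, ?_, ?_, ?_, ?_, ?_, ?_, ?_, ?_, ?_, ?_, ?_, ?_, ?_⟩ <;>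
    simp <;> ring

/-- The generic point of the parametrization `chi`. -/
def genChi : PIdx → MvPolynomial (Fin 6) ℂ := chi (X 0) (X 1) ![X 2, X 3, X 4, X 5]

lemma eval_genChi (c : Fin 6 → ℂ) (f : MvPolynomial PIdx ℂ) :
    eval c (aeval genChi f) = eval (chi (c 0) (c 1) ![c 2, c 3, c 4, c 5]) f := by
  have h : ∀ k, eval c (genChi k) = chi (c 0) (c 1) ![c 2, c 3, c 4, c 5] k := by
    refine PIdx.forall_of ?_
    simp [genChi, chi, ofCoords]
  rw [aeval_eq_bind₁, ← coe_aeval_eq_eval, ← coe_aeval_eq_eval, RingHom.coe_coe, RingHom.coe_coe,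
    aeval_bind₁]
  congr 2
  funext k
  simpa using h k

/-- The points `chi a b g` lie on the variety; the factor `a` excludes the zero vector. -/
lemma aeval_genChi_eq_zero {f : MvPolynomial PIdx ℂ} (hf : f ∈ idealOf variety) :
    aeval genChi f = 0 := by
  have h0 : aeval genChi f * X 0 = 0 := by
    refine MvPolynomial.funext fun c => ?_
    rw [map_mul, eval_genChi, map_zero, eval_X]
    by_cases hc : c 0 = 0
    · rw [hc, mul_zero]
    · have hz : chi (c 0) (c 1) ![c 2, c 3, c 4, c 5] ≠ 0 := fun h => by
        have := congrFun h (ix 0 4)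
        simp [chi, ofCoords, hc] at this
      rw [show eval _ f = 0 from hf _ ⟨hz, (mk_mem_variety_iff hz).2
        ⟨isLin_ofCoords .., _, _, chi_eq_wedge ..⟩⟩, zero_mul]
  simpa [X_ne_zero] using h0

/-- Each point `psi s t e` with `s ≠ 0` is a limit of points of the form `chi a b g`: with
`b = (s, t)` and a suitable cubic `h`, it is the limit for `ε → 0` of the points
`chi (ε e₂) (ε e₃) (ε⁻¹ (b³ + ε² h))`. As the Hessian of `b³` vanishes, the coordinates `y`
converge, and `h` is chosen to give them the right limit. -/
lemma eval_psi_eq_zero_of_aeval_genChi {f : MvPolynomial PIdx ℂ} (hf : aeval genChi f = 0)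
    {s : ℂ} (hs : s ≠ 0) (t : ℂ) (e : Fin 4 → ℂ) : eval (psi s t e) f = 0 := by
  let h2 : ℂ := -e 0 / s ^ 2
  let h3 : ℂ := (-e 1 + 2 * s * t * h2) / s ^ 2
  let g : ℂ → Fin 4 → ℂ := fun ε => ![s ^ 3, s ^ 2 * t, s * t ^ 2 + ε ^ 2 * h2, t ^ 3 + ε ^ 2 * h3]
  let z : ℂ → W := fun ε => ofCoords
    ![-(ε ^ 2 * e 2 ^ 2), -(ε ^ 2 * (e 2 * e 3)), -(ε ^ 2 * e 3 ^ 2)]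
    ![-(s ^ 3 * h2), -(s ^ 3 * h3 - s ^ 2 * t * h2),
      -(s ^ 2 * t * h3 - 2 * s * t ^ 2 * h2) + ε ^ 2 * h2 ^ 2]
    (fun i => e 2 * g ε i) (fun i => e 3 * g ε i)
  have hchi : ∀ ε, ε ≠ 0 → z ε = chi (ε * e 2) (ε * e 3) (fun i => ε⁻¹ * g ε i) := by
    intro ε hε
    have k : ∀ (a b : Fin 3 → ℂ), a 0 = b 0 → a 1 = b 1 → a 2 = b 2 → a = b := by
      intro a b h0 h1 h2
      funext i
      fin_cases i <;> assumption
    have e1 : ∀ (q q' y y' : Fin 3 → ℂ) (u u' v v' : Fin 4 → ℂ), q = q' → y = y' → u = u' →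
        v = v' → ofCoords q y u v = ofCoords q' y' u' v' := by
      rintro _ _ _ _ _ _ _ _ rfl rfl rfl rfl; rfl
    refine e1 _ _ _ _ _ _ _ _ (k _ _ ?_ ?_ ?_) (k _ _ ?_ ?_ ?_) (funext fun i => ?_)
      (funext fun i => ?_)
    · simp; ring
    · simp; ring
    · simp; ring
    · simp [g]; field_simp; ring
    · simp [g]; field_simp; ring
    · simp [g]; field_simp; ring
    · field_simp
    · field_simp
  have hz0 : z 0 = psi s t e := by
    funext k
    revert k
    refine PIdx.forall_of ?_
    simp only [z, g, psi_apply, ofCoords]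
    refine ⟨?_, ?_, ?_, ?_, ?_, ?_, ?_, ?_, ?_, ?_, ?_, ?_, ?_, ?_, ?_, ?_, ?_, ?_, ?_, ?_, ?_⟩ <;>
      simp [h2, h3] <;> field_simp <;> ring
  have hcont : Continuous fun ε => eval (z ε) f := by
    refine (MvPolynomial.continuous_eval f).comp (continuous_pi ?_)
    refine PIdx.forall_of ?_
    simp only [z, g, ofCoords]
    refine ⟨?_, ?_, ?_, ?_, ?_, ?_, ?_, ?_, ?_, ?_, ?_, ?_, ?_, ?_, ?_, ?_, ?_, ?_, ?_, ?_, ?_⟩ <;>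
      simp <;> fun_prop
  have hzero : ∀ ε, ε ≠ 0 → eval (z ε) f = 0 := by
    intro ε hε
    have := eval_genChi ![ε * e 2, ε * e 3, ε⁻¹ * g ε 0, ε⁻¹ * g ε 1, ε⁻¹ * g ε 2, ε⁻¹ * g ε 3] f
    rw [hf, map_zero] at this
    rw [hchi ε hε, this]
    congr 3
    funext i
    fin_cases i <;> rfl
  have := Continuous.ext_on (dense_compl_singleton (0 : ℂ)) hcont continuous_const
    (g := fun _ => (0 : ℂ)) fun ε hε => hzero ε hε
  rw [← hz0]
  exact congrFun this 0

lemma aeval_genPsi_eq_zero_of_aeval_genChi {f : MvPolynomial PIdx ℂ} (hf : aeval genChi f = 0) :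
    aeval genPsi f = 0 := by
  have h0 : aeval genPsi f * X 0 = 0 := by
    refine MvPolynomial.funext fun c => ?_
    rw [map_mul, eval_aeval_genPsi, map_zero, eval_X]
    by_cases hc : c 0 = 0
    · rw [hc, mul_zero]
    · rw [eval_psi_eq_zero_of_aeval_genChi hf hc, zero_mul]
  simpa [X_ne_zero] using h0

lemma genPsi_04 : genPsi (ix 0 4) = 0 := by simp [genPsi, psi_apply, ofCoords]

lemma genPsi_24 : genPsi (ix 2 4) = X 0 ^ 3 * X 4 := by simp [genPsi, psi_apply, ofCoords]

/-- The ideal of the union of the 3-spaces is minimal over the ideal of the variety and the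
coordinate `q₀ = p₀₄`. -/
lemma idealOf_unionOfP3_mem_minimalPrimes : idealOf (unionOfP3 variety) ∈
    (idealOf variety ⊔ Ideal.span {X (ix 0 4)}).minimalPrimes := by
  refine ⟨⟨inferInstance, sup_le (idealOf_anti unionOfP3_subset) ?_⟩, ?_⟩
  · rw [Ideal.span_singleton_le_iff_mem, mem_idealOf_unionOfP3_iff, aeval_X, genPsi_04]
  · rintro Q ⟨hQ, hle⟩ hQP h hh
    have hQI : idealOf variety ≤ Q := le_sup_left.trans hle
    have hQX : X (ix 0 4) ∈ Q := hle (Ideal.mem_sup_right (Ideal.mem_span_singleton_self _))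
    -- on the open set `p₂₄ ≠ 0`, the coordinate `q₀` cuts out the union of the 3-spaces
    have hmem : X (ix 2 4) * h ∈ Q := by
      rw [← IsPrime.vanishingIdeal_zeroLocus (K := ℂ) Q]
      intro z hz
      rw [mem_zeroLocus_iff] at hz
      obtain ⟨hl, hp⟩ := isLin_of_aeval_eq_zero fun f hf => hz f (hQI hf)
      have hr := rel_of_pluPolar hl hl hp
      have hq0 : qc z 0 = 0 := by simpa [qc] using hz _ hQX
      rw [map_mul, aeval_X]
      by_cases hu : z (ix 2 4) = 0
      · rw [hu, zero_mul]
      · have hq1 : qc z 1 = 0 := by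
          have := hr.disc
          rw [hq0] at this
          simpa using this.symm
        have hq2 : qc z 2 = 0 := by
          have := hr.qu1 0
          rw [hq1] at this
          have hu0 : uc z 0 ≠ 0 := by simpa [uc] using hu
          simpa [hu0] using this.symm
        have hq : qc z = 0 := by
          funext i
          fin_cases i
          · exact hq0
          · exact hq1
          · exact hq2
        obtain ⟨s, t, e, he⟩ := exists_psi_of_rel hl hr hq
        have hz0 : z ≠ 0 := fun h0 => hu (by rw [h0]; rfl)
        rw [show aeval z h = 0 from hh z ⟨hz0, (mk_mem_unionOfP3_iff hz0).2 ⟨s, t, e, he⟩⟩,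
          mul_zero]
    refine (hQ.mem_or_mem hmem).resolve_left fun h24 => ?_
    have := (mem_idealOf_unionOfP3_iff _).1 (hQP h24)
    rw [aeval_X, genPsi_24] at this
    simp [X_ne_zero] at this

/-- The ideal of the union of the 3-spaces has height one modulo the ideal of the variety. The lower
bound comes from the kernel of `genChi`, which does not contain `q₀`. -/
lemma height_idealOf_unionOfP3 :
    ((idealOf (unionOfP3 variety)).map (Ideal.Quotient.mk (idealOf variety))).height = 1 := by
  refine le_antisymm
    (Ideal.map_height_le_one_of_mem_minimalPrimes idealOf_unionOfP3_mem_minimalPrimes) ?_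
  let Q : Ideal (MvPolynomial PIdx ℂ) :=
    RingHom.ker (aeval genChi : MvPolynomial PIdx ℂ →ₐ[ℂ] MvPolynomial (Fin 6) ℂ)
  have hQ : Q.IsPrime := RingHom.ker_isPrime _
  have hXQ : idealOf variety ≤ Q := fun f hf => aeval_genChi_eq_zero hf
  have hXP : idealOf variety ≤ idealOf (unionOfP3 variety) := idealOf_anti unionOfP3_subset
  have hQP : Q ≤ idealOf (unionOfP3 variety) := fun f hf =>
    (mem_idealOf_unionOfP3_iff f).2 (aeval_genPsi_eq_zero_of_aeval_genChi hf)
  have hprime : ∀ J : Ideal (MvPolynomial PIdx ℂ), J.IsPrime → idealOf variety ≤ J →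
      (J.map (Ideal.Quotient.mk (idealOf variety))).IsPrime := fun J hJ hle =>
    Ideal.map_isPrime_of_surjective Ideal.Quotient.mk_surjective (by rwa [Ideal.mk_ker])
  have := hprime Q hQ hXQ
  have := hprime _ isPrime_idealOf_unionOfP3 hXP
  refine le_trans le_add_self (Ideal.height_add_one_le_of_lt_of_isPrime
    (I := Q.map (Ideal.Quotient.mk (idealOf variety))) (lt_of_le_of_ne (Ideal.map_mono hQP) ?_))
  intro h
  have h1 : Ideal.Quotient.mk (idealOf variety) (X (ix 0 4)) ∈
      (idealOf (unionOfP3 variety)).map (Ideal.Quotient.mk (idealOf variety)) := by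
    refine Ideal.mem_map_of_mem _ ((mem_idealOf_unionOfP3_iff _).2 ?_)
    rw [aeval_X, genPsi_04]
  rw [← h, Ideal.mem_quotient_iff_mem hXQ] at h1
  have h2 : aeval genChi (X (ix 0 4) : MvPolynomial PIdx ℂ) = 0 := h1
  rw [aeval_X] at h2
  simp [genChi, chi, ofCoords, X_ne_zero] at h2

theorem unionOfP3_isDivisorIn : IsDivisorIn (unionOfP3 variety) variety := by
  refine ⟨unionOfP3_isZariskiClosed, unionOfP3_subset, fun P hP => ?_⟩
  rw [Ideal.minimalPrimes_eq_subsingleton_self, Set.mem_singleton_iff] at hP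
  rw [hP, height_idealOf_unionOfP3]

end Divisor

/-! ### The Hilbert function of the union of the 3-spaces -/

section Degree

/-- The forms of degree `d` on the union of the 3-spaces, as polynomials in the six parameters of
the generic point. -/
def psiForms (d : ℕ) : Submodule ℂ (MvPolynomial (Fin 6) ℂ) :=
  (homogeneousSubmodule PIdx ℂ d).map (aeval genPsi : MvPolynomial PIdx ℂ →ₐ[ℂ] _).toLinearMap

lemma mul_mem_psiForms {d e : ℕ} {f g : MvPolynomial (Fin 6) ℂ} (hf : f ∈ psiForms d)
    (hg : g ∈ psiForms e) : f * g ∈ psiForms (d + e) := by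
  obtain ⟨f, hf, rfl⟩ := hf
  obtain ⟨g, hg, rfl⟩ := hg
  exact ⟨f * g, IsHomogeneous.mul hf hg,
    map_mul (aeval genPsi : MvPolynomial PIdx ℂ →ₐ[ℂ] MvPolynomial (Fin 6) ℂ) f g⟩

lemma genPsi_mem_psiForms (k : PIdx) : genPsi k ∈ psiForms 1 :=
  ⟨X k, isHomogeneous_X ℂ k, aeval_X _ _⟩

lemma one_mem_psiForms : (1 : MvPolynomial (Fin 6) ℂ) ∈ psiForms 0 :=
  ⟨1, isHomogeneous_one _ _,
    map_one (aeval genPsi : MvPolynomial PIdx ℂ →ₐ[ℂ] MvPolynomial (Fin 6) ℂ)⟩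

lemma finrank_gradedPiece_idealOf_unionOfP3 (d : ℕ) :
    Module.finrank ℂ (GradedPiece (idealOf (unionOfP3 variety)) d) =
      Module.finrank ℂ (psiForms d) := by
  let f : homogeneousSubmodule PIdx ℂ d →ₗ[ℂ] MvPolynomial (Fin 6) ℂ :=
    (aeval genPsi : MvPolynomial PIdx ℂ →ₐ[ℂ] _).toLinearMap ∘ₗ Submodule.subtype _
  have hk : ((idealOf (unionOfP3 variety)).restrictScalars ℂ).comap
      (homogeneousSubmodule PIdx ℂ d).subtype = LinearMap.ker f := by
    ext g
    exact mem_idealOf_unionOfP3_iff _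
  have hr : LinearMap.range f = psiForms d := by
    rw [LinearMap.range_comp, Submodule.range_subtype]
    rfl
  rw [← hr]
  exact ((Submodule.quotEquivOfEq _ _ hk).trans f.quotKerEquivRange).finrank_eq

/-- The exponents of the monomials in `s, t, m, n, c, d` of degree `< K` in `m, n`, of total degree
`d` in `m, n, c, d`, and of degree `3d - 2k` in `s, t`, where `k` is the degree in `m, n`. -/
def psiExponents (K d : ℕ) : Finset (Fin 6 →₀ ℕ) :=
  ((Finset.range K).sigma fun k => Finset.range (k + 1) ×ˢ Finset.range (d - k + 1) ×ˢ
    Finset.range (3 * d - 2 * k + 1)).image fun x => Finsupp.equivFunOnFinite.symm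
      ![x.2.2.2, 3 * d - 2 * x.1 - x.2.2.2, x.2.1, x.1 - x.2.1, x.2.2.1, d - x.1 - x.2.2.1]

lemma mem_psiExponents {K d : ℕ} (hK : K ≤ d + 1) (m : Fin 6 →₀ ℕ) : m ∈ psiExponents K d ↔
    m 2 + m 3 < K ∧ m 2 + m 3 + m 4 + m 5 = d ∧ m 0 + m 1 + 2 * (m 2 + m 3) = 3 * d := by
  simp only [psiExponents, Finset.mem_image, Finset.mem_sigma, Finset.mem_product, Finset.mem_range]
  constructor
  · rintro ⟨⟨k, a, b, c⟩, ⟨h1, h2, h3, h4⟩, rfl⟩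
    simp at h1 h2 h3 h4 ⊢
    omega
  · rintro ⟨h1, h2, h3⟩
    refine ⟨⟨m 2 + m 3, m 2, m 4, m 0⟩, ⟨h1, by simp, by simp; omega, by simp; omega⟩, ?_⟩
    ext i
    fin_cases i <;> simp <;> omega

lemma card_psiExponents {K d : ℕ} : (psiExponents K d).card =
    ∑ k ∈ Finset.range K, (k + 1) * ((d - k + 1) * (3 * d - 2 * k + 1)) := by
  rw [psiExponents, Finset.card_image_of_injOn, Finset.card_sigma]
  · simp [Finset.card_product]
  · rintro ⟨k, a, b, c⟩ h ⟨k', a', b', c'⟩ h' he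
    simp only [Finset.coe_sigma, Set.mem_sigma_iff, Finset.mem_coe, Finset.mem_range,
      Finset.mem_product] at h h'
    have he := Finsupp.equivFunOnFinite.symm.injective he
    have h0 := congrFun he 0
    have h2 := congrFun he 2
    have h3 := congrFun he 3
    have h4 := congrFun he 4
    simp at h0 h2 h3 h4
    obtain rfl : k = k' := by omega
    subst h0 h2 h4
    rfl

/-- The bidegrees of the parameters for which the coordinates of the generic point all have bidegree
`(1, 3)`. -/
def psiWeight : Fin 6 → ℕ × ℕ := ![(0, 1), (0, 1), (1, 2), (1, 2), (1, 0), (1, 0)]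

/-- The entries of `ofCoords` are, up to sign, the given coordinates or zero. -/
lemma ofCoords_mem {A : Type} [CommRing A] (N : AddSubgroup A) {q y : Fin 3 → A} {u v : Fin 4 → A}
    (hq : ∀ i, q i ∈ N) (hy : ∀ i, y i ∈ N) (hu : ∀ i, u i ∈ N) (hv : ∀ i, v i ∈ N) (k : PIdx) :
    ofCoords q y u v k ∈ N := by
  revert k
  refine PIdx.forall_of ?_
  simp [ofCoords, hq, hy, hu, hv]

lemma isWeightedHomogeneous_genPsi (k : PIdx) :
    IsWeightedHomogeneous psiWeight (genPsi k) (1, 3) := by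
  have hX := isWeightedHomogeneous_X ℂ psiWeight
  have hu : ∀ (i : Fin 6) (a b : ℕ), a + b = 3 → psiWeight i = (1, 0) →
      IsWeightedHomogeneous psiWeight (X 0 ^ a * X 1 ^ b * X i : MvPolynomial (Fin 6) ℂ)
        (1, 3) := by
    intro i a b hab hi
    have := (((hX 0).pow a).mul ((hX 1).pow b)).mul (hX i)
    rw [hi] at this
    convert this using 1
    simp [psiWeight]
    omega
  have hy : ∀ i j : Fin 6, psiWeight i + psiWeight j = (1, 3) →
      IsWeightedHomogeneous psiWeight (X i * X j : MvPolynomial (Fin 6) ℂ) (1, 3) :=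
    fun i j h => h ▸ (hX i).mul (hX j)
  refine ofCoords_mem (weightedHomogeneousSubmodule ℂ psiWeight (1, 3)).toAddSubgroup
    (fun i => ?_) (fun i => ?_) (fun i => ?_) (fun i => ?_) k
  · exact isWeightedHomogeneous_zero ℂ psiWeight (1, 3)
  · fin_cases i
    · exact hy 0 2 rfl
    · exact (hy 0 3 rfl).add (hy 1 2 rfl)
    · exact hy 1 3 rfl
  · fin_cases i
    · simpa using hu 4 3 0 rfl rfl
    · simpa using hu 4 2 1 rfl rfl
    · simpa using hu 4 1 2 rfl rfl
    · simpa using hu 4 0 3 rfl rfl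
  · fin_cases i
    · simpa using hu 5 3 0 rfl rfl
    · simpa using hu 5 2 1 rfl rfl
    · simpa using hu 5 1 2 rfl rfl
    · simpa using hu 5 0 3 rfl rfl

lemma isWeightedHomogeneous_of_mem_psiForms {d : ℕ} {f : MvPolynomial (Fin 6) ℂ}
    (hf : f ∈ psiForms d) : IsWeightedHomogeneous psiWeight f (d, 3 * d) := by
  obtain ⟨g, hg, rfl⟩ := hf
  rw [AlgHom.toLinearMap_apply, aeval_def, eval₂_eq]
  refine IsWeightedHomogeneous.sum _ _ _ fun m hm => IsWeightedHomogeneous.C_mul ?_ _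
  have h := IsWeightedHomogeneous.prod m.support (fun i => genPsi i ^ m i) (fun i => m i • (1, 3))
    (w := psiWeight) fun i _ => (isWeightedHomogeneous_genPsi i).pow (m i)
  have hd : m.degree = d := by
    have := hg (mem_support_iff.1 hm)
    rw [Finsupp.degree_eq_weight_one]
    exact this
  convert h using 1
  rw [← Finset.sum_smul, show ∑ i ∈ m.support, m i = d from hd]
  simp [mul_comm]

/-- Only monomials of bidegree `(d, 3d)` occur in forms of degree `d`. -/
lemma psiForms_le (d : ℕ) : psiForms d ≤ Submodule.span ℂ
    ((fun m => monomial m (1 : ℂ)) '' (psiExponents (d + 1) d : Set (Fin 6 →₀ ℕ))) := by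
  intro f hf
  have hw := isWeightedHomogeneous_of_mem_psiForms hf
  rw [← support_sum_monomial_coeff f]
  refine Submodule.sum_mem _ fun m hm => ?_
  have h := hw (mem_support_iff.1 hm)
  rw [Finsupp.weight_apply, Finsupp.sum_fintype _ _ (by simp), Fin.sum_univ_six] at h
  simp [psiWeight] at h
  have : monomial m (coeff m f) = coeff m f • monomial m (1 : ℂ) := by
    rw [smul_monomial, smul_eq_mul, mul_one]
  rw [this]
  refine Submodule.smul_mem _ _ (Submodule.subset_span ⟨m, ?_, rfl⟩)
  rw [Finset.mem_coe, mem_psiExponents le_rfl]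
  omega

/-- A monomial in the parameters of the generic point. -/
def psiMonomial (i j k l p q : ℕ) : MvPolynomial (Fin 6) ℂ :=
  X 0 ^ i * X 1 ^ j * X 2 ^ k * X 3 ^ l * X 4 ^ p * X 5 ^ q

lemma monomial_eq_psiMonomial (m : Fin 6 →₀ ℕ) :
    monomial m (1 : ℂ) = psiMonomial (m 0) (m 1) (m 2) (m 3) (m 4) (m 5) := by
  rw [monomial_eq, C_1, one_mul, Finsupp.prod_fintype _ _ (by simp), Fin.prod_univ_six]
  rfl

lemma y_mem_psiForms : X 0 * X 2 ∈ psiForms 1 ∧ X 0 * X 3 + X 1 * X 2 ∈ psiForms 1 ∧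
    X 1 * X 3 ∈ psiForms 1 := by
  have h : yc genPsi = ![X 0 * X 2, X 0 * X 3 + X 1 * X 2, X 1 * X 3] := by
    rw [genPsi, psi_apply, yc_ofCoords]
    rfl
  have key : ∀ {a b}, a = b → a ∈ psiForms 1 → b ∈ psiForms 1 := by rintro _ _ rfl; exact id
  refine ⟨?_, ?_, ?_⟩
  · exact key (congrFun h 0) ((psiForms 1).neg_mem (genPsi_mem_psiForms (ix 2 6)))
  · exact key (congrFun h 1) (genPsi_mem_psiForms (ix 2 5))
  · exact key (congrFun h 2) ((psiForms 1).neg_mem (genPsi_mem_psiForms (ix 5 6)))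

lemma u_mem_psiForms {i j : ℕ} (h : i + j = 3) :
    X 0 ^ i * X 1 ^ j * X 4 ∈ psiForms 1 ∧ X 0 ^ i * X 1 ^ j * X 5 ∈ psiForms 1 := by
  have hu : uc genPsi =
      ![X 0 ^ 3 * X 4, X 0 ^ 2 * X 1 * X 4, X 0 * X 1 ^ 2 * X 4, X 1 ^ 3 * X 4] := by
    rw [genPsi, psi_apply, uc_ofCoords]
    rfl
  have hv : vc genPsi =
      ![X 0 ^ 3 * X 5, X 0 ^ 2 * X 1 * X 5, X 0 * X 1 ^ 2 * X 5, X 1 ^ 3 * X 5] := by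
    rw [genPsi, psi_apply, vc_ofCoords]
    rfl
  have key : ∀ {a b}, a = b → a ∈ psiForms 1 → b ∈ psiForms 1 := by rintro _ _ rfl; exact id
  have hi : i ≤ 3 := by omega
  obtain rfl : j = 3 - i := by omega
  interval_cases i
  · rw [pow_zero, one_mul]
    exact ⟨key (congrFun hu 3) (genPsi_mem_psiForms (ix 0 5)),
      key (congrFun hv 3) ((psiForms 1).neg_mem (genPsi_mem_psiForms (ix 1 5)))⟩
  · rw [pow_one]
    exact ⟨key (congrFun hu 2) ((psiForms 1).neg_mem (genPsi_mem_psiForms (ix 0 6))),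
      key (congrFun hv 2) (genPsi_mem_psiForms (ix 1 6))⟩
  · rw [pow_one]
    exact ⟨key (congrFun hu 1) ((psiForms 1).neg_mem (genPsi_mem_psiForms (ix 0 2))),
      key (congrFun hv 1) (genPsi_mem_psiForms (ix 1 2))⟩
  · rw [Nat.sub_self, pow_zero, mul_one]
    exact ⟨key (congrFun hu 0) (genPsi_mem_psiForms (ix 2 4)),
      key (congrFun hv 0) (genPsi_mem_psiForms (ix 2 3))⟩

/-- The case of degree zero in `m, n`: products of the coordinates `s^i t^j c` and `s^i t^j d`. -/
lemma psiMonomial_base (p q : ℕ) : ∀ i j, i + j = 3 * (p + q) →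
    psiMonomial i j 0 0 p q ∈ psiForms (p + q) := by
  induction p with
  | zero =>
    induction q with
    | zero =>
      intro i j h
      obtain ⟨rfl, rfl⟩ : i = 0 ∧ j = 0 := by omega
      simpa [psiMonomial] using one_mem_psiForms
    | succ q ih =>
      intro i j h
      have h1 := ih (i - min i 3) (j - (3 - min i 3)) (by omega)
      have h2 := (u_mem_psiForms (i := min i 3) (j := 3 - min i 3) (by omega)).2
      have h3 := mul_mem_psiForms h1 h2
      rw [add_assoc] at h3
      convert h3 using 1
      simp only [psiMonomial]
      have e1 : i = (i - min i 3) + min i 3 := by omega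
      have e2 : j = (j - (3 - min i 3)) + (3 - min i 3) := by omega
      conv_lhs => rw [e1, e2]
      ring
  | succ p ih =>
    intro i j h
    have h1 := ih (i - min i 3) (j - (3 - min i 3)) (by omega)
    have h2 := (u_mem_psiForms (i := min i 3) (j := 3 - min i 3) (by omega)).1
    have h3 := mul_mem_psiForms h1 h2
    rw [show p + q + 1 = p + 1 + q by ring] at h3
    convert h3 using 1
    simp only [psiMonomial]
    have e1 : i = (i - min i 3) + min i 3 := by omega
    have e2 : j = (j - (3 - min i 3)) + (3 - min i 3) := by omega
    conv_lhs => rw [e1, e2]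
    ring

/-- Every monomial of the right bidegree that involves `c` or `d` is a form on the union of the
3-spaces. The induction on the degree `r` in `m, n` splits off a factor `s m` or `t n`, or rewrites
`s n` or `t m` by means of `s n + t m`. For the latter it needs a factor `s²` or `t²`, which is
there because `c` and `d` come with cubes of `s` and `t`. -/
lemma psiMonomial_mem {p q : ℕ} (hpq : 0 < p + q) (r : ℕ) : ∀ i j k l, k + l = r →
    i + j = r + 3 * (p + q) → psiMonomial i j k l p q ∈ psiForms (r + (p + q)) := by
  obtain ⟨hy0, hy1, hy2⟩ := y_mem_psiForms
  induction r with
  | zero =>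
    intro i j k l hkl hij
    obtain ⟨rfl, rfl⟩ : k = 0 ∧ l = 0 := by omega
    rw [zero_add]
    exact psiMonomial_base p q i j (by omega)
  | succ r ih =>
    intro i j k l hkl hij
    have hmul : ∀ {f g}, f ∈ psiForms 1 → g ∈ psiForms (r + (p + q)) →
        f * g ∈ psiForms (r + 1 + (p + q)) := fun hf hg => by
      have := mul_mem_psiForms hf hg
      rwa [show 1 + (r + (p + q)) = r + 1 + (p + q) by ring] at this
    rcases k with _ | k
    · obtain rfl : l = r + 1 := by omega
      rcases j with _ | j
      · -- `s^i n^l = (sn + tm) s^(i-1) n^(l-1) - (sm) s^(i-2) t n^(l-1)`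
        obtain ⟨i, rfl⟩ : ∃ i', i = i' + 2 := ⟨i - 2, by omega⟩
        have h1 := hmul hy1 (ih (i + 1) 0 0 r (by omega) (by omega))
        have h2 := hmul hy0 (ih i 1 0 r (by omega) (by omega))
        convert (psiForms _).sub_mem h1 h2 using 1
        simp only [psiMonomial]
        ring
      · convert hmul hy2 (ih i j 0 r (by omega) (by omega)) using 1
        simp only [psiMonomial]
        ring
    · rcases i with _ | i
      · -- `t^j m^k n^l = (sn + tm) t^(j-1) m^(k-1) n^l - (tn) s t^(j-2) m^(k-1) n^l`
        obtain ⟨j, rfl⟩ : ∃ j', j = j' + 2 := ⟨j - 2, by omega⟩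
        have h1 := hmul hy1 (ih 0 (j + 1) k l (by omega) (by omega))
        have h2 := hmul hy2 (ih 1 j k l (by omega) (by omega))
        convert (psiForms _).sub_mem h1 h2 using 1
        simp only [psiMonomial]
        ring
      · convert hmul hy0 (ih i j k l (by omega) (by omega)) using 1
        simp only [psiMonomial]
        ring

/-- All monomials of bidegree `(d, 3d)` of degree less than `d` in `m, n` are forms of degree `d`.
-/
lemma le_psiForms (d : ℕ) : Submodule.span ℂ
    ((fun m => monomial m (1 : ℂ)) '' (psiExponents d d : Set (Fin 6 →₀ ℕ))) ≤ psiForms d := by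
  refine Submodule.span_le.2 ?_
  rintro _ ⟨m, hm, rfl⟩
  rw [Finset.mem_coe, mem_psiExponents (by omega)] at hm
  have h := psiMonomial_mem (p := m 4) (q := m 5) (by omega) _ (m 0) (m 1) (m 2) (m 3) rfl
    (by omega)
  rw [show m 2 + m 3 + (m 4 + m 5) = d by omega] at h
  change monomial m (1 : ℂ) ∈ psiForms d
  rw [monomial_eq_psiMonomial]
  exact h

lemma finrank_psiForms_bounds (d : ℕ) :
    ∑ k ∈ Finset.range d, (k + 1) * ((d - k + 1) * (3 * d - 2 * k + 1)) ≤
      Module.finrank ℂ (psiForms d) ∧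
    Module.finrank ℂ (psiForms d) ≤
      ∑ k ∈ Finset.range (d + 1), (k + 1) * ((d - k + 1) * (3 * d - 2 * k + 1)) := by
  have hfin : Module.Finite ℂ (Submodule.span ℂ ((fun m => monomial m (1 : ℂ)) ''
      (psiExponents (d + 1) d : Set (Fin 6 →₀ ℕ)))) :=
    Module.Finite.span_of_finite ℂ ((Finset.finite_toSet _).image _)
  have hfin' : Module.Finite ℂ (psiForms d) :=
    Submodule.finiteDimensional_of_le (psiForms_le d)
  have h1 := Submodule.finrank_mono (le_psiForms d)
  have h2 := Submodule.finrank_mono (psiForms_le d)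
  rw [finrank_span_monomials, card_psiExponents] at h1 h2
  exact ⟨h1, h2⟩

/-- The closed form of the sum of the dimensions of the bigraded pieces. -/
lemma sum_range_eq (x : ℝ) (n : ℕ) :
    ∑ k ∈ Finset.range n, ((k : ℝ) + 1) * ((x - k + 1) * (3 * x - 2 * k + 1)) =
      (x + 1) * (3 * x + 1) * n + ((x + 1) * (3 * x + 1) - 5 * x - 3) * (n * (n - 1) / 2)
        - (5 * x + 1) * (n * (n - 1) * (2 * n - 1) / 6) + (n * (n - 1)) ^ 2 / 2 := by
  induction n with
  | zero => simp
  | succ n ih =>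
    rw [Finset.sum_range_succ, ih]
    push_cast
    ring

lemma cast_sum_range {K d : ℕ} (hK : K ≤ d + 1) :
    ((∑ k ∈ Finset.range K, (k + 1) * ((d - k + 1) * (3 * d - 2 * k + 1)) : ℕ) : ℝ) =
      ∑ k ∈ Finset.range K, ((k : ℝ) + 1) * (((d : ℝ) - k + 1) * (3 * d - 2 * k + 1)) := by
  rw [Nat.cast_sum]
  refine Finset.sum_congr rfl fun k hk => ?_
  have hk := Finset.mem_range.1 hk
  rw [Nat.cast_mul, Nat.cast_mul, Nat.cast_add, Nat.cast_add, Nat.cast_add,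
    Nat.cast_sub (by omega), Nat.cast_sub (by omega)]
  push_cast
  ring

theorem unionOfP3_hasDimDegree : HasDimDegree (unionOfP3 variety) 4 8 := by
  refine ⟨by norm_num, ?_⟩
  -- for `d ≥ 1` the two sums in the bounds are at least `d⁴ / 3` and at most `d⁴ / 3 + 12 d³`
  have hlim : Filter.Tendsto (fun d : ℕ => (8 : ℝ) + 288 / (d : ℝ)) Filter.atTop (nhds 8) := by
    simpa using (tendsto_const_div_atTop_nhds_zero_nat 288).const_add (8 : ℝ)
  refine tendsto_of_tendsto_of_tendsto_of_le_of_le' (tendsto_const_nhds (x := ((8 : ℕ) : ℝ)))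
    (by simpa using hlim) ?_ ?_ <;>
  · filter_upwards [Filter.eventually_ge_atTop 1] with d hd
    obtain ⟨h1, h2⟩ := finrank_psiForms_bounds d
    rw [finrank_gradedPiece_idealOf_unionOfP3]
    have h1 : ((_ : ℕ) : ℝ) ≤ _ := Nat.cast_le.2 h1
    have h2 : _ ≤ ((_ : ℕ) : ℝ) := Nat.cast_le.2 h2
    rw [cast_sum_range (by omega), sum_range_eq] at h1 h2
    have hd : (1 : ℝ) ≤ d := by exact_mod_cast hd
    have hd4 : (0 : ℝ) < (d : ℝ) ^ 4 := by positivity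
    generalize (Module.finrank ℂ (psiForms d) : ℝ) = h at *
    push_cast at h1 h2 ⊢
    have f : ((Nat.factorial 4 : ℕ) : ℝ) = 24 := by norm_num [Nat.factorial]
    rw [f]
    first
    | rw [le_div_iff₀ hd4]
      nlinarith [pow_pos (lt_of_lt_of_le one_pos hd) 3]
    | rw [div_le_iff₀ hd4]
      have : (8 + 288 / (d : ℝ)) * (d : ℝ) ^ 4 = 8 * d ^ 4 + 288 * d ^ 3 := by field_simp
      rw [this]
      have h3 : (d : ℝ) ^ 2 ≤ d ^ 3 := by nlinarith [sq_nonneg (d : ℝ)]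
      have h4 : (d : ℝ) ≤ d ^ 2 := by nlinarith
      nlinarith

end Degree

end G2hat

end

open G2hat in
theorem mainTheorem9 :
    -- The Hilbert scheme of projective 3-spaces contained in `Ĝ₂` is isomorphic to a smooth conic,
    -- which lies in the plane `ℙ(j(ℂ³))` of `ℙ(V)`.
    (∃ (j : (Fin 3 → ℂ) →ₗ[ℂ] V) (M : Matrix (Fin 3) (Fin 3) ℂ)
      (e : ∀ (R : Type) [CommRing R] [Algebra ℂ R], HilbP3 variety R ≃ ConicPoint M R),
      Function.Injective j ∧ M.IsSymm ∧ M.det ≠ 0 ∧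
      -- The bijections `e` are natural: families of 3-spaces can be pulled back along every
      -- homomorphism of `ℂ`-algebras, and `e` commutes with pullback.
      (∀ (R S : Type) [CommRing R] [CommRing S] [Algebra ℂ R] [Algebra ℂ S] (φ : R →ₐ[ℂ] S)
        (Z : HilbP3 variety R), ∃ Z' : HilbP3 variety S,
          Z'.ideal = Z.ideal.map (MvPolynomial.map (φ : R →+* S)) ∧
          (e S Z').line.toSubmodule =
            Submodule.span S ((fun v : Fin 3 → R => fun i => φ (v i)) ''
              ((e R Z).line.toSubmodule : Set (Fin 3 → R)))) ∧
      -- The point of the conic given by a 3-space `Π` is the common point of the lines in `ℙ(V)`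
      -- that the points of `Π` represent.
      (∀ (Z : HilbP3 variety ℂ) (z : W), (∀ f ∈ Z.ideal, MvPolynomial.eval z f = 0) →
        ∃ v ∈ (e ℂ Z).line.toSubmodule, ∃ w : V, z = wedge (j v) w)) ∧
    -- The union of the 3-spaces is a divisor of degree 8 in `Ĝ₂`.
    IsDivisorIn (unionOfP3 variety) variety ∧ HasDimDegree (unionOfP3 variety) 4 8 := by
  refine ⟨⟨conicPlane, conicMatrix, fun R _ _ => hilbEquivConic R, conicPlane_injective, ?_, ?_,
    fun R S _ _ _ _ φ Z => hilbEquivConic_natural φ Z, exists_common_point⟩,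
    unionOfP3_isDivisorIn, unionOfP3_hasDimDegree⟩
  · ext i j
    fin_cases i <;> fin_cases j <;> simp [conicMatrix]
  · simp [conicMatrix, Matrix.det_fin_three]
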